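/- Let $M$ be a smooth oriented surface, $\alpha : M \to \mathbb{R}^3$ an immersion of class $C^r$, $r \ge 6$, and $N$ its unit normal field (so that $(\alpha_u,\alpha_v,N)$ is a positive frame for every positive chart $(u,v)$). Let $\mathcal{K}$ and $\mathcal{H}$ be the Gaussian and the arithmetic mean curvature of $\alpha$. On the region where $\mathcal{K} > 0$ and which contains no umbilic points, a *geometric mean curvature line* is a regular curve whose normal curvature equals $\sqrt{\mathcal{K}}$; it is called *maximal* (resp. *minimal*) if its geodesic torsion $\tau_g = \langle (N\wedge T)', N\rangle$ is positive (resp. negative), where $T$ is the unit tangent and the derivative is with respect to arc length. Let $c$ be a maximal (resp. minimal) geometric mean curvature cycle, i.e. a periodic leaf of the foliation by maximal (resp. minimal) geometric mean curvature lines, parametrized by arc length $s$ and of total length $L$. Let $k_g = \langle T', N\wedge T\rangle$ be its geodesic curvature, $T = (\alpha\circ c)'$, and let $[\sqrt{\mathcal{K}}]_v$ denote the derivative of $\sqrt{\mathcal{K}}$, at $c(s)$, in the tangent direction $N\wedge T$ normal to the cycle. Then along $c$ $$\tau_g = \sqrt[4]{\mathcal{K}}\,\sqrt{2\mathcal{H}-2\sqrt{\mathcal{K}}}\qquad\Big(\text{resp.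 } \tau_g = -\sqrt[4]{\mathcal{K}}\,\sqrt{2\mathcal{H}-2\sqrt{\mathcal{K}}}\Big).$$ Moreover, let $\Sigma$ be a $C^1$ curve transversal to $c$ at $c(0)$, with a regular $C^1$ parameter vanishing at $c(0)$. The Poincaré first return map $\pi$ of the cycle is defined by following, in the direction of $c$, the leaves of the same foliation from points of $\Sigma$ near $c(0)$ until they first meet a small piece of $\Sigma$ around $c(0)$ again. It exists as a germ at $0$, and, expressed in the parameter of $\Sigma$, satisfies $\pi(0) = 0$, is differentiable at $0$ with $\pi'(0) > 0$, and $$\ln \pi'(0) = \int_0^L \left[ \frac{[\sqrt{\mathcal{K}}]_v}{2\tau_g} + \frac{k_g}{\tau_g}\big(\mathcal{H} - \sqrt{\mathcal{K}}\big) \right] ds,$$ where the integrand is integrable on $[0,L]$. -/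

import Mathlib

open scoped Manifold ContDiff Topology

noncomputable section

namespace GeomMeanCurv

/-- The coordinate plane on which surfaces are modelled. -/
abbrev E2 : Type := EuclideanSpace ℝ (Fin 2)

/-- Euclidean three-space. -/
abbrev E3 : Type := EuclideanSpace ℝ (Fin 3)

/-- The vector product of oriented Euclidean three-space. -/
def wedge (a b : E3) : E3 :=
  WithLp.toLp 2 (crossProduct (WithLp.ofLp a) (WithLp.ofLp b))

section Surface

variable {M : Type*} [TopologicalSpace M] [ChartedSpace E2 M]

/-- The differential at `p` of a map from the surface to Euclidean three-space. -/
def diff (f : M → E3) (p : M) : TangentSpace (𝓡 2) p →L[ℝ] E3 :=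
  mfderiv (𝓡 2) 𝓘(ℝ, E3) f p

/-- The velocity `γ'(t)`, a tangent vector of the surface at `γ t`. -/
def velocity (γ : ℝ → M) (t : ℝ) : TangentSpace (𝓡 2) (γ t) :=
  mfderiv 𝓘(ℝ, ℝ) (𝓡 2) γ t (1 : ℝ)

/-- `α` is an immersion of class `C^r` of the surface in Euclidean three-space. -/
structure IsImmersionOfClass (r : ℕ∞) (α : M → E3) : Prop where
  contMDiff : ContMDiff (𝓡 2) 𝓘(ℝ, E3) (r : WithTop ℕ∞) α
  injective_diff : ∀ p : M, Function.Injective (diff α p)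

/-- `N` is a continuous unit normal field along `α`.  For an immersion of class `C^r` such a field
is the same thing as an orientation of the surface (a chart `(u, v)` is positive when
`(α_u, α_v, N)` is a positive frame), and it is automatically of class `C^(r-1)`. -/
structure IsUnitNormal (α N : M → E3) : Prop where
  continuous : Continuous N
  norm_eq_one : ∀ p : M, ‖N p‖ = 1
  orthogonal : ∀ (p : M) (X : TangentSpace (𝓡 2) p), inner ℝ (N p) (diff α p X) = 0

/-- The first fundamental form `⟨dα, dα⟩`. -/
def firstForm (α : M → E3) (p : M) (X Y : TangentSpace (𝓡 2) p) : ℝ :=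
  inner ℝ (diff α p X) (diff α p Y)

/-- The second fundamental form `⟨N, D²α⟩ = -⟨dN, dα⟩`. -/
def secondForm (α N : M → E3) (p : M) (X Y : TangentSpace (𝓡 2) p) : ℝ :=
  -inner ℝ (diff N p X) (diff α p Y)

/-- The coordinate tangent vectors at `p` of the preferred chart at `p`. -/
def coordVec (p : M) (i : Fin 2) : TangentSpace (𝓡 2) p :=
  (EuclideanSpace.single i (1 : ℝ) : E2)

/-- The Gaussian curvature `(eg - f²) / (EG - F²)`. -/
def gaussCurv (α N : M → E3) (p : M) : ℝ :=
  (secondForm α N p (coordVec p 0) (coordVec p 0) * secondForm α N p (coordVec p 1) (coordVec p 1)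
      - secondForm α N p (coordVec p 0) (coordVec p 1) ^ 2) /
    (firstForm α p (coordVec p 0) (coordVec p 0) * firstForm α p (coordVec p 1) (coordVec p 1)
      - firstForm α p (coordVec p 0) (coordVec p 1) ^ 2)

/-- The (arithmetic) mean curvature `(eG - 2fF + gE) / (2(EG - F²))`. -/
def meanCurv (α N : M → E3) (p : M) : ℝ :=
  (secondForm α N p (coordVec p 0) (coordVec p 0) * firstForm α p (coordVec p 1) (coordVec p 1)
      - 2 * secondForm α N p (coordVec p 0) (coordVec p 1)
          * firstForm α p (coordVec p 0) (coordVec p 1)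
      + secondForm α N p (coordVec p 1) (coordVec p 1)
          * firstForm α p (coordVec p 0) (coordVec p 0)) /
    (2 * (firstForm α p (coordVec p 0) (coordVec p 0) * firstForm α p (coordVec p 1) (coordVec p 1)
      - firstForm α p (coordVec p 0) (coordVec p 1) ^ 2))

/-- The normal curvature in the direction of the nonzero tangent vector `X`. -/
def normalCurv (α N : M → E3) (p : M) (X : TangentSpace (𝓡 2) p) : ℝ :=
  secondForm α N p X X / firstForm α p X X

/-- The geodesic torsion in the direction of the nonzero tangent vector `X`.  Along a unit speed
curve with tangent `T` it is `τ_g = ⟨(N ∧ T)', N⟩ = -⟨N', N ∧ T⟩`. -/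
def geodTorsion (α N : M → E3) (p : M) (X : TangentSpace (𝓡 2) p) : ℝ :=
  -inner ℝ (diff N p X) (wedge (N p) (diff α p X)) / firstForm α p X X

/-- The geodesic curvature `k_g = ⟨T', N ∧ T⟩`, `T = (α ∘ c)'`, of a unit speed curve `c`. -/
def geodCurv (α N : M → E3) (c : ℝ → M) (s : ℝ) : ℝ :=
  inner ℝ (deriv (deriv (α ∘ c)) s) (wedge (N (c s)) (deriv (α ∘ c) s))

/-- The tangent vector at `p` whose image under the (injective) differential of `α` is `w`. -/
def tangentLift (α : M → E3) (p : M) (w : E3) : TangentSpace (𝓡 2) p :=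
  Function.invFun (diff α p) w

/-- The derivative `[√K]_v` at `c s`: the derivative of the function `√K` on the surface in the
direction of the tangent vector `N ∧ T`, where `T = (α ∘ c)'(s)`. -/
def sqrtCurvDeriv (α N : M → E3) (c : ℝ → M) (s : ℝ) : ℝ :=
  mfderiv (𝓡 2) 𝓘(ℝ, ℝ) (fun q : M => √(gaussCurv α N q)) (c s)
    (tangentLift α (c s) (wedge (N (c s)) (deriv (α ∘ c) s)))

/-- The two geometric mean curvature foliations. -/
inductive Kind : Type
  | maximal
  | minimal

/-- The sign of the geodesic torsion along the leaves of each of the two foliations. -/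
def Kind.sign : Kind → ℝ
  | Kind.maximal => 1
  | Kind.minimal => -1

/-- `γ`, restricted to the open set `J` of parameters, is a maximal (resp. minimal) line of
geometric mean curvature: a regular curve in the non-umbilic part of the elliptic region whose
normal curvature is `√K`, with positive (resp. negative) geodesic torsion. -/
structure IsLine (κ : Kind) (α N : M → E3) (γ : ℝ → M) (J : Set ℝ) : Prop where
  contMDiffOn : ContMDiffOn 𝓘(ℝ, ℝ) (𝓡 2) 1 γ J
  regular : ∀ t ∈ J, velocity γ t ≠ 0
  elliptic : ∀ t ∈ J, 0 < gaussCurv α N (γ t)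
  nonumbilic : ∀ t ∈ J, meanCurv α N (γ t) ^ 2 ≠ gaussCurv α N (γ t)
  normalCurv_eq : ∀ t ∈ J, normalCurv α N (γ t) (velocity γ t) = √(gaussCurv α N (γ t))
  torsion_sign : ∀ t ∈ J, 0 < κ.sign * geodTorsion α N (γ t) (velocity γ t)

/-- `c` is a maximal (resp. minimal) geometric mean curvature cycle, that is, a periodic leaf of
the foliation, parametrized by arc length and of total length `L`. -/
structure IsCycle (κ : Kind) (α N : M → E3) (c : ℝ → M) (L : ℝ) : Prop where
  isLine : IsLine κ α N c Set.univ
  unit_speed : ∀ s : ℝ, ‖diff α (c s) (velocity c s)‖ = 1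
  length_pos : 0 < L
  periodic : Function.Periodic c L
  injOn : Set.InjOn c (Set.Ico 0 L)

/-- `σ` parametrizes, near the parameter `0`, a `C^1` cross section to `c` at `c 0`. -/
structure IsCrossSection (α : M → E3) (c σ : ℝ → M) : Prop where
  base : σ 0 = c 0
  contMDiffAt : ContMDiffAt 𝓘(ℝ, ℝ) (𝓡 2) 1 σ 0
  transversal : LinearIndependent ℝ ![deriv (α ∘ c) 0, deriv (α ∘ σ) 0]

/-- `P` is (a representative of the germ at `0` of) the Poincaré first return map of the cycle `c`
on the cross section `σ`, expressed in the parameter of `σ`: for every small enough section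
`Σ_δ = σ (-δ, δ)` and every `v` close enough to `0`, the line through `σ v` of the foliation of the
cycle, followed in the direction of `c`, meets `Σ_δ` again for the first time at `σ (P v)`. -/
def IsReturnMap (κ : Kind) (α N : M → E3) (c σ : ℝ → M) (P : ℝ → ℝ) : Prop :=
  ∀ᶠ δ in 𝓝[>] (0 : ℝ), ∀ᶠ v in 𝓝 (0 : ℝ),
    ∃ (γ : ℝ → M) (a b t₁ : ℝ), a < 0 ∧ 0 < t₁ ∧ t₁ < b ∧
      IsLine κ α N γ (Set.Ioo a b) ∧
      γ 0 = σ v ∧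
      0 < inner ℝ (deriv (α ∘ γ) 0) (deriv (α ∘ c) 0) ∧
      P v ∈ Set.Ioo (-δ) δ ∧
      γ t₁ = σ (P v) ∧
      ∀ t ∈ Set.Ioo 0 t₁, γ t ∉ σ '' Set.Ioo (-δ) δ

/-- The function `[√K]_v / (2 τ_g) + (k_g / τ_g) (H - √K)` of the arc length `s` along `c`. -/
def returnIntegrand (α N : M → E3) (c : ℝ → M) (s : ℝ) : ℝ :=
  sqrtCurvDeriv α N c s / (2 * geodTorsion α N (c s) (velocity c s))
    + geodCurv α N c s / geodTorsion α N (c s) (velocity c s)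
        * (meanCurv α N (c s) - √(gaussCurv α N (c s)))

end Surface

end GeomMeanCurv

end

open GeomMeanCurv

open scoped Manifold ContDiff Topology
set_option linter.unusedSectionVars false

noncomputable section

namespace GeomMeanCurv

/-! Write `T` for the unit tangent, `Y = N ∧ T`, `τ` for the geodesic torsion and `m = √K`. In the
frame `T, Y` the second fundamental form has diagonal `m, 2H - m` and off-diagonal entry `τ`. Its
determinant is `K = m²`, so `τ² = m (2H - 2m)`, and the foliation fixes the sign. This is the first
claim (`exists_frame`, `geodTorsion_eq`).

For the return map, take coordinates `(s, w)` on a strip along the cycle with `w = 0` on the cycle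
and `∂/∂w = Y` there (`exists_isStrip`). Lines are the null directions of the quadratic form `II - m
I` with coefficients `e, f, g`, so as graphs `w(s)` they satisfy `w' = p(s, w)`, where `p` is a root
of `e + 2 f p + g p² = 0`. On the axis `e = 0` and `f = τ ≠ 0`, so the root vanishing there is
smooth and `p_w = -e_w / (2τ)`. Differentiating `e = -⟨N_s, α_s⟩ - m ⟨α_s, α_s⟩` in `w`, exchanging
the mixed derivatives and using the frame equations gives `e_w = τ' + 2 (m - H) k_g - m_w`. Hence
`p_w` is the integrand of the theorem minus `τ' / (2τ)` (`IsStrip.fderiv_slope`). That extra term is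
the derivative of `(1/2) log |τ|`, which is periodic, and it integrates to zero.

Solutions near `w = 0` exist for the whole turn and satisfy `w(s) = w(s₀) (exp ∫ p_w + o(1))`
(`exists_flow`, `flow_asymptotics`). The strip is not closed up: the section is a graph over `w`
once near `s = 0` and once near `s = L`. At both places `w` has the same derivative `⟨Y, σ'(0)⟩`
with respect to the parameter of the section, so this factor cancels and the derivative of the
return map is `exp ∫ p_w` (`IsStrip.exists_return`, `IsStrip.exists_isReturnMap`).

The theorem speaks of every return map, defined through lines that are merely `C^1` with an
arbitrary regular parameter. The direction of a line of given kind is determined by the point up to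
sign. After passing to arc length, lines solve a `C^4` differential equation in a chart and are
determined by initial point and orientation. So any two return maps have the same germ
(`IsReturnMap.eventuallyEq`). -/

/-! ### Vector algebra of oriented three-space -/

theorem inner_eq (a b : E3) : inner ℝ a b = a 0 * b 0 + a 1 * b 1 + a 2 * b 2 := by
  simp [PiLp.inner_apply, Fin.sum_univ_three]; ring

theorem wedge_apply_zero (a b : E3) : wedge a b 0 = a 1 * b 2 - a 2 * b 1 := by
  simp [wedge, crossProduct]

theorem wedge_apply_one (a b : E3) : wedge a b 1 = a 2 * b 0 - a 0 * b 2 := by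
  simp [wedge, crossProduct]

theorem wedge_apply_two (a b : E3) : wedge a b 2 = a 0 * b 1 - a 1 * b 0 := by
  simp [wedge, crossProduct]

theorem inner_wedge_left (a b : E3) : inner ℝ (wedge a b) a = 0 := by
  rw [inner_eq, wedge_apply_zero, wedge_apply_one, wedge_apply_two]; ring

theorem inner_wedge_right (a b : E3) : inner ℝ (wedge a b) b = 0 := by
  rw [inner_eq, wedge_apply_zero, wedge_apply_one, wedge_apply_two]; ring

theorem inner_wedge_wedge (a b : E3) :
    inner ℝ (wedge a b) (wedge a b) = inner ℝ a a * inner ℝ b b - inner ℝ a b ^ 2 := by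
  simp only [inner_eq, wedge_apply_zero, wedge_apply_one, wedge_apply_two]; ring

theorem wedge_smul (a b : E3) (r : ℝ) : wedge a (r • b) = r • wedge a b := by
  simp [wedge]

theorem wedge_wedge (a b c : E3) :
    wedge a (wedge b c) = (inner ℝ a c : ℝ) • b - (inner ℝ a b : ℝ) • c := by
  ext i
  fin_cases i <;> simp [inner_eq, wedge_apply_zero, wedge_apply_one, wedge_apply_two] <;> ring

/-- The vector product as a continuous bilinear map. -/
def wedgeL : E3 →L[ℝ] E3 →L[ℝ] E3 :=
  LinearMap.toContinuousLinearMap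
    { toFun := fun a => LinearMap.toContinuousLinearMap
        { toFun := fun b => wedge a b
          map_add' := fun b c => by simp [wedge]
          map_smul' := fun r b => by simp [wedge] }
      map_add' := fun a b => by ext c : 1; simp [wedge]
      map_smul' := fun r b => by ext c : 1; simp [wedge] }

theorem wedgeL_apply (a b : E3) : wedgeL a b = wedge a b := rfl

/-- Expansion of a vector in the orthonormal frame `t, n ∧ t, n`. -/
theorem eq_frame {n t : E3} (hn : inner ℝ n n = 1) (ht : inner ℝ t t = 1) (hnt : inner ℝ n t = 0)
    (x : E3) :
    x = inner ℝ t x • t + inner ℝ (wedge n t) x • wedge n t + inner ℝ n x • n := by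
  have key : inner ℝ (wedge n t) (wedge n t) = 1 := by rw [inner_wedge_wedge, hn, ht, hnt]; norm_num
  have h : Orthonormal ℝ ![t, wedge n t, n] := by
    rw [orthonormal_iff_ite]
    have e1 := inner_wedge_left n t
    have e2 := inner_wedge_right n t
    have e3 : inner ℝ n (wedge n t) = 0 := by rw [real_inner_comm, e1]
    have e4 : inner ℝ t (wedge n t) = 0 := by rw [real_inner_comm, e2]
    have e5 : inner ℝ t n = 0 := by rw [real_inner_comm, hnt]
    rw [real_inner_self_eq_norm_sq] at hn ht key
    intro i j
    fin_cases i <;> fin_cases j <;> simp_all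
  let b := (basisOfOrthonormalOfCardEqFinrank h (by simp)).toOrthonormalBasis (by simpa using h)
  have hb := b.sum_repr' x
  simp only [Fin.sum_univ_three] at hb
  simpa [b] using hb.symm

theorem inner_frame {n t : E3} (hn : inner ℝ n n = 1) (ht : inner ℝ t t = 1)
    (hnt : inner ℝ n t = 0) (x y : E3) :
    inner ℝ x y = inner ℝ t x * inner ℝ t y + inner ℝ (wedge n t) x * inner ℝ (wedge n t) y
      + inner ℝ n x * inner ℝ n y := by
  conv_lhs => rw [eq_frame hn ht hnt x]
  simp [inner_add_left, inner_smul_left]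

/-! ### The fundamental forms at one point -/

section Pointwise

variable {M : Type*} [TopologicalSpace M] [ChartedSpace E2 M] {α N : M → E3} {p : M}

theorem tangent_eq (X : TangentSpace (𝓡 2) p) :
    ∃ x y : ℝ, X = x • coordVec p 0 + y • coordVec p 1 := by
  let X' : E2 := X
  refine ⟨X' 0, X' 1, ?_⟩
  change X' = X' 0 • (EuclideanSpace.single 0 (1 : ℝ) : E2)
    + X' 1 • (EuclideanSpace.single 1 (1 : ℝ) : E2)
  ext i
  fin_cases i <;> simp

theorem firstForm_add_left (X Y Z : TangentSpace (𝓡 2) p) :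
    firstForm α p (X + Y) Z = firstForm α p X Z + firstForm α p Y Z := by
  simp [firstForm, inner_add_left]

theorem firstForm_smul_left (r : ℝ) (X Z : TangentSpace (𝓡 2) p) :
    firstForm α p (r • X) Z = r * firstForm α p X Z := by
  simp [firstForm, inner_smul_left]

theorem firstForm_comm (X Y : TangentSpace (𝓡 2) p) : firstForm α p X Y = firstForm α p Y X :=
  real_inner_comm _ _

theorem firstForm_add_right (X Y Z : TangentSpace (𝓡 2) p) :
    firstForm α p Z (X + Y) = firstForm α p Z X + firstForm α p Z Y := by
  simp [firstForm, inner_add_right]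

theorem firstForm_smul_right (r : ℝ) (X Z : TangentSpace (𝓡 2) p) :
    firstForm α p Z (r • X) = r * firstForm α p Z X := by
  simp [firstForm, inner_smul_right]

theorem secondForm_add_left (X Y Z : TangentSpace (𝓡 2) p) :
    secondForm α N p (X + Y) Z = secondForm α N p X Z + secondForm α N p Y Z := by
  simp [secondForm, inner_add_left]; ring

theorem secondForm_smul_left (r : ℝ) (X Z : TangentSpace (𝓡 2) p) :
    secondForm α N p (r • X) Z = r * secondForm α N p X Z := by
  simp [secondForm, inner_smul_left]

theorem secondForm_add_right (X Y Z : TangentSpace (𝓡 2) p) :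
    secondForm α N p Z (X + Y) = secondForm α N p Z X + secondForm α N p Z Y := by
  simp [secondForm, inner_add_right]; ring

theorem secondForm_smul_right (r : ℝ) (X Z : TangentSpace (𝓡 2) p) :
    secondForm α N p Z (r • X) = r * secondForm α N p Z X := by
  simp [secondForm, inner_smul_right]

theorem firstForm_pos (hi : Function.Injective (diff α p)) {X : TangentSpace (𝓡 2) p}
    (hX : X ≠ 0) : 0 < firstForm α p X X := by
  rw [firstForm, real_inner_self_pos]
  intro h
  exact hX (hi (h.trans (map_zero _).symm))

/-- Gram–Schmidt: `E` times the squared length of `e₁ - (F / E) e₀`, a nonzero vector, is `E G -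
F²`. -/
theorem coordDet_pos (hi : Function.Injective (diff α p)) :
    0 < firstForm α p (coordVec p 0) (coordVec p 0) * firstForm α p (coordVec p 1) (coordVec p 1)
      - firstForm α p (coordVec p 0) (coordVec p 1) ^ 2 := by
  have h0 : (coordVec p 0 : TangentSpace (𝓡 2) p) ≠ 0 := by
    intro h
    have : (EuclideanSpace.single 0 (1 : ℝ) : E2) 0 = 0 := by
      change (EuclideanSpace.single 0 (1 : ℝ) : E2) = 0 at h
      rw [h]; simp
    simp at this
  have h1 (r : ℝ) : coordVec p 1 + r • coordVec p 0 ≠ 0 := by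
    intro h
    have : ((EuclideanSpace.single 1 (1 : ℝ) : E2) + r • (EuclideanSpace.single 0 (1 : ℝ) : E2)) 1
        = 0 := by
      change (EuclideanSpace.single 1 (1 : ℝ) : E2) + r • (EuclideanSpace.single 0 (1 : ℝ) : E2) = 0
        at h
      rw [h]; simp
    simp at this
  have hE := firstForm_pos hi h0
  set E := firstForm α p (coordVec p 0) (coordVec p 0) with hEdef
  have hG := firstForm_pos hi (h1 (-(firstForm α p (coordVec p 0) (coordVec p 1)) / E))
  simp only [firstForm_add_left, firstForm_add_right, firstForm_smul_left, firstForm_smul_right,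
    firstForm_comm (coordVec p 1) (coordVec p 0), ← hEdef] at hG
  have := mul_pos hE hG
  field_simp at this
  nlinarith

/-- The curvature is defined with the coordinate vectors of one chart. Passing to `X, Y` multiplies
both Gram determinants by the square of the change-of-basis determinant, so the relation holds for
every pair, even a dependent one. The same scaling, polarized, gives `meanCurv_mul`. Together they
allow `K` and `H` to be computed in any frame or parametrization. -/
theorem gaussCurv_mul (hi : Function.Injective (diff α p))
    (hs : ∀ X Y, secondForm α N p X Y = secondForm α N p Y X) (X Y : TangentSpace (𝓡 2) p) :
    gaussCurv α N p * (firstForm α p X X * firstForm α p Y Y - firstForm α p X Y ^ 2) =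
      secondForm α N p X X * secondForm α N p Y Y - secondForm α N p X Y ^ 2 := by
  obtain ⟨a, b, rfl⟩ := tangent_eq X
  obtain ⟨c, d, rfl⟩ := tangent_eq Y
  have hD := (coordDet_pos hi).ne'
  unfold gaussCurv
  simp only [firstForm_add_left, firstForm_add_right, firstForm_smul_left, firstForm_smul_right,
    firstForm_comm (coordVec p 1) (coordVec p 0), secondForm_add_left, secondForm_add_right,
    secondForm_smul_left, secondForm_smul_right, hs (coordVec p 1) (coordVec p 0)]
  rw [div_mul_eq_mul_div, div_eq_iff hD]
  ring

theorem meanCurv_mul (hi : Function.Injective (diff α p))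
    (hs : ∀ X Y, secondForm α N p X Y = secondForm α N p Y X) (X Y : TangentSpace (𝓡 2) p) :
    2 * meanCurv α N p * (firstForm α p X X * firstForm α p Y Y - firstForm α p X Y ^ 2) =
      secondForm α N p X X * firstForm α p Y Y - 2 * secondForm α N p X Y * firstForm α p X Y
        + secondForm α N p Y Y * firstForm α p X X := by
  obtain ⟨a, b, rfl⟩ := tangent_eq X
  obtain ⟨c, d, rfl⟩ := tangent_eq Y
  have hD := (coordDet_pos hi).ne'
  unfold meanCurv
  simp only [firstForm_add_left, firstForm_add_right, firstForm_smul_left, firstForm_smul_right,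
    firstForm_comm (coordVec p 1) (coordVec p 0), secondForm_add_left, secondForm_add_right,
    secondForm_smul_left, secondForm_smul_right, hs (coordVec p 1) (coordVec p 0)]
  rw [mul_div_assoc', div_mul_eq_mul_div, div_eq_iff (by positivity)]
  ring

/-- Dimension count: the image of the differential is a plane contained in the plane orthogonal to
`N p`. -/
theorem exists_diff_eq (hi : Function.Injective (diff α p)) (hn : N p ≠ 0)
    (ho : ∀ X : TangentSpace (𝓡 2) p, inner ℝ (N p) (diff α p X) = 0) {w : E3}
    (hw : inner ℝ (N p) w = 0) : ∃ Y : TangentSpace (𝓡 2) p, diff α p Y = w := by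
  have hle : (diff α p).toLinearMap.range ≤ (ℝ ∙ (N p))ᗮ := by
    rintro _ ⟨X, rfl⟩
    exact Submodule.mem_orthogonal_singleton_iff_inner_right.2 (ho X)
  have h2 : Module.finrank ℝ (TangentSpace (𝓡 2) p) = 2 := by
    change Module.finrank ℝ E2 = 2
    simp
  have : FiniteDimensional ℝ (TangentSpace (𝓡 2) p) :=
    inferInstanceAs (FiniteDimensional ℝ E2)
  have h1 : Module.finrank ℝ (diff α p).toLinearMap.range = 2 := by
    rw [LinearMap.finrank_range_of_inj hi, h2]
  have h3 : Module.finrank ℝ (ℝ ∙ (N p))ᗮ = 2 := by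
    have : Fact (Module.finrank ℝ E3 = 2 + 1) := ⟨by simp⟩
    exact Submodule.finrank_orthogonal_span_singleton hn
  have he := Submodule.eq_of_le_of_finrank_eq hle (h1.trans h3.symm)
  have : w ∈ (diff α p).toLinearMap.range := by
    rw [he]; exact Submodule.mem_orthogonal_singleton_iff_inner_right.2 hw
  exact this

theorem diff_tangentLift {w : E3} (h : ∃ Y : TangentSpace (𝓡 2) p, diff α p Y = w) :
    diff α p (tangentLift α p w) = w :=
  Function.invFun_eq h

theorem normalCurv_smul {r : ℝ} (hr : r ≠ 0) (X : TangentSpace (𝓡 2) p) :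
    normalCurv α N p (r • X) = normalCurv α N p X := by
  simp only [normalCurv, firstForm_smul_left, firstForm_smul_right, secondForm_smul_left,
    secondForm_smul_right]
  rw [← mul_assoc, ← mul_assoc, mul_div_mul_left _ _ (mul_ne_zero hr hr)]

theorem geodTorsion_smul {r : ℝ} (hr : r ≠ 0) (X : TangentSpace (𝓡 2) p) :
    geodTorsion α N p (r • X) = geodTorsion α N p X := by
  simp only [geodTorsion, firstForm_smul_left, firstForm_smul_right, map_smul, wedge_smul,
    inner_smul_left, inner_smul_right]
  simp only [conj_trivial]
  rw [← mul_assoc, ← mul_assoc, ← mul_neg, mul_div_mul_left _ _ (mul_ne_zero hr hr)]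

/-- The unit tangent vector `X` and the tangent vector `Y` above `N ∧ X` form an orthonormal basis
in which the second fundamental form has off-diagonal entry `τ_g`. -/
theorem exists_frame (hi : Function.Injective (diff α p)) (hn : ‖N p‖ = 1)
    (ho : ∀ X : TangentSpace (𝓡 2) p, inner ℝ (N p) (diff α p X) = 0)
    (hs : ∀ X Y, secondForm α N p X Y = secondForm α N p Y X)
    {X : TangentSpace (𝓡 2) p} (hX : firstForm α p X X = 1) :
    ∃ Y : TangentSpace (𝓡 2) p, diff α p Y = wedge (N p) (diff α p X) ∧
      firstForm α p X Y = 0 ∧ firstForm α p Y Y = 1 ∧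
      secondForm α N p X Y = geodTorsion α N p X ∧
      gaussCurv α N p = secondForm α N p X X * secondForm α N p Y Y - geodTorsion α N p X ^ 2 ∧
      2 * meanCurv α N p = secondForm α N p X X + secondForm α N p Y Y ∧
      ∀ Z : TangentSpace (𝓡 2) p, Z = firstForm α p X Z • X + firstForm α p Y Z • Y := by
  have hn0 : N p ≠ 0 := by rw [← norm_ne_zero_iff, hn]; norm_num
  have hn1 : inner ℝ (N p) (N p) = 1 := by rw [real_inner_self_eq_norm_sq, hn]; norm_num
  obtain ⟨Y, hY⟩ := exists_diff_eq hi hn0 ho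
    (w := wedge (N p) (diff α p X)) (by rw [real_inner_comm, inner_wedge_left])
  have h1 : firstForm α p X Y = 0 := by
    rw [firstForm, hY, real_inner_comm, inner_wedge_right]
  have h2 : firstForm α p Y Y = 1 := by
    rw [firstForm, hY, inner_wedge_wedge, hn1, ho]
    rw [firstForm] at hX; rw [hX]; norm_num
  have h3 : secondForm α N p X Y = geodTorsion α N p X := by
    rw [secondForm, geodTorsion, hY, hX, div_one]
  have hK := gaussCurv_mul hi hs X Y
  have hH := meanCurv_mul hi hs X Y
  rw [hX, h1, h2, h3] at hK hH
  refine ⟨Y, hY, h1, h2, h3, by linarith, by linarith, fun Z => hi ?_⟩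
  have := eq_frame hn1 (t := diff α p X) hX (ho X) (diff α p Z)
  rw [ho Z, zero_smul, add_zero, ← hY] at this
  rw [map_add, map_smul, map_smul]
  exact this

/-- In the frame of `exists_frame` the determinant of the second form is `K` and its trace is `2H`.
One diagonal entry is `√K`, and eliminating the other one leaves the formula. -/
theorem geodTorsion_sq (hi : Function.Injective (diff α p)) (hn : ‖N p‖ = 1)
    (ho : ∀ X : TangentSpace (𝓡 2) p, inner ℝ (N p) (diff α p X) = 0)
    (hs : ∀ X Y, secondForm α N p X Y = secondForm α N p Y X)
    {X : TangentSpace (𝓡 2) p} (hX : firstForm α p X X = 1) (hK : 0 < gaussCurv α N p)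
    (hkn : normalCurv α N p X = √(gaussCurv α N p)) :
    geodTorsion α N p X ^ 2
      = √(gaussCurv α N p) * (2 * meanCurv α N p - 2 * √(gaussCurv α N p)) := by
  obtain ⟨Y, -, -, -, -, h1, h2, -⟩ := exists_frame hi hn ho hs hX
  rw [normalCurv, hX, div_one] at hkn
  have := Real.sq_sqrt hK.le
  rw [hkn] at h1 h2
  linear_combination h1 - √(gaussCurv α N p) * h2 + this

theorem Kind.sign_mul_self (κ : Kind) : κ.sign * κ.sign = 1 := by
  cases κ <;> simp [Kind.sign]

/-- The square is known from `geodTorsion_sq`. Since `κ.sign * τ` is positive it is the root of its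
own square, and `κ.sign` squares to one. -/
theorem geodTorsion_eq (hi : Function.Injective (diff α p)) (hn : ‖N p‖ = 1)
    (ho : ∀ X : TangentSpace (𝓡 2) p, inner ℝ (N p) (diff α p X) = 0)
    (hs : ∀ X Y, secondForm α N p X Y = secondForm α N p Y X) {κ : Kind}
    {X : TangentSpace (𝓡 2) p} (hX : firstForm α p X X = 1) (hK : 0 < gaussCurv α N p)
    (hkn : normalCurv α N p X = √(gaussCurv α N p)) (hτ : 0 < κ.sign * geodTorsion α N p X) :
    geodTorsion α N p X = κ.sign * (gaussCurv α N p ^ (1 / 4 : ℝ)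
        * √(2 * meanCurv α N p - 2 * √(gaussCurv α N p))) := by
  have h := geodTorsion_sq hi hn ho hs hX hK hkn
  have h1 : gaussCurv α N p ^ (1 / 4 : ℝ) = √(√(gaussCurv α N p)) := by
    rw [Real.sqrt_eq_rpow, Real.sqrt_eq_rpow, ← Real.rpow_mul hK.le]; norm_num
  have h2 : κ.sign * geodTorsion α N p X = √(√(gaussCurv α N p))
      * √(2 * meanCurv α N p - 2 * √(gaussCurv α N p)) := by
    rw [← Real.sqrt_mul (Real.sqrt_nonneg _), ← h, ← Real.sqrt_sq hτ.le, mul_pow, sq κ.sign,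
      κ.sign_mul_self, one_mul]
  rw [h1, ← h2, ← mul_assoc, κ.sign_mul_self, one_mul]

/-- The direction of a line of each of the two foliations is determined by the point. -/
theorem eq_or_eq_neg_of_line (hi : Function.Injective (diff α p)) (hn : ‖N p‖ = 1)
    (ho : ∀ X : TangentSpace (𝓡 2) p, inner ℝ (N p) (diff α p X) = 0)
    (hs : ∀ X Y, secondForm α N p X Y = secondForm α N p Y X) {κ : Kind} {m : ℝ}
    {X X' : TangentSpace (𝓡 2) p} (hX : firstForm α p X X = 1) (hX' : firstForm α p X' X' = 1)
    (hk : normalCurv α N p X = m) (hk' : normalCurv α N p X' = m)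
    (hτ : 0 < κ.sign * geodTorsion α N p X) (hτ' : 0 < κ.sign * geodTorsion α N p X') :
    X' = X ∨ X' = -X := by
  obtain ⟨Y, hY, h1, h2, h3, -, -, h4⟩ := exists_frame hi hn ho hs hX
  have hX'e := h4 X'
  set x := firstForm α p X X'
  set y := firstForm α p Y X'
  have hxy : x ^ 2 + y ^ 2 = 1 := by
    rw [← hX', hX'e]
    simp only [firstForm_add_left, firstForm_add_right, firstForm_smul_left, firstForm_smul_right,
      firstForm_comm Y X, hX, h1, h2]
    ring
  -- `N ∧ ·` is the quarter turn of the tangent plane: it sends `X` to `Y` and `Y` to `-X`, hence `x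
  -- X + y Y` to `-y X + x Y`.
  have hT : geodTorsion α N p X' = secondForm α N p X' (-y • X + x • Y) := by
    have hn1 : inner ℝ (N p) (N p) = 1 := by rw [real_inner_self_eq_norm_sq, hn]; norm_num
    rw [geodTorsion, hX', div_one, secondForm]
    congr 2
    have e : wedge (N p) (wedge (N p) (diff α p X)) = - diff α p X := by
      rw [wedge_wedge, ho X, hn1, zero_smul, one_smul, zero_sub]
    rw [hX'e, map_add, map_add, map_smul, map_smul, map_smul, map_smul, ← wedgeL_apply, map_add,
      map_smul, map_smul, wedgeL_apply, wedgeL_apply, hY, e]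
    module
  rw [normalCurv, hX, div_one] at hk
  rw [normalCurv, hX', div_one] at hk'
  rw [hT] at hτ'
  rw [hX'e] at hk' hτ'
  simp only [secondForm_add_left, secondForm_add_right, secondForm_smul_left,
    secondForm_smul_right, hs Y X, hk, h3] at hk' hτ'
  set τ := geodTorsion α N p X
  set b := secondForm α N p Y Y
  by_cases hy : y = 0
  · rw [hy, zero_smul, add_zero] at hX'e
    have : x = 1 ∨ x = -1 := by
      rw [hy] at hxy
      simpa using hxy
    rcases this with h | h
    · left; rw [hX'e, h, one_smul]
    · right; rw [hX'e, h, neg_one_smul]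
  -- The unit vectors of normal curvature `m` solve `y (2τx + (b - m) y) = 0`. Those with `y ≠ 0`
  -- form the second null direction of `II - m I`, and there the geodesic torsion is `-τ`: that
  -- direction belongs to the other foliation.
  · exfalso
    have h5 : 2 * τ * x + (b - m) * y = 0 := by
      apply mul_left_cancel₀ hy
      linear_combination hk' - m * hxy
    have h6 : x * (-y * m + x * τ) + y * (-y * τ + x * b) = -τ := by
      linear_combination x * h5 - τ * hxy
    have h7 : κ.sign * (-τ) > 0 := by
      rw [← h6]; linarith
    linarith

end Pointwise

/-! ### Charts and the chain rule -/

section Charts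

variable {M : Type*} [TopologicalSpace M] [ChartedSpace E2 M] [IsManifold (𝓡 2) ∞ M]

/-- Local parametrization of the surface inverse to the preferred chart at `p`. -/
abbrev par (p : M) : E2 → M := (extChartAt (𝓡 2) p).symm

/-- The preferred chart at `p` as a coordinate function. -/
abbrev crd (p : M) : M → E2 := extChartAt (𝓡 2) p

theorem par_crd (p : M) : par p (crd p p) = p := extChartAt_to_inv p

theorem contMDiffAt_par (p : M) {u : E2} (hu : u ∈ (extChartAt (𝓡 2) p).target) :
    ContMDiffAt 𝓘(ℝ, E2) (𝓡 2) ∞ (par p) u :=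
  (contMDiffOn_extChartAt_symm p).contMDiffAt ((isOpen_extChartAt_target p).mem_nhds hu)

theorem contMDiffAt_crd (p : M) {q : M} (hq : q ∈ (extChartAt (𝓡 2) p).source) :
    ContMDiffAt (𝓡 2) 𝓘(ℝ, E2) ∞ (crd p) q :=
  contMDiffAt_extChartAt' (by simpa using hq)

theorem fderiv_comp_eq_diff {Z : Type*} [NormedAddCommGroup Z] [NormedSpace ℝ Z] {f : M → E3}
    {x : Z → M} {z : Z} (hf : MDifferentiableAt (𝓡 2) 𝓘(ℝ, E3) f (x z))
    (hx : MDifferentiableAt 𝓘(ℝ, Z) (𝓡 2) x z) (ζ : Z) :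
    fderiv ℝ (f ∘ x) z ζ = diff f (x z) (mfderiv 𝓘(ℝ, Z) (𝓡 2) x z ζ) := by
  rw [← mfderiv_eq_fderiv, mfderiv_comp z hf hx]
  rfl

/-- All tangent spaces are `E2` by definition, so the vector is ascribed to `E2` and used at the
base point `q` without a transport along `x z = q`. -/
theorem fderiv_comp_eq_diff_of_eq {Z : Type*} [NormedAddCommGroup Z] [NormedSpace ℝ Z]
    {f : M → E3} {x : Z → M} {z : Z} {q : M} (hq : x z = q)
    (hf : MDifferentiableAt (𝓡 2) 𝓘(ℝ, E3) f q)
    (hx : MDifferentiableAt 𝓘(ℝ, Z) (𝓡 2) x z) (ζ : Z) :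
    fderiv ℝ (f ∘ x) z ζ = diff f q (mfderiv 𝓘(ℝ, Z) (𝓡 2) x z ζ : E2) := by
  subst hq
  exact fderiv_comp_eq_diff hf hx ζ

theorem deriv_comp_eq_diff {f : M → E3} {x : ℝ → M} {t : ℝ}
    (hf : MDifferentiableAt (𝓡 2) 𝓘(ℝ, E3) f (x t))
    (hx : MDifferentiableAt 𝓘(ℝ, ℝ) (𝓡 2) x t) :
    deriv (f ∘ x) t = diff f (x t) (velocity x t) := by
  rw [← fderiv_apply_one_eq_deriv]
  exact fderiv_comp_eq_diff hf hx 1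

theorem contDiffAt_comp_of_contMDiffAt {Z : Type*} [NormedAddCommGroup Z] [NormedSpace ℝ Z]
    {F : Type*} [NormedAddCommGroup F] [NormedSpace ℝ F] {k : WithTop ℕ∞} {f : M → F}
    {x : Z → M} {z : Z} (hf : ContMDiffAt (𝓡 2) 𝓘(ℝ, F) k f (x z))
    (hx : ContMDiffAt 𝓘(ℝ, Z) (𝓡 2) k x z) : ContDiffAt ℝ k (f ∘ x) z :=
  (hf.comp z hx).contDiffAt

/-- `par p ∘ crd p` is the identity near `p`, so the differential of `par p` is onto. Identities
between tangent vectors can then be proved with ordinary derivatives on `E2`. -/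
theorem exists_mfderiv_par_eq (p : M) (X : TangentSpace (𝓡 2) p) :
    ∃ ξ : E2, (mfderiv 𝓘(ℝ, E2) (𝓡 2) (par p) (crd p p) ξ : E2) = X := by
  have h1 : MDifferentiableAt (𝓡 2) 𝓘(ℝ, E2) (crd p) p :=
    (contMDiffAt_crd p (mem_extChartAt_source p)).mdifferentiableAt (by simp)
  have h2 : MDifferentiableAt 𝓘(ℝ, E2) (𝓡 2) (par p) (crd p p) :=
    (contMDiffAt_par p (mem_extChartAt_target p)).mdifferentiableAt (by simp)
  have h3 : par p ∘ crd p =ᶠ[𝓝 p] id := by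
    filter_upwards [extChartAt_source_mem_nhds (I := 𝓡 2) p] with q hq
    exact (extChartAt (𝓡 2) p).left_inv hq
  refine ⟨mfderiv (𝓡 2) 𝓘(ℝ, E2) (crd p) p X, ?_⟩
  have h4 := mfderiv_comp p h2 h1
  rw [h3.mfderiv_eq, mfderiv_id] at h4
  exact (DFunLike.congr_fun h4 X).symm

end Charts

/-! ### Smoothness of the normal field and symmetry of the second form -/

section Regularity

variable {M : Type*} [TopologicalSpace M] [ChartedSpace E2 M] [IsManifold (𝓡 2) ∞ M]
  {α N : M → E3} {r : ℕ∞}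

theorem IsImmersionOfClass.contMDiff_six (hα : IsImmersionOfClass r α) (hr : 6 ≤ r) :
    ContMDiff (𝓡 2) 𝓘(ℝ, E3) 6 α :=
  hα.contMDiff.of_le (WithTop.coe_le_coe.2 hr)

theorem wedge_ne_zero {a b : E3} (h : LinearIndependent ℝ ![a, b]) : wedge a b ≠ 0 := by
  intro h0
  rw [LinearIndependent.pair_iff] at h
  have ha : a ≠ 0 := by
    rintro rfl
    exact one_ne_zero (h 1 0 (by simp)).1
  have h1 := wedge_wedge a a b
  rw [h0, ← wedgeL_apply, map_zero] at h1
  have h2 := (h (inner ℝ a b) (-inner ℝ a a) (by rw [neg_smul, ← sub_eq_add_neg, ← h1])).2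
  exact ha (inner_self_eq_zero.1 (neg_eq_zero.1 h2))

theorem linearIndependent_diff {p : M} (hi : Function.Injective (diff α p))
    {X Y : TangentSpace (𝓡 2) p} (h : LinearIndependent ℝ ![X, Y]) :
    LinearIndependent ℝ ![diff α p X, diff α p Y] := by
  rw [LinearIndependent.pair_iff] at h ⊢
  intro s t hst
  refine h s t (hi ?_)
  rw [map_add, map_smul, map_smul, hst, map_zero]

/-- A continuous unit normal field along an immersion of class `C^(k+1)` is of class `C^k`. -/
theorem contMDiff_normal (hα : ContMDiff (𝓡 2) 𝓘(ℝ, E3) 6 α)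
    (hi : ∀ p : M, Function.Injective (diff α p)) (hN : IsUnitNormal α N) :
    ContMDiff (𝓡 2) 𝓘(ℝ, E3) 5 N := by
  intro p
  have hsurj := exists_mfderiv_par_eq p
  have htgt : (extChartAt (𝓡 2) p).target ∈ 𝓝 (crd p p) :=
    (isOpen_extChartAt_target p).mem_nhds (mem_extChartAt_target p)
  have hA : ContDiffAt ℝ 6 (α ∘ par p) (crd p p) :=
    contDiffAt_comp_of_contMDiffAt (hα _)
      ((contMDiffAt_par p (mem_extChartAt_target p)).of_le (by norm_cast))
  have hdiff : ∀ u ∈ (extChartAt (𝓡 2) p).target, ∀ ξ : E2,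
      fderiv ℝ (α ∘ par p) u ξ = diff α (par p u) (mfderiv 𝓘(ℝ, E2) (𝓡 2) (par p) u ξ) :=
    fun u hu ξ => fderiv_comp_eq_diff ((hα _).mdifferentiableAt (by simp))
      ((contMDiffAt_par p hu).mdifferentiableAt (by simp)) ξ
  obtain ⟨ξ, hξ⟩ := hsurj (coordVec p 0)
  obtain ⟨η, hη⟩ := hsurj (coordVec p 1)
  -- A normal field built from first derivatives of `α`, hence of class `C^5`, and nonzero at the
  -- centre of the chart. It remains to compare it with `N`, which is only known to be continuous.
  let ν : E2 → E3 := fun u => wedgeL (fderiv ℝ (α ∘ par p) u ξ) (fderiv ℝ (α ∘ par p) u η)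
  have hdA : ContDiffAt ℝ 5 (fderiv ℝ (α ∘ par p)) (crd p p) :=
    hA.fderiv_right (by norm_num)
  have hν : ContDiffAt ℝ 5 ν (crd p p) := by
    have h1 : ContDiffAt ℝ 5 (fun u => fderiv ℝ (α ∘ par p) u ξ) (crd p p) :=
      hdA.clm_apply contDiffAt_const
    have h2 : ContDiffAt ℝ 5 (fun u => fderiv ℝ (α ∘ par p) u η) (crd p p) :=
      hdA.clm_apply contDiffAt_const
    exact (wedgeL.contDiff.contDiffAt.comp _ h1).clm_apply h2
  have hν0 : ν (crd p p) ≠ 0 := by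
    apply wedge_ne_zero
    rw [hdiff _ (mem_extChartAt_target p), hdiff _ (mem_extChartAt_target p)]
    apply linearIndependent_diff (hi _)
    have : LinearIndependent ℝ ![(coordVec p 0 : E2), (coordVec p 1 : E2)] := by
      rw [LinearIndependent.pair_iff]
      intro s t hst
      change s • (EuclideanSpace.single 0 (1 : ℝ) : E2)
        + t • (EuclideanSpace.single 1 (1 : ℝ) : E2) = (0 : E2) at hst
      have h0 := congrArg (fun v : E2 => v 0) hst
      have h1 := congrArg (fun v : E2 => v 1) hst
      simp at h0 h1
      exact ⟨h0, h1⟩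
    rw [← hξ, ← hη] at this
    exact this
  have hNc : ContinuousAt (N ∘ par p) (crd p p) :=
    hN.continuous.continuousAt.comp (contMDiffAt_par p (mem_extChartAt_target p)).continuousAt
  let s : E2 → ℝ := fun u => inner ℝ (ν u) (N (par p u))
  have hs : ContinuousAt s (crd p p) := hν.continuousAt.inner hNc
  -- `N ∧ ν = 0` because `N` is orthogonal to both factors of `ν`; expanding `ν ∧ (N ∧ ν) = 0` shows
  -- that `N` and `ν` are parallel.
  have hNν : ∀ u ∈ (extChartAt (𝓡 2) p).target, (‖ν u‖ ^ 2) • N (par p u) = s u • ν u := by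
    intro u hu
    have h1 := wedge_wedge (N (par p u)) (fderiv ℝ (α ∘ par p) u ξ) (fderiv ℝ (α ∘ par p) u η)
    rw [hdiff u hu, hdiff u hu, hN.orthogonal, hN.orthogonal, zero_smul, zero_smul, sub_zero] at h1
    have h2 := wedge_wedge (ν u) (N (par p u)) (ν u)
    have h3 : wedge (N (par p u)) (ν u) = 0 := by
      simp only [ν, wedgeL_apply]; rw [hdiff u hu, hdiff u hu]; exact h1
    rw [h3, ← wedgeL_apply, map_zero, real_inner_self_eq_norm_sq] at h2
    exact (sub_eq_zero.1 h2.symm)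
  have hsq : ∀ u ∈ (extChartAt (𝓡 2) p).target, s u ^ 2 = ‖ν u‖ ^ 2 := by
    intro u hu
    have h1 := congrArg (fun v => inner ℝ v (N (par p u))) (hNν u hu)
    simp only [inner_smul_left, conj_trivial, real_inner_self_eq_norm_sq, hN.norm_eq_one] at h1
    change _ = s u * s u at h1
    linarith
  have hs0 : s (crd p p) ≠ 0 := by
    intro h
    have := hsq _ (mem_extChartAt_target p)
    rw [h] at this
    exact hν0 (norm_eq_zero.1 (pow_eq_zero_iff (two_ne_zero) |>.1 (by linarith)))
  -- `⟨ν, N⟩` equals `‖ν‖` up to sign and does not vanish, so by continuity the sign `ε` is constant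
  -- near the point. Hence `N = ε ν / ‖ν‖` there, which is as smooth as `ν`.
  obtain ⟨ε, hε⟩ : ∃ ε : ℝ, ∀ᶠ u in 𝓝 (crd p p), s u = ε * ‖ν u‖ := by
    rcases lt_or_gt_of_ne hs0 with h | h
    · refine ⟨-1, ?_⟩
      filter_upwards [hs.eventually_lt continuousAt_const h, htgt] with u hu hu'
      have := abs_eq_abs.2 (sq_eq_sq_iff_eq_or_eq_neg.1 (hsq u hu'))
      rw [abs_of_neg hu, abs_of_nonneg (norm_nonneg _)] at this
      linarith
    · refine ⟨1, ?_⟩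
      filter_upwards [continuousAt_const.eventually_lt hs h, htgt] with u hu hu'
      have := abs_eq_abs.2 (sq_eq_sq_iff_eq_or_eq_neg.1 (hsq u hu'))
      rw [abs_of_pos hu, abs_of_nonneg (norm_nonneg _)] at this
      linarith
  have hform : N ∘ par p =ᶠ[𝓝 (crd p p)] fun u => (ε * ‖ν u‖⁻¹) • ν u := by
    filter_upwards [hε, htgt, hν.continuousAt.eventually_ne hν0] with u h1 h2 h3
    have h4 := hNν u h2
    have h5 : ‖ν u‖ ≠ 0 := norm_ne_zero_iff.2 h3
    rw [h1] at h4
    have h6 : N (par p u) = (‖ν u‖ ^ 2)⁻¹ • ((ε * ‖ν u‖) • ν u) := by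
      rw [← h4, smul_smul, inv_mul_cancel₀ (pow_ne_zero 2 h5), one_smul]
    rw [Function.comp_apply, h6, smul_smul]
    congr 1
    field_simp
  have hsm : ContDiffAt ℝ 5 (N ∘ par p) (crd p p) := by
    refine ContDiffAt.congr_of_eventuallyEq ?_ hform
    exact (contDiffAt_const.mul ((hν.norm ℝ hν0).inv (norm_ne_zero_iff.2 hν0))).smul hν
  have hback : N =ᶠ[𝓝 p] (N ∘ par p) ∘ crd p := by
    filter_upwards [extChartAt_source_mem_nhds (I := 𝓡 2) p] with q hq
    exact congrArg N ((extChartAt (𝓡 2) p).left_inv hq).symm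
  refine ContMDiffAt.congr_of_eventuallyEq ?_ hback
  exact hsm.contMDiffAt.comp p ((contMDiffAt_crd p (mem_extChartAt_source p)).of_le
    (by norm_cast))

/-- Differentiating `⟨N, α_θ⟩ = 0` in the direction `ζ` turns `-⟨N_ζ, α_θ⟩` into `⟨N, D²α(ζ, θ)⟩`,
and second derivatives commute. -/
theorem secondForm_comm (hα : ContMDiff (𝓡 2) 𝓘(ℝ, E3) 6 α)
    (hNs : ContMDiff (𝓡 2) 𝓘(ℝ, E3) 5 N) (hN : IsUnitNormal α N) (p : M)
    (X Y : TangentSpace (𝓡 2) p) : secondForm α N p X Y = secondForm α N p Y X := by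
  have htgt : (extChartAt (𝓡 2) p).target ∈ 𝓝 (crd p p) :=
    (isOpen_extChartAt_target p).mem_nhds (mem_extChartAt_target p)
  have hx : MDifferentiableAt 𝓘(ℝ, E2) (𝓡 2) (par p) (crd p p) :=
    (contMDiffAt_par p (mem_extChartAt_target p)).mdifferentiableAt (by simp)
  have hA : ContDiffAt ℝ 6 (α ∘ par p) (crd p p) :=
    contDiffAt_comp_of_contMDiffAt (hα _)
      ((contMDiffAt_par p (mem_extChartAt_target p)).of_le (by norm_cast))
  have hNd : ContDiffAt ℝ 5 (N ∘ par p) (crd p p) :=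
    contDiffAt_comp_of_contMDiffAt (hNs _)
      ((contMDiffAt_par p (mem_extChartAt_target p)).of_le (by norm_cast))
  obtain ⟨ξ, rfl⟩ := exists_mfderiv_par_eq p X
  obtain ⟨η, rfl⟩ := exists_mfderiv_par_eq p Y
  have key : ∀ ζ θ : E2, inner ℝ (fderiv ℝ (N ∘ par p) (crd p p) ζ)
      (fderiv ℝ (α ∘ par p) (crd p p) θ) =
      -inner ℝ (N (par p (crd p p))) (fderiv ℝ (fderiv ℝ (α ∘ par p)) (crd p p) ζ θ) := by
    intro ζ θ
    have h0 : (fun u => inner ℝ ((N ∘ par p) u) (fderiv ℝ (α ∘ par p) u θ)) =ᶠ[𝓝 (crd p p)]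
        fun _ => (0 : ℝ) := by
      filter_upwards [htgt] with u hu
      rw [fderiv_comp_eq_diff ((hα _).mdifferentiableAt (by simp))
        ((contMDiffAt_par p hu).mdifferentiableAt (by simp))]
      exact hN.orthogonal _ _
    have h1 : DifferentiableAt ℝ (fderiv ℝ (α ∘ par p)) (crd p p) :=
      (hA.fderiv_right (m := 1) (by norm_num)).differentiableAt (by norm_num)
    have h2 : HasFDerivAt (fun u => fderiv ℝ (α ∘ par p) u θ)
        ((fderiv ℝ (fderiv ℝ (α ∘ par p)) (crd p p)).flip θ) (crd p p) := by
      have := h1.hasFDerivAt.clm_apply (hasFDerivAt_const θ (crd p p))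
      simpa using this
    have h3 := ((hNd.differentiableAt (by norm_num)).hasFDerivAt.inner ℝ h2).fderiv
    rw [h0.fderiv_eq] at h3
    have h4 := DFunLike.congr_fun h3 ζ
    simp at h4 ⊢
    linarith
  have hsymm := hA.isSymmSndFDerivAt (by simp; norm_num)
  have h : ∀ ζ θ : E2,
      secondForm α N p (mfderiv 𝓘(ℝ, E2) (𝓡 2) (par p) (crd p p) ζ : E2)
        (mfderiv 𝓘(ℝ, E2) (𝓡 2) (par p) (crd p p) θ : E2) =
      inner ℝ (N (par p (crd p p))) (fderiv ℝ (fderiv ℝ (α ∘ par p)) (crd p p) ζ θ) := by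
    intro ζ θ
    unfold secondForm
    rw [← fderiv_comp_eq_diff_of_eq (par_crd p) ((hα _).mdifferentiableAt (by simp)) hx,
      ← fderiv_comp_eq_diff_of_eq (par_crd p) ((hNs _).mdifferentiableAt (by simp)) hx, key,
      neg_neg]
  exact (h ξ η).trans ((congrArg _ (hsymm.eq ξ η)).trans (h η ξ).symm)

end Regularity

/-! ### Fundamental forms in a parametrization; the field of unit directions -/

section Lines

variable {M : Type*} [TopologicalSpace M] [ChartedSpace E2 M] [IsManifold (𝓡 2) ∞ M]
  {α N : M → E3}

/-- The properties of an immersion and its unit normal field which are used below. -/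
structure IsRegularSurface (α N : M → E3) : Prop where
  smooth : ContMDiff (𝓡 2) 𝓘(ℝ, E3) 6 α
  smooth_normal : ContMDiff (𝓡 2) 𝓘(ℝ, E3) 5 N
  injective (p : M) : Function.Injective (diff α p)
  norm_eq_one (p : M) : ‖N p‖ = 1
  orthogonal (p : M) (X : TangentSpace (𝓡 2) p) : inner ℝ (N p) (diff α p X) = 0
  symm (p : M) (X Y : TangentSpace (𝓡 2) p) : secondForm α N p X Y = secondForm α N p Y X

theorem IsRegularSurface.of {r : ℕ∞} (hr : 6 ≤ r) (hα : IsImmersionOfClass r α)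
    (hN : IsUnitNormal α N) : IsRegularSurface α N where
  smooth := hα.contMDiff_six hr
  smooth_normal := contMDiff_normal (hα.contMDiff_six hr) hα.injective_diff hN
  injective := hα.injective_diff
  norm_eq_one := hN.norm_eq_one
  orthogonal := hN.orthogonal
  symm := secondForm_comm (hα.contMDiff_six hr)
    (contMDiff_normal (hα.contMDiff_six hr) hα.injective_diff hN) hN

theorem IsRegularSurface.mdiff (h : IsRegularSurface α N) (p : M) :
    MDifferentiableAt (𝓡 2) 𝓘(ℝ, E3) α p := (h.smooth p).mdifferentiableAt (by simp)

theorem IsRegularSurface.mdiff_normal (h : IsRegularSurface α N) (p : M) :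
    MDifferentiableAt (𝓡 2) 𝓘(ℝ, E3) N p := (h.smooth_normal p).mdifferentiableAt (by simp)

theorem IsRegularSurface.inner_self (h : IsRegularSurface α N) (p : M) :
    inner ℝ (N p) (N p) = 1 := by rw [real_inner_self_eq_norm_sq, h.norm_eq_one]; norm_num

section Param

variable {Z : Type*} [NormedAddCommGroup Z] [NormedSpace ℝ Z]

/-- Coefficients `⟨df(ζ), dg(η)⟩` of the fundamental forms of a parametrized surface. -/
def pairing (f g : Z → E3) (ζ η : Z) (z : Z) : ℝ :=
  inner ℝ (fderiv ℝ f z ζ) (fderiv ℝ g z η)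

theorem contDiffAt_pairing {f g : Z → E3} {z : Z} {k m : WithTop ℕ∞} (hk : k + 1 ≤ m)
    (hf : ContDiffAt ℝ m f z) (hg : ContDiffAt ℝ m g z) (ζ η : Z) :
    ContDiffAt ℝ k (pairing f g ζ η) z :=
  ((hf.fderiv_right hk).clm_apply contDiffAt_const).inner ℝ
    ((hg.fderiv_right hk).clm_apply contDiffAt_const)

theorem firstForm_param (h : IsRegularSurface α N) {x : Z → M} {z : Z}
    (hx : MDifferentiableAt 𝓘(ℝ, Z) (𝓡 2) x z) (ζ η : Z) :
    firstForm α (x z) (mfderiv 𝓘(ℝ, Z) (𝓡 2) x z ζ) (mfderiv 𝓘(ℝ, Z) (𝓡 2) x z η) =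
      pairing (α ∘ x) (α ∘ x) ζ η z := by
  rw [firstForm, pairing, fderiv_comp_eq_diff (h.mdiff _) hx, fderiv_comp_eq_diff (h.mdiff _) hx]

theorem secondForm_param (h : IsRegularSurface α N) {x : Z → M} {z : Z}
    (hx : MDifferentiableAt 𝓘(ℝ, Z) (𝓡 2) x z) (ζ η : Z) :
    secondForm α N (x z) (mfderiv 𝓘(ℝ, Z) (𝓡 2) x z ζ) (mfderiv 𝓘(ℝ, Z) (𝓡 2) x z η) =
      -pairing (N ∘ x) (α ∘ x) ζ η z := by
  rw [secondForm, pairing, fderiv_comp_eq_diff (h.mdiff _) hx,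
    fderiv_comp_eq_diff (h.mdiff_normal _) hx]

theorem pairing_comm (h : IsRegularSurface α N) {x : Z → M} {z : Z}
    (hx : MDifferentiableAt 𝓘(ℝ, Z) (𝓡 2) x z) (ζ η : Z) :
    pairing (N ∘ x) (α ∘ x) ζ η z = pairing (N ∘ x) (α ∘ x) η ζ z := by
  rw [← neg_inj, ← secondForm_param h hx, h.symm, secondForm_param h hx]

/-- The determinant of the first fundamental form of a parametrized surface. -/
def gramDet (f : Z → E3) (ζ η : Z) (z : Z) : ℝ :=
  pairing f f ζ ζ z * pairing f f η η z - pairing f f ζ η z ^ 2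

theorem contDiffAt_gramDet {f : Z → E3} {z : Z} {k m : WithTop ℕ∞} (hk : k + 1 ≤ m)
    (hf : ContDiffAt ℝ m f z) (ζ η : Z) : ContDiffAt ℝ k (gramDet f ζ η) z :=
  ((contDiffAt_pairing hk hf hf _ _).mul (contDiffAt_pairing hk hf hf _ _)).sub
    ((contDiffAt_pairing hk hf hf _ _).pow 2)

theorem gaussCurv_param (h : IsRegularSurface α N) {x : Z → M} {z : Z}
    (hx : MDifferentiableAt 𝓘(ℝ, Z) (𝓡 2) x z) {ζ η : Z} (hD : gramDet (α ∘ x) ζ η z ≠ 0) :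
    gaussCurv α N (x z) = (pairing (N ∘ x) (α ∘ x) ζ ζ z * pairing (N ∘ x) (α ∘ x) η η z
      - pairing (N ∘ x) (α ∘ x) ζ η z ^ 2) / gramDet (α ∘ x) ζ η z := by
  have := gaussCurv_mul (h.injective (x z)) (h.symm (x z)) (mfderiv 𝓘(ℝ, Z) (𝓡 2) x z ζ)
    (mfderiv 𝓘(ℝ, Z) (𝓡 2) x z η)
  simp only [firstForm_param h hx, secondForm_param h hx] at this
  rw [eq_div_iff hD, gramDet, this]
  ring

theorem meanCurv_param (h : IsRegularSurface α N) {x : Z → M} {z : Z}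
    (hx : MDifferentiableAt 𝓘(ℝ, Z) (𝓡 2) x z) {ζ η : Z} (hD : gramDet (α ∘ x) ζ η z ≠ 0) :
    meanCurv α N (x z) = (-pairing (N ∘ x) (α ∘ x) ζ ζ z * pairing (α ∘ x) (α ∘ x) η η z
      + 2 * pairing (N ∘ x) (α ∘ x) ζ η z * pairing (α ∘ x) (α ∘ x) ζ η z
      - pairing (N ∘ x) (α ∘ x) η η z * pairing (α ∘ x) (α ∘ x) ζ ζ z)
        / (2 * gramDet (α ∘ x) ζ η z) := by
  have := meanCurv_mul (h.injective (x z)) (h.symm (x z)) (mfderiv 𝓘(ℝ, Z) (𝓡 2) x z ζ)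
    (mfderiv 𝓘(ℝ, Z) (𝓡 2) x z η)
  simp only [firstForm_param h hx, secondForm_param h hx] at this
  rw [eq_div_iff (by positivity), gramDet]
  linear_combination this

/-- `K` is a rational function of products of first derivatives of `N ∘ x` and `α ∘ x`, so one
derivative is lost. The bound `m ≤ 5` comes from the regularity of `N`. -/
theorem contDiffAt_gaussCurv (h : IsRegularSurface α N) {k m : ℕ} (hm : m ≤ 5) (hk : k + 1 ≤ m)
    {x : Z → M} {z : Z} (hx : ContMDiffAt 𝓘(ℝ, Z) (𝓡 2) m x z) {ζ η : Z}
    (hD : gramDet (α ∘ x) ζ η z ≠ 0) : ContDiffAt ℝ k (gaussCurv α N ∘ x) z := by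
  have hk' : (k : WithTop ℕ∞) + 1 ≤ m := by exact_mod_cast hk
  have hA : ContDiffAt ℝ m (α ∘ x) z := contDiffAt_comp_of_contMDiffAt
    ((h.smooth _).of_le (by exact_mod_cast (by omega : m ≤ 6))) hx
  have hn : ContDiffAt ℝ m (N ∘ x) z := contDiffAt_comp_of_contMDiffAt
    ((h.smooth_normal _).of_le (by exact_mod_cast hm)) hx
  have hg := contDiffAt_gramDet hk' hA ζ η
  have h1 : IsManifold (𝓡 2) (m : WithTop ℕ∞) M :=
    IsManifold.of_le (n := ∞) (by exact_mod_cast le_top)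
  have hev : ∀ᶠ z' in 𝓝 z, ContMDiffAt 𝓘(ℝ, Z) (𝓡 2) m x z' :=
    (contMDiffAt_iff_contMDiffAt_nhds (by simp)).1 hx
  refine ContDiffAt.congr_of_eventuallyEq (f := fun z => (pairing (N ∘ x) (α ∘ x) ζ ζ z *
    pairing (N ∘ x) (α ∘ x) η η z - pairing (N ∘ x) (α ∘ x) ζ η z ^ 2) / gramDet (α ∘ x) ζ η z)
    ?_ ?_
  · exact (((contDiffAt_pairing hk' hn hA _ _).mul (contDiffAt_pairing hk' hn hA _ _)).sub
      ((contDiffAt_pairing hk' hn hA _ _).pow 2)).div hg hD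
  · filter_upwards [hev, hg.continuousAt.eventually_ne hD] with z' h2 h3
    exact gaussCurv_param h (h2.mdifferentiableAt
      (by simp; omega)) h3

theorem contDiffAt_meanCurv (h : IsRegularSurface α N) {k m : ℕ} (hm : m ≤ 5) (hk : k + 1 ≤ m)
    {x : Z → M} {z : Z} (hx : ContMDiffAt 𝓘(ℝ, Z) (𝓡 2) m x z) {ζ η : Z}
    (hD : gramDet (α ∘ x) ζ η z ≠ 0) : ContDiffAt ℝ k (meanCurv α N ∘ x) z := by
  have hk' : (k : WithTop ℕ∞) + 1 ≤ m := by exact_mod_cast hk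
  have hA : ContDiffAt ℝ m (α ∘ x) z := contDiffAt_comp_of_contMDiffAt
    ((h.smooth _).of_le (by exact_mod_cast (by omega : m ≤ 6))) hx
  have hn : ContDiffAt ℝ m (N ∘ x) z := contDiffAt_comp_of_contMDiffAt
    ((h.smooth_normal _).of_le (by exact_mod_cast hm)) hx
  have hg := contDiffAt_gramDet hk' hA ζ η
  have h1 : IsManifold (𝓡 2) (m : WithTop ℕ∞) M :=
    IsManifold.of_le (n := ∞) (by exact_mod_cast le_top)
  have hev : ∀ᶠ z' in 𝓝 z, ContMDiffAt 𝓘(ℝ, Z) (𝓡 2) m x z' :=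
    (contMDiffAt_iff_contMDiffAt_nhds (by simp)).1 hx
  refine ContDiffAt.congr_of_eventuallyEq (f := fun z =>
    (-pairing (N ∘ x) (α ∘ x) ζ ζ z * pairing (α ∘ x) (α ∘ x) η η z
      + 2 * pairing (N ∘ x) (α ∘ x) ζ η z * pairing (α ∘ x) (α ∘ x) ζ η z
      - pairing (N ∘ x) (α ∘ x) η η z * pairing (α ∘ x) (α ∘ x) ζ ζ z)
        / (2 * gramDet (α ∘ x) ζ η z)) ?_ ?_
  · exact ((((contDiffAt_pairing hk' hn hA _ _).neg.mul (contDiffAt_pairing hk' hA hA _ _)).add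
      ((contDiffAt_const.mul (contDiffAt_pairing hk' hn hA _ _)).mul
        (contDiffAt_pairing hk' hA hA _ _))).sub
      ((contDiffAt_pairing hk' hn hA _ _).mul (contDiffAt_pairing hk' hA hA _ _))).div
      (contDiffAt_const.mul hg) (mul_ne_zero two_ne_zero hD)
  · filter_upwards [hev, hg.continuousAt.eventually_ne hD] with z' h2 h3
    exact meanCurv_param h (h2.mdifferentiableAt
      (by simp; omega)) h3

end Param

theorem fderiv_chart {f : M → E3} {p : M}
    (hf : MDifferentiableAt (𝓡 2) 𝓘(ℝ, E3) f p) (ξ : E2) :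
    fderiv ℝ (f ∘ par p) (crd p p) ξ
      = diff f p (mfderiv 𝓘(ℝ, E2) (𝓡 2) (par p) (crd p p) ξ : E2) :=
  fderiv_comp_eq_diff_of_eq (par_crd p) hf
    ((contMDiffAt_par p (mem_extChartAt_target p)).mdifferentiableAt (by simp)) ξ

/-- The differential of `α` is injective, and so is that of `par p`, since `crd p ∘ par p` is the
identity near `crd p p`. -/
theorem injective_fderiv_chart (h : IsRegularSurface α N) (p : M) :
    Function.Injective (fderiv ℝ (α ∘ par p) (crd p p)) := by
  rw [injective_iff_map_eq_zero]
  intro ζ hζ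
  have hx : MDifferentiableAt 𝓘(ℝ, E2) (𝓡 2) (par p) (crd p p) :=
    (contMDiffAt_par p (mem_extChartAt_target p)).mdifferentiableAt (by simp)
  rw [fderiv_chart (h.mdiff p)] at hζ
  have h12 : mfderiv 𝓘(ℝ, E2) (𝓡 2) (par p) (crd p p) ζ = (0 : E2) :=
    h.injective p (hζ.trans (map_zero _).symm)
  have e1 : MDifferentiableAt (𝓡 2) 𝓘(ℝ, E2) (crd p) (par p (crd p p)) := by
    rw [par_crd]
    exact (contMDiffAt_crd p (mem_extChartAt_source p)).mdifferentiableAt (by simp)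
  have e2 := mfderiv_comp (crd p p) e1 hx
  have e3 : crd p ∘ par p =ᶠ[𝓝 (crd p p)] id := by
    filter_upwards [(isOpen_extChartAt_target (I := 𝓡 2) p).mem_nhds
      (mem_extChartAt_target p)] with u hu
    exact (extChartAt (𝓡 2) p).right_inv hu
  rw [e3.mfderiv_eq, mfderiv_id] at e2
  have h11 := DFunLike.congr_fun e2 ζ
  exact h11.trans ((congrArg (fun v : E2 => (mfderiv (𝓡 2) 𝓘(ℝ, E2) (crd p)
    (par p (crd p p)) v : E2)) h12).trans (map_zero _))

/-- A line of geometric mean curvature parametrized by arc length. -/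
structure IsUnitLine (κ : Kind) (α N : M → E3) (γ : ℝ → M) (J : Set ℝ) : Prop
    extends IsLine κ α N γ J where
  unit_speed : ∀ t ∈ J, firstForm α (γ t) (velocity γ t) (velocity γ t) = 1

/-- The conditions on a tangent vector which characterize the unit vectors tangent to the lines
of one of the two foliations. -/
structure IsUnitDir (κ : Kind) (α N : M → E3) (p : M) (X : TangentSpace (𝓡 2) p) : Prop where
  unit : firstForm α p X X = 1
  elliptic : 0 < gaussCurv α N p
  normalCurv_eq : normalCurv α N p X = √(gaussCurv α N p)
  torsion_sign : 0 < κ.sign * geodTorsion α N p X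

theorem IsUnitLine.isUnitDir {κ : Kind} {γ : ℝ → M} {J : Set ℝ} (h : IsUnitLine κ α N γ J) {t : ℝ}
    (ht : t ∈ J) : IsUnitDir κ α N (γ t) (velocity γ t) :=
  ⟨h.unit_speed t ht, h.elliptic t ht, h.normalCurv_eq t ht, h.torsion_sign t ht⟩

/-- Near a given unit vector tangent to the foliation, the coordinates of such vectors form the
graph of a vector field of class `C^4`. -/
theorem exists_unit_field (h : IsRegularSurface α N) {κ : Kind} {p : M} {X : TangentSpace (𝓡 2) p}
    (hX : IsUnitDir κ α N p X) {ξ : E2}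
    (hξ : (mfderiv 𝓘(ℝ, E2) (𝓡 2) (par p) (crd p p) ξ : E2) = X) :
    ∃ V : E2 → E2, ContDiffAt ℝ 4 V (crd p p) ∧ ∀ᶠ v : E2 × E2 in 𝓝 (crd p p, ξ),
      (-pairing (N ∘ par p) (α ∘ par p) v.2 v.2 v.1
        = √(gaussCurv α N (par p v.1)) ∧
        pairing (α ∘ par p) (α ∘ par p) v.2 v.2 v.1 = 1) → V v.1 = v.2 := by
  have hx : MDifferentiableAt 𝓘(ℝ, E2) (𝓡 2) (par p) (crd p p) :=
    (contMDiffAt_par p (mem_extChartAt_target p)).mdifferentiableAt (by simp)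
  have hA : ContDiffAt ℝ 5 (α ∘ par p) (crd p p) :=
    contDiffAt_comp_of_contMDiffAt ((h.smooth _).of_le (by norm_cast))
      ((contMDiffAt_par p (mem_extChartAt_target p)).of_le (by norm_cast))
  have hn : ContDiffAt ℝ 5 (N ∘ par p) (crd p p) :=
    contDiffAt_comp_of_contMDiffAt (h.smooth_normal _)
      ((contMDiffAt_par p (mem_extChartAt_target p)).of_le (by norm_cast))
  have hKp : 0 < gaussCurv α N (par p (crd p p)) := by rw [par_crd]; exact hX.elliptic
  obtain ⟨Y, -, hY1, hY2, hY3, -, -, hY4⟩ :=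
    exists_frame (h.injective p) (h.norm_eq_one p) (h.orthogonal p) (h.symm p) hX.unit
  obtain ⟨η, hη⟩ := exists_mfderiv_par_eq p Y
  have hAd : ∀ ζ, fderiv ℝ (α ∘ par p) (crd p p) ζ
      = diff α p (mfderiv 𝓘(ℝ, E2) (𝓡 2) (par p) (crd p p) ζ : E2) :=
    fun ζ => fderiv_chart (h.mdiff p) ζ
  have hNd : ∀ ζ, fderiv ℝ (N ∘ par p) (crd p p) ζ
      = diff N p (mfderiv 𝓘(ℝ, E2) (𝓡 2) (par p) (crd p p) ζ : E2) :=
    fun ζ => fderiv_chart (h.mdiff_normal p) ζ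
  have hD : gramDet (α ∘ par p) ξ η (crd p p) ≠ 0 := by
    have e1 : pairing (α ∘ par p) (α ∘ par p) ξ ξ (crd p p) = 1 := by
      unfold pairing; rw [hAd, hξ]; exact hX.unit
    have e2 : pairing (α ∘ par p) (α ∘ par p) ξ η (crd p p) = 0 := by
      unfold pairing; rw [hAd, hAd, hξ, hη]; exact hY1
    have e3 : pairing (α ∘ par p) (α ∘ par p) η η (crd p p) = 1 := by
      unfold pairing; rw [hAd, hη]; exact hY2
    rw [gramDet, e1, e2, e3]; norm_num
  have hK : ContDiffAt ℝ 4 (fun u => √(gaussCurv α N (par p u))) (crd p p) :=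
    (contDiffAt_gaussCurv h (k := 4) (m := 5) le_rfl le_rfl
      ((contMDiffAt_par p (mem_extChartAt_target p)).of_le (by norm_cast)) hD).sqrt hKp.ne'
  set m : E2 → ℝ := fun u => √(gaussCurv α N (par p u)) with hm
  -- In chart coordinates a unit direction of normal curvature `m` is a point `(u, v)` with `F (u,
  -- v) = (0, 1)`. The field `V` is the implicit function solving this for `v`; it has class `C^4`
  -- because `F` contains one derivative of `N`.
  let F : E2 × E2 → ℝ × ℝ := fun v =>
    (-inner ℝ (fderiv ℝ (N ∘ par p) v.1 v.2) (fderiv ℝ (α ∘ par p) v.1 v.2)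
      - m v.1 * inner ℝ (fderiv ℝ (α ∘ par p) v.1 v.2) (fderiv ℝ (α ∘ par p) v.1 v.2),
      inner ℝ (fderiv ℝ (α ∘ par p) v.1 v.2) (fderiv ℝ (α ∘ par p) v.1 v.2))
  have hF : ContDiffAt ℝ 4 F (crd p p, ξ) := by
    have c1 : ContDiffAt ℝ 4 (fun v : E2 × E2 => fderiv ℝ (α ∘ par p) v.1 v.2) (crd p p, ξ) :=
      ((hA.fderiv_right (m := 4) (by norm_num)).comp (crd p p, ξ) contDiffAt_fst).clm_apply
        contDiffAt_snd
    have c2 : ContDiffAt ℝ 4 (fun v : E2 × E2 => fderiv ℝ (N ∘ par p) v.1 v.2) (crd p p, ξ) :=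
      ((hn.fderiv_right (m := 4) (by norm_num)).comp (crd p p, ξ) contDiffAt_fst).clm_apply
        contDiffAt_snd
    have c3 : ContDiffAt ℝ 4 (fun v : E2 × E2 => m v.1) (crd p p, ξ) :=
      ContDiffAt.comp (crd p p, ξ) (g := m) hK contDiffAt_fst
    exact ((c2.inner ℝ c1).neg.sub (c3.mul (c1.inner ℝ c1))).prodMk (c1.inner ℝ c1)
  set a := fderiv ℝ (α ∘ par p) (crd p p) with ha
  set b := fderiv ℝ (N ∘ par p) (crd p p) with hb
  have hF2 : ∀ ζ, (fderiv ℝ F (crd p p, ξ) ∘L .inr ℝ E2 E2) ζ =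
      (-(inner ℝ (b ξ) (a ζ) + inner ℝ (b ζ) (a ξ))
        - m (crd p p) * (inner ℝ (a ξ) (a ζ) + inner ℝ (a ζ) (a ξ)),
        inner ℝ (a ξ) (a ζ) + inner ℝ (a ζ) (a ξ)) := by
    intro ζ
    have h1 : HasFDerivAt (fun ζ => F (crd p p, ζ))
        (fderiv ℝ F (crd p p, ξ) ∘L .inr ℝ E2 E2) ξ :=
      (hF.differentiableAt (by norm_num)).hasFDerivAt.comp ξ (hasFDerivAt_prodMk_right (crd p p) ξ)
    have h2 := (b.hasFDerivAt (x := ξ)).inner ℝ (a.hasFDerivAt (x := ξ))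
    have h3 := (a.hasFDerivAt (x := ξ)).inner ℝ (a.hasFDerivAt (x := ξ))
    have h4 := (h2.neg.sub (h3.const_mul (m (crd p p)))).prodMk h3
    rw [h1.unique h4]
    simp
  -- A vector `W` in the kernel satisfies `I(X, W) = 0`, so it is a multiple of `Y`, and `II(X, W) =
  -- 0`, so that multiple is killed by `II(X, Y) = τ ≠ 0`. The nonvanishing torsion is what makes
  -- the direction a simple root.
  have hinv : (fderiv ℝ F (crd p p, ξ) ∘L .inr ℝ E2 E2).IsInvertible := by
    have hinj : Function.Injective (fderiv ℝ F (crd p p, ξ) ∘L .inr ℝ E2 E2) := by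
      rw [injective_iff_map_eq_zero]
      intro ζ hζ
      rw [hF2, Prod.mk_eq_zero] at hζ
      obtain ⟨h1, h2⟩ := hζ
      rw [h2, mul_zero, sub_zero, neg_eq_zero, hNd, hNd, hAd, hAd, hξ] at h1
      rw [real_inner_comm, hAd, hAd, hξ] at h2
      set W : TangentSpace (𝓡 2) p :=
        (mfderiv 𝓘(ℝ, E2) (𝓡 2) (par p) (crd p p) ζ : E2) with hW
      have h5 : firstForm α p X W = 0 := by
        have : firstForm α p W X + firstForm α p W X = 0 := h2
        rw [firstForm_comm]; linarith
      have h6 : secondForm α N p X W + secondForm α N p W X = 0 := by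
        unfold secondForm; linarith
      rw [h.symm p W X] at h6
      have h7 := hY4 W
      rw [h5, zero_smul, zero_add] at h7
      rw [h7, secondForm_smul_right, hY3] at h6
      have hτ : geodTorsion α N p X ≠ 0 := by
        intro h0; have := hX.torsion_sign; rw [h0, mul_zero] at this; exact lt_irrefl _ this
      have h8 : firstForm α p Y W = 0 := by
        have : firstForm α p Y W * geodTorsion α N p X = 0 := by linarith
        exact (mul_eq_zero.1 this).resolve_right hτ
      rw [h8, zero_smul] at h7
      have h9 : a ζ = 0 := by rw [hAd, ← hW, h7, map_zero]
      exact injective_fderiv_chart h p (h9.trans (map_zero _).symm)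
    let e := LinearEquiv.ofInjectiveOfFinrankEq
      (fderiv ℝ F (crd p p, ξ) ∘L .inr ℝ E2 E2).toLinearMap hinj (by simp)
    exact ⟨e.toContinuousLinearEquiv, by ext ζ <;> rfl⟩
  refine ⟨hF.implicitFunction (by norm_num) hinv,
    hF.contDiffAt_implicitFunction (by norm_num) hinv, ?_⟩
  filter_upwards [hF.eventually_apply_eq_iff_implicitFunction (by norm_num) hinv] with v hv hv'
  rw [← hv]
  have e1 : inner ℝ (a ξ) (a ξ) = 1 := by rw [hAd, hξ]; exact hX.unit
  have e2 : -inner ℝ (b ξ) (a ξ) = m (crd p p) := by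
    have := hX.normalCurv_eq
    rw [normalCurv, hX.unit, div_one] at this
    rw [hNd, hAd, hξ, hm]
    simp only
    rw [par_crd]
    exact this
  have e3 : F (crd p p, ξ) = (0, 1) := by
    simp only [F]
    rw [← ha, ← hb, e1, e2]; simp
  rw [e3]
  have e4 : -inner ℝ (fderiv ℝ (N ∘ par p) v.1 v.2) (fderiv ℝ (α ∘ par p) v.1 v.2) = m v.1 := hv'.1
  have e5 : inner ℝ (fderiv ℝ (α ∘ par p) v.1 v.2) (fderiv ℝ (α ∘ par p) v.1 v.2) = (1 : ℝ) := hv'.2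
  simp only [F]
  rw [e4, e5]; simp

end Lines

/-! ### Lines as solutions of a differential equation; uniqueness -/

section LineODE

variable {M : Type*} [TopologicalSpace M] [ChartedSpace E2 M] [IsManifold (𝓡 2) ∞ M]
  {α N : M → E3} {κ : Kind}

theorem IsLine.contMDiffAt {γ : ℝ → M} {J : Set ℝ} (h : IsLine κ α N γ J) (hJ : IsOpen J) {t : ℝ}
    (ht : t ∈ J) : ContMDiffAt 𝓘(ℝ, ℝ) (𝓡 2) 1 γ t :=
  h.contMDiffOn.contMDiffAt (hJ.mem_nhds ht)

theorem IsLine.mdiff {γ : ℝ → M} {J : Set ℝ} (h : IsLine κ α N γ J) (hJ : IsOpen J) {t : ℝ}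
    (ht : t ∈ J) : MDifferentiableAt 𝓘(ℝ, ℝ) (𝓡 2) γ t :=
  (h.contMDiffAt hJ ht).mdifferentiableAt (by simp)

theorem IsLine.continuousAt_deriv (hS : IsRegularSurface α N) {γ : ℝ → M} {J : Set ℝ}
    (h : IsLine κ α N γ J) (hJ : IsOpen J) {t : ℝ} (ht : t ∈ J) :
    ContinuousAt (deriv (α ∘ γ)) t := by
  have h1 : ContDiffAt ℝ 1 (α ∘ γ) t :=
    contDiffAt_comp_of_contMDiffAt ((hS.smooth _).of_le (by norm_cast)) (h.contMDiffAt hJ ht)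
  have h2 : ContDiffAt ℝ 0 (fderiv ℝ (α ∘ γ)) t := h1.fderiv_right (by simp)
  have h3 := h2.continuousAt.clm_apply (continuousAt_const (y := (1 : ℝ)))
  exact h3

/-- In coordinates, lines of unit speed in a given direction satisfy a differential equation. -/
theorem exists_lineODE (hS : IsRegularSurface α N) {p : M} {X : TangentSpace (𝓡 2) p}
    (hX : IsUnitDir κ α N p X) :
    ∃ V : E2 → E2, ContDiffAt ℝ 4 V (crd p p) ∧ ∀ (β : ℝ → M) (J : Set ℝ) (t₀ : ℝ), IsOpen J →
      t₀ ∈ J → IsUnitLine κ α N β J → β t₀ = p → deriv (α ∘ β) t₀ = diff α p X →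
      ∀ᶠ t in 𝓝 t₀, HasDerivAt (crd p ∘ β) (V (crd p (β t))) t := by
  obtain ⟨ξ, hξ⟩ := exists_mfderiv_par_eq p X
  obtain ⟨V, hV, hV2⟩ := exists_unit_field hS hX hξ
  refine ⟨V, hV, fun β J t₀ hJ ht₀ hβ hβ0 hd => ?_⟩
  have hβc : ContMDiffAt 𝓘(ℝ, ℝ) (𝓡 2) 1 β t₀ := hβ.contMDiffAt hJ ht₀
  have hu : ContDiffAt ℝ 1 (crd p ∘ β) t₀ := by
    refine contDiffAt_comp_of_contMDiffAt ?_ hβc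
    rw [hβ0]
    exact (contMDiffAt_crd p (mem_extChartAt_source p)).of_le (by norm_cast)
  have hsrc : ∀ᶠ t in 𝓝 t₀, β t ∈ (extChartAt (𝓡 2) p).source := by
    apply hβc.continuousAt
    rw [hβ0]
    exact extChartAt_source_mem_nhds p
  have hfac : ∀ {F : Type} (f : M → F), ∀ᶠ t in 𝓝 t₀, (f ∘ β) =ᶠ[𝓝 t] (f ∘ par p) ∘ (crd p ∘ β) := by
    intro F f
    filter_upwards [hsrc.eventually_nhds] with t ht
    filter_upwards [ht] with t' ht'
    exact congrArg f ((extChartAt (𝓡 2) p).left_inv ht').symm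
  have hud : ∀ᶠ t in 𝓝 t₀, DifferentiableAt ℝ (crd p ∘ β) t :=
    (hu.eventually (by simp)).mono fun t ht => ht.differentiableAt (by simp)
  have hchain : ∀ (f : M → E3), ContMDiff (𝓡 2) 𝓘(ℝ, E3) 5 f → ∀ᶠ t in 𝓝 t₀,
      fderiv ℝ (f ∘ par p) (crd p (β t)) (deriv (crd p ∘ β) t) = diff f (β t) (velocity β t) := by
    intro f hf
    filter_upwards [hsrc, hud, hfac f, hJ.mem_nhds ht₀] with t h1 h2 h3 h4
    rw [← deriv_comp_eq_diff ((hf _).mdifferentiableAt (by simp)) (hβ.mdiff hJ h4), h3.deriv_eq]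
    have h5 : DifferentiableAt ℝ (f ∘ par p) ((crd p ∘ β) t) :=
      (contDiffAt_comp_of_contMDiffAt (hf _) ((contMDiffAt_par p
        ((extChartAt (𝓡 2) p).map_source h1)).of_le (by norm_cast))).differentiableAt (by simp)
    exact (fderiv_comp_deriv t h5 h2).symm
  have hα5 : ContMDiff (𝓡 2) 𝓘(ℝ, E3) 5 α := hS.smooth.of_le (by norm_cast)
  have hu0 : deriv (crd p ∘ β) t₀ = ξ := by
    apply injective_fderiv_chart hS p
    have h1 := (hchain α hα5).self_of_nhds
    rw [← deriv_comp_eq_diff (hS.mdiff _) (hβ.mdiff hJ ht₀), hd, hβ0] at h1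
    rw [h1, fderiv_chart (hS.mdiff p), hξ]
  -- The implicit function recovers the velocity only near `(crd p p, ξ)`. As the line is `C^1`, its
  -- position and velocity stay there for parameters close to `t₀`.
  have hlim : Filter.Tendsto (fun t => ((crd p ∘ β) t, deriv (crd p ∘ β) t)) (𝓝 t₀)
      (𝓝 (crd p p, ξ)) := by
    have h1 : Filter.Tendsto (crd p ∘ β) (𝓝 t₀) (𝓝 (crd p p)) := by
      have := hu.continuousAt.tendsto
      rwa [Function.comp_apply, hβ0] at this
    have h2 : ContDiffAt ℝ 0 (fderiv ℝ (crd p ∘ β)) t₀ := hu.fderiv_right (by simp)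
    have h3 : ContinuousAt (deriv (crd p ∘ β)) t₀ :=
      h2.continuousAt.clm_apply (continuousAt_const (y := (1 : ℝ)))
    have h4 := h3.tendsto
    rw [hu0] at h4
    exact h1.prodMk_nhds h4
  filter_upwards [hlim.eventually hV2, hchain α hα5, hchain N hS.smooth_normal, hsrc, hud,
    hJ.mem_nhds ht₀] with t h1 h2 h3 h4 h5 h6
  have h7 : par p (crd p (β t)) = β t := (extChartAt (𝓡 2) p).left_inv h4
  have h8 := hβ.isUnitDir h6
  have e := h1 ?_
  · change V (crd p (β t)) = _ at e
    rw [e]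
    exact h5.hasDerivAt
  · simp only [Function.comp_apply, pairing]
    simp only [h7, h2, h3]
    refine ⟨?_, h8.unit⟩
    rw [← h8.normalCurv_eq, normalCurv, h8.unit, div_one]
    rfl

end LineODE

/-- A solution of an autonomous equation is one degree smoother than the equation. -/
theorem contDiffAt_of_hasDerivAt_comp {E : Type*} [NormedAddCommGroup E] [NormedSpace ℝ E]
    {V : E → E} {u : ℝ → E} {t₀ : ℝ} {k : ℕ} (hV : ContDiffAt ℝ k V (u t₀))
    (hu : ∀ᶠ t in 𝓝 t₀, HasDerivAt u (V (u t)) t) : ContDiffAt ℝ (k + 1) u t₀ := by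
  have key : ∀ n : ℕ, n ≤ k + 1 → ContDiffAt ℝ n u t₀ := by
    intro n
    induction n with
    | zero =>
      intro _
      have : ∀ᶠ t in 𝓝 t₀, ContinuousAt u t := hu.mono fun t ht => ht.continuousAt
      exact contDiffAt_zero.2 ⟨_, this, fun t ht => (Set.mem_ofPred.1 ht).continuousWithinAt⟩
    | succ n ih =>
      intro hn
      have h1 := ih (by omega)
      push_cast
      rw [contDiffAt_succ_iff_hasFDerivAt]
      refine ⟨fun t => ContinuousLinearMap.toSpanSingleton ℝ (V (u t)),
        ⟨_, hu, fun t ht => (Set.mem_ofPred.1 ht).hasFDerivAt⟩, ?_⟩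
      have h2 : ContDiffAt ℝ n (fun t => V (u t)) t₀ :=
        (hV.of_le (by exact_mod_cast (by omega : n ≤ k))).comp t₀ h1
      exact (ContinuousLinearMap.toSpanSingletonCLE (𝕜 := ℝ) (E := E)).contDiff.contDiffAt.comp t₀ h2
  exact_mod_cast key (k + 1) le_rfl

section Uniqueness

variable {M : Type*} [TopologicalSpace M] [ChartedSpace E2 M] [IsManifold (𝓡 2) ∞ M]
  {α N : M → E3} {κ : Kind}

/-- Unit speed lines are of class `C^5`. -/
theorem IsUnitLine.contMDiffAt_five (hS : IsRegularSurface α N) {γ : ℝ → M} {J : Set ℝ}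
    (h : IsUnitLine κ α N γ J) (hJ : IsOpen J) {t : ℝ} (ht : t ∈ J) :
    ContMDiffAt 𝓘(ℝ, ℝ) (𝓡 2) 5 γ t := by
  obtain ⟨V, hV, hV2⟩ := exists_lineODE hS (h.isUnitDir ht)
  have h1 := hV2 γ J t hJ ht h rfl (deriv_comp_eq_diff (hS.mdiff _) (h.mdiff hJ ht))
  have h2 : ContDiffAt ℝ (4 + 1) (crd (γ t) ∘ γ) t :=
    contDiffAt_of_hasDerivAt_comp (k := 4) (u := crd (γ t) ∘ γ) hV h1
  have h3 : γ =ᶠ[𝓝 t] par (γ t) ∘ (crd (γ t) ∘ γ) := by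
    filter_upwards [(h.contMDiffAt hJ ht).continuousAt (extChartAt_source_mem_nhds (I := 𝓡 2) (γ t))] with s hs
    exact ((extChartAt (𝓡 2) (γ t)).left_inv hs).symm
  refine ContMDiffAt.congr_of_eventuallyEq ?_ h3
  refine ContMDiffAt.comp t (((contMDiffAt_par (γ t) (mem_extChartAt_target _))).of_le
    (by norm_cast)) ?_
  exact (h2.of_le (by norm_num)).contMDiffAt

/-- Both curves solve the equation of `exists_lineODE` for the same initial direction, and its
right-hand side is Lipschitz near the initial point. -/
theorem IsUnitLine.eventuallyEq (hS : IsRegularSurface α N) {β γ : ℝ → M} {J : Set ℝ}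
    (hJ : IsOpen J) (hβ : IsUnitLine κ α N β J) (hγ : IsUnitLine κ α N γ J) {t : ℝ} (ht : t ∈ J)
    (h : β t = γ t) (h' : deriv (α ∘ β) t = deriv (α ∘ γ) t) : β =ᶠ[𝓝 t] γ := by
  obtain ⟨V, hV, hV2⟩ := exists_lineODE hS (hβ.isUnitDir ht)
  have hd := deriv_comp_eq_diff (hS.mdiff _) (hβ.mdiff hJ ht)
  have h1 := hV2 β J t hJ ht hβ rfl hd
  have h2 := hV2 γ J t hJ ht hγ h.symm (h'.symm.trans hd)
  obtain ⟨K, s, hs, hK⟩ := (hV.of_le (m := 1) (by norm_num)).exists_lipschitzOnWith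
  have c1 : ContinuousAt (crd (β t) ∘ β) t :=
    ContinuousAt.comp (contMDiffAt_crd _ (mem_extChartAt_source _)).continuousAt
      (hβ.contMDiffAt hJ ht).continuousAt
  have c2 : ContinuousAt (crd (β t) ∘ γ) t := by
    refine ContinuousAt.comp ?_ (hγ.contMDiffAt hJ ht).continuousAt
    rw [← h]
    exact (contMDiffAt_crd _ (mem_extChartAt_source _)).continuousAt
  have h3 : crd (β t) ∘ β =ᶠ[𝓝 t] crd (β t) ∘ γ := by
    refine ODE_solution_unique_of_eventually (v := fun _ => V) (s := fun _ => s) (K := K)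
      (Filter.Eventually.of_forall fun _ => hK) (h1.and (c1 hs)) (h2.and (c2 ?_))
      (congrArg (crd (β t)) h)
    simpa [← h] using hs
  have hsrc := extChartAt_source_mem_nhds (I := 𝓡 2) (β t)
  have hsrc' := hsrc
  rw [h] at hsrc'
  filter_upwards [h3, (hβ.contMDiffAt hJ ht).continuousAt hsrc,
    (hγ.contMDiffAt hJ ht).continuousAt hsrc'] with s h4 h5 h6
  exact (extChartAt (𝓡 2) (β t)).injOn h5 (by rw [h]; exact h6) h4

/-- The set where position and velocity agree is open by local uniqueness and closed in `J` by
continuity; points of `M` are separated by the Hausdorff property. Velocities are compared in `E3`,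
so no tangent spaces at different points need to be identified. -/
theorem IsUnitLine.eqOn [T2Space M] (hS : IsRegularSurface α N) {β γ : ℝ → M} {J : Set ℝ}
    (hJ : IsOpen J) (hJc : IsPreconnected J) (hβ : IsUnitLine κ α N β J)
    (hγ : IsUnitLine κ α N γ J) {t₀ : ℝ} (ht₀ : t₀ ∈ J) (h : β t₀ = γ t₀)
    (h' : deriv (α ∘ β) t₀ = deriv (α ∘ γ) t₀) : Set.EqOn β γ J := by
  let S : Set ℝ := {t | t ∈ J ∧ β t = γ t ∧ deriv (α ∘ β) t = deriv (α ∘ γ) t}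
  have hopen : IsOpen S := by
    rw [isOpen_iff_mem_nhds]
    rintro t ⟨ht, h1, h2⟩
    have h3 := hβ.eventuallyEq hS hJ hγ ht h1 h2
    filter_upwards [h3.eventually_nhds, hJ.mem_nhds ht] with s hs hs'
    exact ⟨hs', hs.self_of_nhds, Filter.EventuallyEq.deriv_eq (hs.mono fun x hx => congrArg α hx)⟩
  have hsub : J ⊆ S := by
    refine hJc.subset_of_closure_inter_subset hopen ⟨t₀, ht₀, ht₀, h, h'⟩ ?_
    rintro t ⟨ht, htJ⟩
    rw [mem_closure_iff_frequently] at ht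
    refine ⟨htJ, ?_, ?_⟩
    · by_contra hne
      have := ((hβ.contMDiffAt hJ htJ).continuousAt.ne_iff_eventually_ne
        (hγ.contMDiffAt hJ htJ).continuousAt).1 hne
      exact ht (this.mono fun s hs hs' => hs hs'.2.1)
    · by_contra hne
      have := ((hβ.continuousAt_deriv hS hJ htJ).ne_iff_eventually_ne
        (hγ.continuousAt_deriv hS hJ htJ)).1 hne
      exact ht (this.mono fun s hs hs' => hs hs'.2.2)
  exact fun t ht => (hsub ht).2.1

end Uniqueness

/-! ### Reparametrization by arc length -/

/-- A continuous function bounded below by a positive constant is the derivative of an increasing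
bijection of the line, whose inverse is continuously differentiable. -/
theorem exists_inverse_primitive {v : ℝ → ℝ} (hv : Continuous v) {c : ℝ} (hc : 0 < c)
    (hvc : ∀ t, c ≤ v t) :
    ∃ ℓ h : ℝ → ℝ, StrictMono ℓ ∧ StrictMono h ∧ ℓ 0 = 0 ∧ (∀ t, h (ℓ t) = t) ∧
      (∀ s, ℓ (h s) = s) ∧ Continuous h ∧ ∀ s, HasDerivAt h (v (h s))⁻¹ s := by
  let ℓ : ℝ → ℝ := fun t => ∫ x in (0 : ℝ)..t, v x
  have hd : ∀ t, HasDerivAt ℓ (v t) t := fun t =>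
    intervalIntegral.integral_hasDerivAt_right (hv.intervalIntegrable _ _)
      (hv.stronglyMeasurableAtFilter _ _) hv.continuousAt
  have hcont : Continuous ℓ := continuous_iff_continuousAt.2 fun t => (hd t).continuousAt
  have hmono : StrictMono ℓ := strictMono_of_deriv_pos fun t => by
    rw [(hd t).deriv]; exact hc.trans_le (hvc t)
  have h0 : ℓ 0 = 0 := by simp [ℓ]
  -- Since `ℓ' ≥ c`, the function `ℓ t - c t` is monotone. So `ℓ` is unbounded in both directions,
  -- hence onto.
  have hdm : Monotone fun t => ℓ t - c * t := by
    have hd' : ∀ t, HasDerivAt (fun t => ℓ t - c * t) (v t - c * 1) t := fun t =>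
      (hd t).sub ((hasDerivAt_id t).const_mul c)
    refine monotone_of_deriv_nonneg (fun t => (hd' t).differentiableAt) fun t => ?_
    rw [(hd' t).deriv, mul_one]
    exact sub_nonneg.2 (hvc t)
  have hsurj : Function.Surjective ℓ := by
    refine hcont.surjective ?_ ?_
    · refine Filter.tendsto_atTop_mono' _ ?_ (Filter.tendsto_id.const_mul_atTop hc)
      filter_upwards [Filter.eventually_ge_atTop 0] with t ht
      have := hdm ht
      simp [h0] at this
      simpa using this
    · refine Filter.tendsto_atBot_mono' _ ?_ (Filter.tendsto_id.const_mul_atBot hc)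
      filter_upwards [Filter.eventually_le_atBot 0] with t ht
      have := hdm ht
      simp [h0] at this
      simpa using this
  let e := hmono.orderIsoOfSurjective ℓ hsurj
  have he : ∀ t, e t = ℓ t := fun t => rfl
  have hsc : Continuous e.symm := e.symm.continuous
  refine ⟨ℓ, e.symm, hmono, e.symm.strictMono, h0, fun t => e.symm_apply_apply t,
    fun s => e.apply_symm_apply s, hsc, fun s => ?_⟩
  exact HasDerivAt.of_local_left_inverse hsc.continuousAt (hd _) (hc.trans_le (hvc _)).ne'
    (Filter.Eventually.of_forall fun s => e.apply_symm_apply s)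

section Reparam

variable {M : Type*} [TopologicalSpace M] [ChartedSpace E2 M] [IsManifold (𝓡 2) ∞ M]
  {α N : M → E3} {κ : Kind}

theorem IsLine.deriv_ne_zero (hS : IsRegularSurface α N) {γ : ℝ → M} {J : Set ℝ}
    (h : IsLine κ α N γ J) (hJ : IsOpen J) {t : ℝ} (ht : t ∈ J) : deriv (α ∘ γ) t ≠ 0 := by
  rw [deriv_comp_eq_diff (hS.mdiff _) (h.mdiff hJ ht)]
  intro h0
  exact h.regular t ht (hS.injective _ (h0.trans (map_zero _).symm))

theorem velocity_comp {γ : ℝ → M} {h : ℝ → ℝ} {s h' : ℝ}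
    (hγ : MDifferentiableAt 𝓘(ℝ, ℝ) (𝓡 2) γ (h s)) (hh : HasDerivAt h h' s) :
    velocity (γ ∘ h) s = h' • velocity γ (h s) := by
  have h1 : MDifferentiableAt 𝓘(ℝ, ℝ) 𝓘(ℝ, ℝ) h s := hh.differentiableAt.mdifferentiableAt
  unfold velocity
  rw [mfderiv_comp s hγ h1, mfderiv_eq_fderiv]
  change mfderiv 𝓘(ℝ, ℝ) (𝓡 2) γ (h s) (fderiv ℝ h s 1) = _
  have h2 : fderiv ℝ h s 1 = h' • (1 : ℝ) := by rw [hh.hasFDerivAt.fderiv]; simp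
  rw [h2]
  exact map_smul (mfderiv 𝓘(ℝ, ℝ) (𝓡 2) γ (h s)) h' (1 : ℝ)

/-- Reparametrization of a line by arc length. -/
theorem IsLine.exists_isUnitLine (hS : IsRegularSurface α N) {γ : ℝ → M} {a b t₁ : ℝ}
    (hγ : IsLine κ α N γ (Set.Ioo a b)) (ha : a < 0) (ht₁ : 0 < t₁) (hb : t₁ < b) :
    ∃ (h : ℝ → ℝ) (a' b' s₁ : ℝ), StrictMono h ∧ h 0 = 0 ∧ a' < 0 ∧ 0 < s₁ ∧ s₁ < b' ∧
      h s₁ = t₁ ∧ IsUnitLine κ α N (γ ∘ h) (Set.Ioo a' b') ∧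
      ∃ r : ℝ, 0 < r ∧ deriv (α ∘ (γ ∘ h)) 0 = r • deriv (α ∘ γ) 0 := by
  -- On `(a, b)` the speed may degenerate at the ends. It has a positive minimum on a compact
  -- interval `[A, B]` whose interior contains `0` and `t₁`, and it is extended by constants so that
  -- arc length is a bijection of the whole line.
  obtain ⟨A, hA1, hA2⟩ := exists_between ha
  obtain ⟨B, hB1, hB2⟩ := exists_between hb
  have hAB : A ≤ B := by linarith
  have hsub : Set.Icc A B ⊆ Set.Ioo a b := fun t ht => ⟨hA1.trans_le ht.1, ht.2.trans_lt hB2⟩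
  have hcont : ContinuousOn (fun t => ‖deriv (α ∘ γ) t‖) (Set.Icc A B) := fun t ht =>
    (hγ.continuousAt_deriv hS isOpen_Ioo (hsub ht)).norm.continuousWithinAt
  let v : ℝ → ℝ := Set.IccExtend hAB ((Set.Icc A B).domRestrict fun t => ‖deriv (α ∘ γ) t‖)
  have hv : Continuous v := hcont.domRestrict.Icc_extend'
  have hvt : ∀ t ∈ Set.Icc A B, v t = ‖deriv (α ∘ γ) t‖ := fun t ht =>
    Set.IccExtend_of_mem hAB _ ht
  obtain ⟨t₂, ht₂, hmin⟩ := isCompact_Icc.exists_isMinOn (Set.nonempty_Icc.2 hAB) hcont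
  have hc : 0 < ‖deriv (α ∘ γ) t₂‖ :=
    norm_pos_iff.2 (hγ.deriv_ne_zero hS isOpen_Ioo (hsub ht₂))
  have hvc : ∀ t, ‖deriv (α ∘ γ) t₂‖ ≤ v t := fun t =>
    hmin (Set.projIcc A B hAB t).2
  obtain ⟨ℓ, h, hℓ, hh, hℓ0, hhℓ, hℓh, hhc, hhd⟩ := exists_inverse_primitive hv hc hvc
  have hh0 : h 0 = 0 := by have := hhℓ 0; rwa [hℓ0] at this
  have hmem : ∀ s ∈ Set.Ioo (ℓ A) (ℓ B), h s ∈ Set.Icc A B := by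
    intro s hs
    refine ⟨?_, ?_⟩
    · rw [← hhℓ A]; exact (hh hs.1).le
    · rw [← hhℓ B]; exact (hh hs.2).le
  have hvel : ∀ s ∈ Set.Ioo (ℓ A) (ℓ B),
      velocity (γ ∘ h) s = (v (h s))⁻¹ • velocity γ (h s) := fun s hs =>
    velocity_comp (hγ.mdiff isOpen_Ioo (hsub (hmem s hs))) (hhd s)
  have hvpos : ∀ s, 0 < (v (h s))⁻¹ := fun s => inv_pos.2 (hc.trans_le (hvc _))
  have hline : IsLine κ α N (γ ∘ h) (Set.Ioo (ℓ A) (ℓ B)) := by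
    refine ⟨?_, ?_, ?_, ?_, ?_, ?_⟩
    · have h1 : ContDiff ℝ 1 h := by
        rw [contDiff_one_iff_deriv]
        refine ⟨fun s => (hhd s).differentiableAt, ?_⟩
        have : deriv h = fun s => (v (h s))⁻¹ := funext fun s => (hhd s).deriv
        rw [this]
        exact (hv.comp hhc).inv₀ fun s => (hc.trans_le (hvc _)).ne'
      exact hγ.contMDiffOn.comp h1.contMDiff.contMDiffOn fun s hs => hsub (hmem s hs)
    · intro s hs
      rw [hvel s hs]
      exact smul_ne_zero (hvpos s).ne' (hγ.regular _ (hsub (hmem s hs)))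
    · exact fun s hs => hγ.elliptic _ (hsub (hmem s hs))
    · exact fun s hs => hγ.nonumbilic _ (hsub (hmem s hs))
    · intro s hs
      rw [hvel s hs]
      exact (normalCurv_smul (hvpos s).ne' _).trans (hγ.normalCurv_eq _ (hsub (hmem s hs)))
    · intro s hs
      rw [hvel s hs]
      refine (hγ.torsion_sign _ (hsub (hmem s hs))).trans_eq ?_
      exact congrArg _ (geodTorsion_smul (hvpos s).ne' _).symm
  have hA0 : ℓ A < 0 := by rw [← hℓ0]; exact hℓ hA2
  have hB0 : 0 < ℓ t₁ := by rw [← hℓ0]; exact hℓ ht₁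
  refine ⟨h, ℓ A, ℓ B, ℓ t₁, hh, hh0, hA0, hB0, hℓ hB1, hhℓ t₁, ⟨hline, ?_⟩, ?_⟩
  · intro s hs
    rw [hvel s hs]
    have h1 := hvt _ (hmem s hs)
    rw [deriv_comp_eq_diff (hS.mdiff _) (hγ.mdiff isOpen_Ioo (hsub (hmem s hs)))] at h1
    have h2 : firstForm α (γ (h s)) (velocity γ (h s)) (velocity γ (h s)) = v (h s) ^ 2 := by
      rw [h1, firstForm, real_inner_self_eq_norm_sq]
    change firstForm α (γ (h s)) ((v (h s))⁻¹ • velocity γ (h s))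
      ((v (h s))⁻¹ • velocity γ (h s)) = 1
    rw [firstForm_smul_left, firstForm_smul_right, h2]
    have := inv_pos.1 (hvpos s)
    field_simp
  · have h0 : (0 : ℝ) ∈ Set.Ioo (ℓ A) (ℓ B) := ⟨hA0, hB0.trans (hℓ hB1)⟩
    refine ⟨(v (h 0))⁻¹, hvpos 0, ?_⟩
    rw [deriv_comp_eq_diff (hS.mdiff _) (hline.mdiff isOpen_Ioo h0), hvel 0 h0,
      deriv_comp_eq_diff (hS.mdiff _)
        (hγ.mdiff isOpen_Ioo (by rw [← hh0]; exact hsub (hmem 0 h0)))]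
    have hg : ∀ t, t = 0 → diff α (γ t) ((v t)⁻¹ • velocity γ t)
        = (v t)⁻¹ • diff α (γ 0) (velocity γ 0) := by
      rintro t rfl
      exact map_smul _ _ _
    exact hg _ hh0

end Reparam

/-! ### Uniqueness of the germ of the return map -/

section ReturnMap

variable {M : Type*} [TopologicalSpace M] [T2Space M] [ChartedSpace E2 M]
  [IsManifold (𝓡 2) ∞ M] {α N : M → E3} {κ : Kind}

/-- By `eq_or_eq_neg_of_line` the two unit velocities agree up to sign, and having a positive
product with the same `w` excludes opposite signs. -/
theorem IsUnitLine.deriv_eq (hS : IsRegularSurface α N) {β γ : ℝ → M} {J J' : Set ℝ}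
    (hJ : IsOpen J) (hJ' : IsOpen J') (hβ : IsUnitLine κ α N β J) (hγ : IsUnitLine κ α N γ J')
    {t : ℝ} (ht : t ∈ J) (ht' : t ∈ J') (h : β t = γ t) {w : E3}
    (h1 : 0 < inner ℝ (deriv (α ∘ β) t) w) (h2 : 0 < inner ℝ (deriv (α ∘ γ) t) w) :
    deriv (α ∘ β) t = deriv (α ∘ γ) t := by
  have e1 := hβ.isUnitDir ht
  have e2 := hγ.isUnitDir ht'
  rw [deriv_comp_eq_diff (hS.mdiff _) (hβ.mdiff hJ ht)] at h1 ⊢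
  rw [deriv_comp_eq_diff (hS.mdiff _) (hγ.mdiff hJ' ht')] at h2 ⊢
  generalize velocity β t = X at *
  generalize velocity γ t = X' at *
  generalize β t = p at *
  generalize γ t = q at *
  subst h
  rcases eq_or_eq_neg_of_line (hS.injective p) (hS.norm_eq_one p) (hS.orthogonal p) (hS.symm p)
    e1.unit e2.unit e1.normalCurv_eq e2.normalCurv_eq e1.torsion_sign e2.torsion_sign with h3 | h3
  · rw [h3]
  · rw [h3, map_neg, inner_neg_left] at h2
    linarith

/-- The value at `0` lies in `(-δ, δ)` for all small `δ`. -/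
theorem IsReturnMap.apply_zero {c σ : ℝ → M} {P : ℝ → ℝ} (hP : IsReturnMap κ α N c σ P) :
    P 0 = 0 := by
  have h1 : ∀ᶠ δ in 𝓝[>] (0 : ℝ), P 0 ∈ Set.Ioo (-δ) δ := by
    filter_upwards [hP] with δ hδ
    obtain ⟨_, _, _, _, _, _, _, _, _, _, h, _⟩ := hδ.self_of_nhds
    exact h
  have h2 : |P 0| ≤ 0 := by
    refine ge_of_tendsto (Filter.tendsto_id.mono_left (nhdsWithin_le_nhds (s := Set.Ioi (0 : ℝ)))) ?_
    filter_upwards [h1] with δ hδ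
    exact (abs_lt.2 hδ).le
  exact abs_nonpos_iff.1 h2

/-- The first return map is determined as a germ. -/
theorem IsReturnMap.eventuallyEq (hS : IsRegularSurface α N) {c σ : ℝ → M} {P Q : ℝ → ℝ}
    (hσ : ∃ ε > 0, Set.InjOn σ (Set.Ioo (-ε) ε)) (hP : IsReturnMap κ α N c σ P)
    (hQ : IsReturnMap κ α N c σ Q) : P =ᶠ[𝓝 0] Q := by
  obtain ⟨ε, hε, hinj⟩ := hσ
  obtain ⟨δ, ⟨hPδ, hQδ⟩, hδ⟩ := ((hP.and hQ).and (Ioo_mem_nhdsGT hε)).exists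
  filter_upwards [hPδ, hQδ] with v h1 h2
  obtain ⟨γ, a, b, t, ha, ht, hb, hγ, hγ0, hγd, hPm, hPe, hPf⟩ := h1
  obtain ⟨γ', a', b', t', ha', ht', hb', hγ', hγ0', hγd', hQm, hQe, hQf⟩ := h2
  obtain ⟨h, A, B, s, hm, h0, hA, hs, hB, hhs, hu, r, hr, hd⟩ :=
    hγ.exists_isUnitLine hS ha ht hb
  obtain ⟨h', A', B', s', hm', h0', hA', hs', hB', hhs', hu', r', hr', hd'⟩ :=
    hγ'.exists_isUnitLine hS ha' ht' hb'
  have hz : (γ ∘ h) 0 = (γ' ∘ h') 0 := by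
    simp only [Function.comp_apply, h0, h0', hγ0, hγ0']
  have hder : deriv (α ∘ (γ ∘ h)) 0 = deriv (α ∘ (γ' ∘ h')) 0 := by
    refine hu.deriv_eq hS isOpen_Ioo isOpen_Ioo hu' ⟨hA, hs.trans hB⟩ ⟨hA', hs'.trans hB'⟩ hz
      (w := deriv (α ∘ c) 0) ?_ ?_
    · rw [hd, real_inner_smul_left]; exact mul_pos hr hγd
    · rw [hd', real_inner_smul_left]; exact mul_pos hr' hγd'
  have hsub1 : Set.Ioo (max A A') (min B B') ⊆ Set.Ioo A B :=
    Set.Ioo_subset_Ioo (le_max_left _ _) (min_le_left _ _)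
  have hsub2 : Set.Ioo (max A A') (min B B') ⊆ Set.Ioo A' B' :=
    Set.Ioo_subset_Ioo (le_max_right _ _) (min_le_right _ _)
  have hres : ∀ {β : ℝ → M} {J J' : Set ℝ}, IsUnitLine κ α N β J → J' ⊆ J →
      IsUnitLine κ α N β J' := fun hβ hJ =>
    ⟨⟨hβ.contMDiffOn.mono hJ, fun t ht => hβ.regular t (hJ ht), fun t ht => hβ.elliptic t (hJ ht),
      fun t ht => hβ.nonumbilic t (hJ ht), fun t ht => hβ.normalCurv_eq t (hJ ht),
      fun t ht => hβ.torsion_sign t (hJ ht)⟩, fun t ht => hβ.unit_speed t (hJ ht)⟩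
  have heq : Set.EqOn (γ ∘ h) (γ' ∘ h') (Set.Ioo (max A A') (min B B')) :=
    (hres hu hsub1).eqOn hS isOpen_Ioo isPreconnected_Ioo (hres hu' hsub2)
      (t₀ := 0) ⟨max_lt hA hA', lt_min (hs.trans hB) (hs'.trans hB')⟩ hz hder
  have hpos : ∀ {h : ℝ → ℝ} {x y : ℝ}, StrictMono h → h 0 = 0 → 0 < x → x < y →
      h x ∈ Set.Ioo 0 (h y) := fun hm h0 hx hxy => ⟨by rw [← h0]; exact hm hx, hm hxy⟩
  -- If one arrival came earlier, the other line, which runs through the same points, would already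
  -- be on the section `σ (-δ, δ)` at that moment, before its own first return.
  have hss : s = s' := by
    rcases lt_trichotomy s s' with hlt | heq' | hlt
    · exfalso
      have e := heq (x := s) ⟨max_lt (hA.trans hs) (hA'.trans hs), lt_min hB (hlt.trans hB')⟩
      simp only [Function.comp_apply, hhs, hPe] at e
      have hp := hpos hm' h0' hs hlt
      rw [hhs'] at hp
      exact hQf _ hp (e ▸ ⟨P v, hPm, rfl⟩)
    · exact heq'
    · exfalso
      have e := heq (x := s') ⟨max_lt (hA.trans hs') (hA'.trans hs'), lt_min (hlt.trans hB) hB'⟩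
      simp only [Function.comp_apply, hhs', hQe] at e
      have hp := hpos hm h0 hs' hlt
      rw [hhs] at hp
      exact hPf _ hp (e ▸ ⟨Q v, hQm, rfl⟩)
  have e := heq (x := s) ⟨max_lt (hA.trans hs) (hA'.trans hs), lt_min hB (hss ▸ hB')⟩
  simp only [Function.comp_apply] at e
  rw [hhs, hss, hhs', hPe, hQe] at e
  have hδε : Set.Ioo (-δ) δ ⊆ Set.Ioo (-ε) ε :=
    Set.Ioo_subset_Ioo (neg_le_neg hδ.2.le) hδ.2.le
  exact hinj (hδε hPm) (hδε hQm) e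

end ReturnMap

/-! ### Construction of a strip along a line -/

section Strip

variable {M : Type*} [TopologicalSpace M] [ChartedSpace E2 M] [IsManifold (𝓡 2) ∞ M]
  {α N : M → E3} {κ : Kind}

theorem IsCycle.isUnitLine {c : ℝ → M} {L : ℝ} (hc : IsCycle κ α N c L) :
    IsUnitLine κ α N c Set.univ :=
  ⟨hc.isLine, fun t _ => by
    rw [firstForm, real_inner_self_eq_norm_sq, hc.unit_speed]; norm_num⟩

/-- The unit tangent of a curve, as a vector of Euclidean space. -/
def tang (α : M → E3) (c : ℝ → M) (s : ℝ) : E3 := deriv (α ∘ c) s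

/-- The conormal `N ∧ T` of a curve. -/
def conormal (α N : M → E3) (c : ℝ → M) (s : ℝ) : E3 := wedge (N (c s)) (tang α c s)

variable {c : ℝ → M}

theorem contDiff_curve (hS : IsRegularSurface α N) (hc : IsUnitLine κ α N c Set.univ) :
    ContDiff ℝ 5 (α ∘ c) := contDiff_iff_contDiffAt.2 fun _ =>
  contDiffAt_comp_of_contMDiffAt ((hS.smooth _).of_le (by norm_cast))
    (hc.contMDiffAt_five hS isOpen_univ (Set.mem_univ _))

theorem contDiff_normal_curve (hS : IsRegularSurface α N) (hc : IsUnitLine κ α N c Set.univ) :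
    ContDiff ℝ 5 (N ∘ c) := contDiff_iff_contDiffAt.2 fun _ =>
  contDiffAt_comp_of_contMDiffAt (hS.smooth_normal _)
    (hc.contMDiffAt_five hS isOpen_univ (Set.mem_univ _))

theorem contDiff_tang (hS : IsRegularSurface α N) (hc : IsUnitLine κ α N c Set.univ) :
    ContDiff ℝ 4 (tang α c) := by
  have h := contDiff_curve hS hc
  have h2 : ContDiff ℝ (4 + 1) (α ∘ c) := h.of_le (by norm_num)
  exact (contDiff_succ_iff_deriv.1 h2).2.2

theorem contDiff_conormal (hS : IsRegularSurface α N) (hc : IsUnitLine κ α N c Set.univ) :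
    ContDiff ℝ 4 (conormal α N c) :=
  (wedgeL.contDiff.comp ((contDiff_normal_curve hS hc).of_le (by norm_cast))).clm_apply
    (contDiff_tang hS hc)

theorem tang_eq (hS : IsRegularSurface α N) (hc : IsUnitLine κ α N c Set.univ) (s : ℝ) :
    tang α c s = diff α (c s) (velocity c s) :=
  deriv_comp_eq_diff (hS.mdiff _) (hc.mdiff isOpen_univ (Set.mem_univ s))

theorem inner_tang_self (hS : IsRegularSurface α N) (hc : IsUnitLine κ α N c Set.univ) (s : ℝ) :
    inner ℝ (tang α c s) (tang α c s) = (1 : ℝ) := by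
  rw [tang_eq hS hc]; exact hc.unit_speed s (Set.mem_univ s)

theorem inner_normal_tang (hS : IsRegularSurface α N) (hc : IsUnitLine κ α N c Set.univ) (s : ℝ) :
    inner ℝ (N (c s)) (tang α c s) = (0 : ℝ) := by
  rw [tang_eq hS hc]; exact hS.orthogonal _ _

theorem continuous_of_isUnitLine (hc : IsUnitLine κ α N c Set.univ) : Continuous c :=
  continuous_iff_continuousAt.2 fun s => (hc.contMDiffAt isOpen_univ (Set.mem_univ s)).continuousAt

/-- Components of `α q - α (c s)` in the tangent plane at `c s`. -/
def offset (α N : M → E3) (c : ℝ → M) (x : ℝ × M) : ℝ × ℝ :=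
  (inner ℝ (tang α c x.1) (α x.2 - α (c x.1)), inner ℝ (conormal α N c x.1) (α x.2 - α (c x.1)))

theorem continuous_offset (hS : IsRegularSurface α N) (hc : IsUnitLine κ α N c Set.univ) :
    Continuous (offset α N c) := by
  have h1 := (contDiff_tang hS hc).continuous
  have h2 := (contDiff_conormal hS hc).continuous
  have h3 : Continuous (α ∘ c) := (contDiff_curve hS hc).continuous
  have h4 := hS.smooth.continuous
  have h5 : Continuous fun x : ℝ × M => α x.2 - α (c x.1) :=
    (h4.comp continuous_snd).sub (h3.comp continuous_fst)
  exact ((h1.comp continuous_fst).inner h5).prodMk ((h2.comp continuous_fst).inner h5)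

theorem offset_self (s : ℝ) : offset α N c (s, c s) = 0 := by
  simp [offset]

/-- Implicit function theorem for `u ↦ offset (s, par u)`. Its derivative records the components
along `T` and `N ∧ T` of a vector tangent to the surface, so it is injective. The last clause says
that points near `c s₀` are determined by `s` and their offset. -/
theorem exists_offset_inverse (hS : IsRegularSurface α N) (hc : IsUnitLine κ α N c Set.univ)
    (s₀ : ℝ) : ∃ ψ : ℝ × ℝ × ℝ → E2, ContDiffAt ℝ 4 ψ (s₀, 0) ∧ ψ (s₀, 0) = crd (c s₀) (c s₀) ∧
      (∀ᶠ x in 𝓝 (s₀, (0 : ℝ × ℝ)), offset α N c (x.1, par (c s₀) (ψ x)) = x.2) ∧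
      ∀ᶠ x in 𝓝 (s₀, c s₀), par (c s₀) (ψ (x.1, offset α N c x)) = x.2 := by
  set p := c s₀ with hp
  have hA : ContDiffAt ℝ 4 (α ∘ par p) (crd p p) :=
    contDiffAt_comp_of_contMDiffAt ((hS.smooth _).of_le (by norm_cast))
      ((contMDiffAt_par p (mem_extChartAt_target p)).of_le (by norm_cast))
  let f : (ℝ × ℝ × ℝ) × E2 → ℝ × ℝ := fun v => offset α N c (v.1.1, par p v.2) - v.1.2
  let u₀ : (ℝ × ℝ × ℝ) × E2 := ((s₀, 0), crd p p)
  have hpar0 : par p (crd p p) = c s₀ := par_crd p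
  have hf : ContDiffAt ℝ 4 f u₀ := by
    have e1 : ContDiffAt ℝ 4 (fun v : (ℝ × ℝ × ℝ) × E2 => v.1.1) u₀ :=
      contDiffAt_fst.fst
    have e2 : ContDiffAt ℝ 4 (fun v : (ℝ × ℝ × ℝ) × E2 => (α ∘ par p) v.2 - (α ∘ c) v.1.1) u₀ :=
      (ContDiffAt.comp u₀ (g := α ∘ par p) hA contDiffAt_snd).sub
        (((contDiff_curve hS hc).of_le (by norm_cast)).contDiffAt.comp u₀ e1)
    have e3 := (contDiff_tang hS hc).contDiffAt.comp u₀ e1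
    have e4 := (contDiff_conormal hS hc).contDiffAt.comp u₀ e1
    exact ((e3.inner ℝ e2).prodMk (e4.inner ℝ e2)).sub contDiffAt_fst.snd
  have hf0 : f u₀ = 0 := by
    simp only [f, u₀, hpar0, offset_self, sub_zero]
  have hf2 : ∀ ζ, (fderiv ℝ f u₀ ∘L .inr ℝ (ℝ × ℝ × ℝ) E2) ζ =
      (inner ℝ (tang α c s₀) (fderiv ℝ (α ∘ par p) (crd p p) ζ),
        inner ℝ (conormal α N c s₀) (fderiv ℝ (α ∘ par p) (crd p p) ζ)) := by
    intro ζ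
    have h1 : HasFDerivAt (fun ζ => f ((s₀, 0), ζ))
        (fderiv ℝ f u₀ ∘L .inr ℝ (ℝ × ℝ × ℝ) E2) (crd p p) :=
      (hf.differentiableAt (by norm_num)).hasFDerivAt.comp (crd p p)
        (hasFDerivAt_prodMk_right (s₀, (0 : ℝ × ℝ)) (crd p p))
    have h2 : HasFDerivAt (fun u => α (par p u) - α (c s₀)) (fderiv ℝ (α ∘ par p) (crd p p))
        (crd p p) := (hA.differentiableAt (by norm_num)).hasFDerivAt.sub_const _
    have h3 := (innerSL ℝ (tang α c s₀)).hasFDerivAt.comp (crd p p) h2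
    have h4 := (innerSL ℝ (conormal α N c s₀)).hasFDerivAt.comp (crd p p) h2
    have h5 := (h3.prodMk h4).sub_const (0 : ℝ × ℝ)
    have h6 := h1.unique h5
    rw [h6]
    simp
  have hinv : (fderiv ℝ f u₀ ∘L .inr ℝ (ℝ × ℝ × ℝ) E2).IsInvertible := by
    have hinj : Function.Injective (fderiv ℝ f u₀ ∘L .inr ℝ (ℝ × ℝ × ℝ) E2) := by
      rw [injective_iff_map_eq_zero]
      intro ζ hζ
      rw [hf2, Prod.mk_eq_zero] at hζ
      have h1 := eq_frame (hS.inner_self p) (inner_tang_self hS hc s₀) (inner_normal_tang hS hc s₀)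
        (fderiv ℝ (α ∘ par p) (crd p p) ζ)
      have h2 : inner ℝ (N p) (fderiv ℝ (α ∘ par p) (crd p p) ζ) = 0 := by
        rw [fderiv_chart (hS.mdiff p)]; exact hS.orthogonal _ _
      have h3 : inner ℝ (wedge (N p) (tang α c s₀)) (fderiv ℝ (α ∘ par p) (crd p p) ζ) = 0 := hζ.2
      rw [hζ.1, h2, h3] at h1
      simp only [zero_smul, add_zero] at h1
      exact injective_fderiv_chart hS p (h1.trans (map_zero _).symm)
    let e := LinearEquiv.ofInjectiveOfFinrankEq
      (fderiv ℝ f u₀ ∘L .inr ℝ (ℝ × ℝ × ℝ) E2).toLinearMap hinj (by simp)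
    exact ⟨e.toContinuousLinearEquiv, by ext ζ <;> rfl⟩
  refine ⟨hf.implicitFunction (by norm_num) hinv,
    hf.contDiffAt_implicitFunction (by norm_num) hinv,
    hf.implicitFunction_apply_self (by norm_num) hinv, ?_, ?_⟩
  · filter_upwards [hf.eventually_apply_implicitFunction (by norm_num) hinv] with x hx
    rw [hf0] at hx
    exact sub_eq_zero.1 hx
  · have hlim : Filter.Tendsto (fun x : ℝ × M => ((x.1, offset α N c x), crd p x.2))
        (𝓝 (s₀, c s₀)) (𝓝 u₀) := by
      have h1 : ContinuousAt (crd p) (c s₀) :=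
        (contMDiffAt_crd p (mem_extChartAt_source p)).continuousAt
      have h2 : ContinuousAt (fun x : ℝ × M => ((x.1, offset α N c x), crd p x.2)) (s₀, c s₀) :=
        (continuousAt_fst.prodMk (continuous_offset hS hc).continuousAt).prodMk
          (ContinuousAt.comp (f := Prod.snd) (g := crd p) h1 continuousAt_snd)
      have h3 := h2.tendsto
      rwa [offset_self] at h3
    have hsrc : ∀ᶠ x : ℝ × M in 𝓝 (s₀, c s₀), x.2 ∈ (extChartAt (𝓡 2) p).source :=
      continuousAt_snd (extChartAt_source_mem_nhds (I := 𝓡 2) p)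
    filter_upwards [hlim.eventually
      (hf.eventually_apply_eq_iff_implicitFunction (by norm_num) hinv), hsrc] with x hx hx'
    have h1 : par p (crd p x.2) = x.2 := (extChartAt (𝓡 2) p).left_inv hx'
    rw [hf0] at hx
    have h2 := hx.1 (by simp only [f]; rw [h1]; simp)
    change _ = crd p x.2 at h2
    rw [h2, h1]

/-- Coordinates `(s, w)` along a unit speed line `c`: the point `Φ (s, w)` projects onto
`α (c s) + w (N ∧ T)(s)` in the tangent plane at `c s`. -/
theorem exists_strip (hS : IsRegularSurface α N) (hc : IsUnitLine κ α N c Set.univ) (s₁ s₂ : ℝ) :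
    ∃ Φ : ℝ × ℝ → M, ∀ s ∈ Set.Icc s₁ s₂,
      ContMDiffAt 𝓘(ℝ, ℝ × ℝ) (𝓡 2) 4 Φ (s, 0) ∧ Φ (s, 0) = c s ∧
      ∀ᶠ z in 𝓝 (s, (0 : ℝ)), offset α N c (z.1, Φ z) = (0, z.2) := by
  classical
  have hcc := continuous_of_isUnitLine hc
  let Ψ : ℝ × M → ℝ × ℝ × ℝ := fun x => (x.1, offset α N c x)
  have hΨ : Continuous Ψ := continuous_fst.prodMk (continuous_offset hS hc)
  -- A map that is injective on a compact set and near each of its points is injective on a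
  -- neighbourhood. The set is the graph of `c` in `ℝ × M` and `Ψ` keeps `s`, so it does not matter
  -- that the curve returns to the same points of the surface.
  let S : Set (ℝ × M) := (fun s => (s, c s)) '' Set.Icc s₁ s₂
  have hSc : IsCompact S := isCompact_Icc.image (continuous_id.prodMk hcc)
  have hSinj : Set.InjOn Ψ S := by
    rintro _ ⟨s, -, rfl⟩ _ ⟨s', -, rfl⟩ h
    have : s = s' := congrArg Prod.fst h
    rw [this]
  obtain ⟨t, ht, htinj⟩ := hSinj.exists_mem_nhdsSet hSc (fun x _ => hΨ.continuousAt) (by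
    rintro _ ⟨s, -, rfl⟩
    obtain ⟨ψ, -, -, -, h⟩ := exists_offset_inverse hS hc s
    refine ⟨_, h, fun x hx y hy hxy => ?_⟩
    have hx' : par (c s) (ψ (Ψ x)) = x.2 := hx
    have hy' : par (c s) (ψ (Ψ y)) = y.2 := hy
    have hxy' : Ψ x = Ψ y := hxy
    exact Prod.ext (congrArg (fun z => z.1) hxy') (by rw [← hx', ← hy', hxy']))
  -- The unique point in the injectivity neighbourhood `t` with offset `(0, w)`. The default `c z.1`
  -- is irrelevant: near the axis the local inverses `ψ` provide such a point.
  let Φ : ℝ × ℝ → M := fun z =>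
    if h : ∃ q, (z.1, q) ∈ t ∧ Ψ (z.1, q) = (z.1, 0, z.2) then h.choose else c z.1
  have hΦ : ∀ z q, (z.1, q) ∈ t → Ψ (z.1, q) = (z.1, 0, z.2) → Φ z = q := by
    intro z q h1 h2
    have h : ∃ q, (z.1, q) ∈ t ∧ Ψ (z.1, q) = (z.1, 0, z.2) := ⟨q, h1, h2⟩
    simp only [Φ, dif_pos h]
    exact congrArg Prod.snd (htinj h.choose_spec.1 h1 (h.choose_spec.2.trans h2.symm))
  refine ⟨Φ, fun s hs => ?_⟩
  obtain ⟨ψ, hψ, hψ0, hψ1, -⟩ := exists_offset_inverse hS hc s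
  have hts : t ∈ 𝓝 (s, c s) := mem_nhdsSet_iff_forall.1 ht _ ⟨s, hs, rfl⟩
  have hpar : ContMDiffAt 𝓘(ℝ, E2) (𝓡 2) 4 (par (c s)) (crd (c s) (c s)) :=
    (contMDiffAt_par _ (mem_extChartAt_target _)).of_le (by norm_cast)
  have hlin : ContDiffAt ℝ 4 (fun z : ℝ × ℝ => (z.1, (0 : ℝ), z.2)) (s, 0) :=
    contDiffAt_fst.prodMk (contDiffAt_const.prodMk contDiffAt_snd)
  have hψ' : ContDiffAt ℝ 4 (fun z : ℝ × ℝ => ψ (z.1, 0, z.2)) (s, 0) :=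
    ContDiffAt.comp (s, (0 : ℝ)) (g := ψ) hψ hlin
  have hsm : ContMDiffAt 𝓘(ℝ, ℝ × ℝ) (𝓡 2) 4 (fun z : ℝ × ℝ => par (c s) (ψ (z.1, 0, z.2)))
      (s, 0) := by
    refine ContMDiffAt.comp (s, (0 : ℝ)) (g := par (c s)) ?_ hψ'.contMDiffAt
    change ContMDiffAt _ _ _ _ (ψ (s, 0))
    rw [hψ0]
    exact hpar
  have hev : ∀ᶠ z : ℝ × ℝ in 𝓝 (s, 0),
      Φ z = par (c s) (ψ (z.1, 0, z.2)) ∧ offset α N c (z.1, Φ z) = (0, z.2) := by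
    have h1 : ContinuousAt (fun z : ℝ × ℝ => (z.1, par (c s) (ψ (z.1, 0, z.2)))) (s, 0) :=
      continuousAt_fst.prodMk hsm.continuousAt
    have h2 : par (c s) (ψ (s, 0, 0)) = c s := by
      change par (c s) (ψ (s, 0)) = c s
      rw [hψ0, par_crd]
    have h3 := h1.tendsto
    simp only [h2] at h3
    filter_upwards [h3 hts, hlin.continuousAt.eventually hψ1] with z hz hz'
    have h4 := hΦ z _ hz (by simp only [Ψ]; rw [hz'])
    exact ⟨h4, by rw [h4]; exact hz'⟩
  refine ⟨hsm.congr_of_eventuallyEq (hev.mono fun z hz => hz.1), ?_, hev.mono fun z hz => hz.2⟩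
  have := hev.self_of_nhds.1
  rw [this]
  change par (c s) (ψ (s, 0)) = c s
  rw [hψ0, par_crd]

end Strip

/-! ### Strips, first-order data on the axis, local inverses -/

section StripGeometry

variable {M : Type*} [TopologicalSpace M] [ChartedSpace E2 M] [IsManifold (𝓡 2) ∞ M]
  {α N : M → E3} {κ : Kind} {c : ℝ → M}

/-- `Φ` parametrizes a strip along `c` whose transversal direction on `c` is the conormal. -/
structure IsStrip (α N : M → E3) (c : ℝ → M) (Φ : ℝ × ℝ → M) (I : Set ℝ) : Prop where
  smooth : ∀ s ∈ I, ContMDiffAt 𝓘(ℝ, ℝ × ℝ) (𝓡 2) 4 Φ (s, 0)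
  base : ∀ s ∈ I, Φ (s, 0) = c s
  deriv_conormal : ∀ s ∈ I, fderiv ℝ (α ∘ Φ) (s, 0) (0, 1) = conormal α N c s

theorem contDiffAt_smooth_comp {f : M → E3} (hf : ContMDiff (𝓡 2) 𝓘(ℝ, E3) 5 f) {Φ : ℝ × ℝ → M}
    {z : ℝ × ℝ} (hΦ : ContMDiffAt 𝓘(ℝ, ℝ × ℝ) (𝓡 2) 4 Φ z) : ContDiffAt ℝ 4 (f ∘ Φ) z :=
  contDiffAt_comp_of_contMDiffAt ((hf _).of_le (by norm_cast)) hΦ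

theorem IsRegularSurface.smooth_five (hS : IsRegularSurface α N) :
    ContMDiff (𝓡 2) 𝓘(ℝ, E3) 5 α := hS.smooth.of_le (by norm_cast)

theorem hasDerivAt_slice {F : Type*} [NormedAddCommGroup F] [NormedSpace ℝ F] {f : ℝ × ℝ → F}
    {s w : ℝ} (hf : DifferentiableAt ℝ f (s, w)) :
    HasDerivAt (fun x => f (x, w)) (fderiv ℝ f (s, w) (1, 0)) s := by
  have h := hf.hasFDerivAt.comp_hasDerivAt s ((hasDerivAt_id s).prodMk (hasDerivAt_const s w))
  exact h

theorem hasDerivAt_slice_right {F : Type*} [NormedAddCommGroup F] [NormedSpace ℝ F]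
    {f : ℝ × ℝ → F} {s w : ℝ} (hf : DifferentiableAt ℝ f (s, w)) :
    HasDerivAt (fun x => f (s, x)) (fderiv ℝ f (s, w) (0, 1)) w := by
  have h := hf.hasFDerivAt.comp_hasDerivAt w ((hasDerivAt_const w s).prodMk (hasDerivAt_id w))
  exact h

/-- Differentiating `offset (s, Φ (s, w)) = (0, w)` in `w` gives the components `0` and `1` of `∂_w`
along `T` and `N ∧ T`; the normal component vanishes by tangency. -/
theorem exists_isStrip (hS : IsRegularSurface α N) (hc : IsUnitLine κ α N c Set.univ)
    (s₁ s₂ : ℝ) : ∃ Φ : ℝ × ℝ → M, IsStrip α N c Φ (Set.Ioo s₁ s₂) := by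
  obtain ⟨Φ, hΦ⟩ := exists_strip hS hc s₁ s₂
  refine ⟨Φ, fun s hs => (hΦ s (Set.Ioo_subset_Icc_self hs)).1,
    fun s hs => (hΦ s (Set.Ioo_subset_Icc_self hs)).2.1, fun s hs => ?_⟩
  obtain ⟨h1, h2, h3⟩ := hΦ s (Set.Ioo_subset_Icc_self hs)
  have hA := (contDiffAt_smooth_comp hS.smooth_five h1).differentiableAt (by norm_num)
  have hw := hasDerivAt_slice_right hA
  have h4 : ∀ᶠ w in 𝓝 (0 : ℝ), offset α N c (s, Φ (s, w)) = (0, w) := by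
    have : ContinuousAt (fun w : ℝ => (s, w)) 0 := by fun_prop
    exact this.eventually h3
  have h5 : ∀ v : E3, HasDerivAt (fun w => inner ℝ v (α (Φ (s, w)) - α (c s)))
      (inner ℝ v (fderiv ℝ (α ∘ Φ) (s, 0) (0, 1))) 0 := fun v =>
    (innerSL ℝ v).hasFDerivAt.comp_hasDerivAt (0 : ℝ) (hw.sub_const (α (c s)))
  have e1 : inner ℝ (tang α c s) (fderiv ℝ (α ∘ Φ) (s, 0) (0, 1)) = 0 :=
    (h5 _).unique ((hasDerivAt_const (0 : ℝ) (0 : ℝ)).congr_of_eventuallyEq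
      (h4.mono fun w hw => congrArg Prod.fst hw))
  have e2 : inner ℝ (wedge (N (c s)) (tang α c s)) (fderiv ℝ (α ∘ Φ) (s, 0) (0, 1)) = 1 :=
    (h5 _).unique ((hasDerivAt_id (0 : ℝ)).congr_of_eventuallyEq
      (h4.mono fun w hw => congrArg Prod.snd hw))
  have e3 : inner ℝ (N (c s)) (fderiv ℝ (α ∘ Φ) (s, 0) (0, 1)) = 0 := by
    rw [fderiv_comp_eq_diff_of_eq h2 (hS.mdiff _) (h1.mdifferentiableAt (by simp))]
    exact hS.orthogonal _ _
  have e4 := eq_frame (hS.inner_self (c s)) (inner_tang_self hS hc s) (inner_normal_tang hS hc s)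
        (fderiv ℝ (α ∘ Φ) (s, 0) (0, 1))
  rw [e1, e2, e3] at e4
  rw [e4, conormal]
  simp

variable {Φ : ℝ × ℝ → M} {I : Set ℝ}

theorem IsStrip.fderiv_base {f : M → E3} (hf : ContMDiff (𝓡 2) 𝓘(ℝ, E3) 5 f)
    (hΦ : IsStrip α N c Φ I) (hI : IsOpen I) {s : ℝ} (hs : s ∈ I) :
    fderiv ℝ (f ∘ Φ) (s, 0) (1, 0) = deriv (f ∘ c) s := by
  have hA := (contDiffAt_smooth_comp hf (hΦ.smooth s hs)).differentiableAt (by norm_num)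
  rw [← (hasDerivAt_slice hA).deriv]
  apply Filter.EventuallyEq.deriv_eq
  filter_upwards [hI.mem_nhds hs] with x hx
  exact congrArg f (hΦ.base x hx)

theorem inner_conormal_self (hS : IsRegularSurface α N) (hc : IsUnitLine κ α N c Set.univ)
    (s : ℝ) : inner ℝ (conormal α N c s) (conormal α N c s) = (1 : ℝ) := by
  rw [conormal, inner_wedge_wedge, hS.inner_self, inner_tang_self hS hc, inner_normal_tang hS hc]
  norm_num

theorem inner_tang_conormal (s : ℝ) : inner ℝ (tang α c s) (conormal α N c s) = (0 : ℝ) := by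
  rw [conormal, real_inner_comm, inner_wedge_right]

theorem IsStrip.fderiv_apply (hS : IsRegularSurface α N) (hΦ : IsStrip α N c Φ I) (hI : IsOpen I)
    {s : ℝ} (hs : s ∈ I) (z : ℝ × ℝ) :
    fderiv ℝ (α ∘ Φ) (s, 0) z = z.1 • tang α c s + z.2 • conormal α N c s := by
  have : z = z.1 • ((1 : ℝ), (0 : ℝ)) + z.2 • ((0 : ℝ), (1 : ℝ)) := by ext <;> simp
  conv_lhs => rw [this]
  rw [map_add, map_smul, map_smul, hΦ.fderiv_base hS.smooth_five hI hs, hΦ.deriv_conormal s hs]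
  rfl

/-- A strip is a local diffeomorphism at the points of its axis. -/
theorem IsStrip.exists_inverse (hS : IsRegularSurface α N) (hc : IsUnitLine κ α N c Set.univ)
    (hΦ : IsStrip α N c Φ I) (hI : IsOpen I) {s : ℝ} (hs : s ∈ I) :
    ∃ R : M → ℝ × ℝ, ContMDiffAt (𝓡 2) 𝓘(ℝ, ℝ × ℝ) 4 R (c s) ∧ R (c s) = (s, 0) ∧
      (∀ᶠ z in 𝓝 (s, (0 : ℝ)), R (Φ z) = z) ∧ ∀ᶠ q in 𝓝 (c s), Φ (R q) = q := by
  set p := c s with hp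
  have hΦs := hΦ.smooth s hs
  have hb : Φ (s, 0) = p := hΦ.base s hs
  have hcrd : ContMDiffAt (𝓡 2) 𝓘(ℝ, E2) 4 (crd p) (Φ (s, 0)) := by
    rw [hb]; exact (contMDiffAt_crd p (mem_extChartAt_source p)).of_le (by norm_cast)
  have hg : ContDiffAt ℝ 4 (crd p ∘ Φ) (s, 0) := contDiffAt_comp_of_contMDiffAt hcrd hΦs
  have hsrc : ∀ᶠ z in 𝓝 (s, (0 : ℝ)), Φ z ∈ (extChartAt (𝓡 2) p).source := by
    apply hΦs.continuousAt
    rw [hb]; exact extChartAt_source_mem_nhds p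
  have hgd := hg.differentiableAt (by norm_num)
  have hpar : DifferentiableAt ℝ (α ∘ par p) (crd p (Φ (s, 0))) := by
    rw [hb]
    exact (contDiffAt_comp_of_contMDiffAt (hS.smooth_five _) ((contMDiffAt_par p
      (mem_extChartAt_target p)).of_le (by norm_cast))).differentiableAt (by norm_num)
  have hAg : α ∘ Φ =ᶠ[𝓝 (s, 0)] (α ∘ par p) ∘ (crd p ∘ Φ) := by
    filter_upwards [hsrc] with z hz
    exact congrArg α ((extChartAt (𝓡 2) p).left_inv hz).symm
  have hinj : Function.Injective (fderiv ℝ (crd p ∘ Φ) (s, 0)) := by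
    rw [injective_iff_map_eq_zero]
    intro z hz
    have h1 := hΦ.fderiv_apply hS hI hs z
    rw [hAg.fderiv_eq, fderiv_comp (f := crd p ∘ Φ) (g := α ∘ par p) (s, 0) hpar hgd,
      ContinuousLinearMap.comp_apply, hz, map_zero] at h1
    have h2 := congrArg (fun v => inner ℝ (tang α c s) v) h1
    have h3 := congrArg (fun v => inner ℝ (conormal α N c s) v) h1
    have h4 := inner_tang_conormal (α := α) (N := N) (c := c) s
    have h5 := h4
    rw [real_inner_comm] at h5
    simp only [inner_zero_right, inner_add_right, inner_smul_right, inner_tang_self hS hc, h4, h5,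
      inner_conormal_self hS hc] at h2 h3
    ext
    · simp; linarith
    · simp; linarith
  let e := (LinearEquiv.ofInjectiveOfFinrankEq (fderiv ℝ (crd p ∘ Φ) (s, 0)).toLinearMap hinj
    (by simp)).toContinuousLinearEquiv
  have he : HasFDerivAt (crd p ∘ Φ) (e : ℝ × ℝ →L[ℝ] E2) (s, 0) := by
    have : (e : ℝ × ℝ →L[ℝ] E2) = fderiv ℝ (crd p ∘ Φ) (s, 0) := by ext <;> rfl
    rw [this]; exact hgd.hasFDerivAt
  have hst : HasStrictFDerivAt (crd p ∘ Φ) (e : ℝ × ℝ →L[ℝ] E2) (s, 0) :=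
    hg.hasStrictFDerivAt' he (by norm_num)
  let ρ := hst.localInverse (crd p ∘ Φ) e (s, 0)
  have hinvs : ContDiffAt ℝ 4 ρ ((crd p ∘ Φ) (s, 0)) := hg.to_localInverse he (by norm_num)
  have hρ0 : ρ (crd p p) = (s, 0) := by
    have : ρ ((crd p ∘ Φ) (s, 0)) = (s, 0) := hst.localInverse_apply_image
    simpa only [Function.comp_apply, hb] using this
  have hinvs' : ContDiffAt ℝ 4 ρ (crd p p) := by
    simpa only [Function.comp_apply, hb] using hinvs
  have hRp : ContMDiffAt (𝓡 2) 𝓘(ℝ, ℝ × ℝ) 4 (ρ ∘ crd p) p :=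
    ContMDiffAt.comp p hinvs'.contMDiffAt
      ((contMDiffAt_crd p (mem_extChartAt_source p)).of_le (by norm_cast))
  refine ⟨ρ ∘ crd p, hRp, hρ0, hst.eventually_left_inverse, ?_⟩
  have h1 : ∀ᶠ u in 𝓝 (crd p p), crd p (Φ (ρ u)) = u := by
    have : ∀ᶠ u in 𝓝 ((crd p ∘ Φ) (s, 0)), crd p (Φ (ρ u)) = u := hst.eventually_right_inverse
    simpa only [Function.comp_apply, hb] using this
  have h2 : ∀ᶠ q in 𝓝 p, crd p (Φ (ρ (crd p q))) = crd p q :=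
    (contMDiffAt_crd p (mem_extChartAt_source p)).continuousAt.eventually h1
  have h3 : ∀ᶠ q in 𝓝 p, Φ (ρ (crd p q)) ∈ (extChartAt (𝓡 2) p).source := by
    have := hRp.continuousAt.tendsto
    simp only [Function.comp_apply, hρ0] at this
    exact this.eventually hsrc
  filter_upwards [h2, h3, extChartAt_source_mem_nhds (I := 𝓡 2) p] with q h4 h5 h6
  exact (extChartAt (𝓡 2) p).injOn h5 h6 h4

end StripGeometry

section Pairing

variable {Z : Type*} [NormedAddCommGroup Z] [NormedSpace ℝ Z]

theorem hasFDerivAt_fderiv_apply {F : Type*} [NormedAddCommGroup F] [NormedSpace ℝ F] {f : Z → F}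
    {z : Z} (hf : ContDiffAt ℝ 2 f z) (ζ : Z) :
    HasFDerivAt (fun y => fderiv ℝ f y ζ) ((fderiv ℝ (fderiv ℝ f) z).flip ζ) z := by
  have h1 : DifferentiableAt ℝ (fderiv ℝ f) z :=
    (hf.fderiv_right (m := 1) (by norm_num)).differentiableAt (by norm_num)
  simpa using h1.hasFDerivAt.clm_apply (hasFDerivAt_const ζ z)

theorem fderiv_pairing {f g : Z → E3} {z : Z} (hf : ContDiffAt ℝ 2 f z) (hg : ContDiffAt ℝ 2 g z)
    (ζ η θ : Z) : fderiv ℝ (pairing f g ζ η) z θ =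
      inner ℝ (fderiv ℝ (fderiv ℝ f) z θ ζ) (fderiv ℝ g z η)
        + inner ℝ (fderiv ℝ f z ζ) (fderiv ℝ (fderiv ℝ g) z θ η) := by
  have h := (hasFDerivAt_fderiv_apply hf ζ).inner ℝ (hasFDerivAt_fderiv_apply hg η)
  have h' : HasFDerivAt (pairing f g ζ η) _ z := h
  rw [h'.fderiv]
  simp
  ring

theorem fderiv_fderiv_comm {F : Type*} [NormedAddCommGroup F] [NormedSpace ℝ F] {f : Z → F}
    {z : Z} (hf : ContDiffAt ℝ 2 f z) (ζ η : Z) :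
    fderiv ℝ (fderiv ℝ f) z ζ η = fderiv ℝ (fderiv ℝ f) z η ζ :=
  (hf.isSymmSndFDerivAt (by simp)).eq ζ η

end Pairing

/-! ### The slope of the foliation in strip coordinates -/

section Slope

variable {M : Type*} [TopologicalSpace M] [ChartedSpace E2 M] [IsManifold (𝓡 2) ∞ M]
  {α N : M → E3} {κ : Kind} {c : ℝ → M} {Φ : ℝ × ℝ → M} {I : Set ℝ}

/-- The conditions on a tangent vector which characterize the vectors tangent to the lines of one of
the two foliations. -/
structure IsDir (κ : Kind) (α N : M → E3) (p : M) (X : TangentSpace (𝓡 2) p) : Prop where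
  ne_zero : X ≠ 0
  elliptic : 0 < gaussCurv α N p
  nonumbilic : meanCurv α N p ^ 2 ≠ gaussCurv α N p
  normalCurv_eq : normalCurv α N p X = √(gaussCurv α N p)
  torsion_sign : 0 < κ.sign * geodTorsion α N p X

/-- Coefficients of the quadratic form `II - √K I` of a parametrized surface. -/
def diffCoef (α N : M → E3) (Φ : ℝ × ℝ → M) (ζ η z : ℝ × ℝ) : ℝ :=
  -pairing (N ∘ Φ) (α ∘ Φ) ζ η z - √(gaussCurv α N (Φ z)) * pairing (α ∘ Φ) (α ∘ Φ) ζ η z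

/-- The slope `dw/ds` of the lines of the foliation in the coordinates `(s, w)`. -/
def slope (κ : Kind) (α N : M → E3) (Φ : ℝ × ℝ → M) (z : ℝ × ℝ) : ℝ :=
  -diffCoef α N Φ (1, 0) (1, 0) z / (diffCoef α N Φ (1, 0) (0, 1) z + κ.sign *
    √(diffCoef α N Φ (1, 0) (0, 1) z ^ 2
      - diffCoef α N Φ (1, 0) (1, 0) z * diffCoef α N Φ (0, 1) (0, 1) z))

/-- The geodesic torsion along a curve. -/
def torsion (α N : M → E3) (c : ℝ → M) (s : ℝ) : ℝ := geodTorsion α N (c s) (velocity c s)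

theorem torsion_eq (hS : IsRegularSurface α N) (hc : IsUnitLine κ α N c Set.univ) (s : ℝ) :
    torsion α N c s = -inner ℝ (deriv (N ∘ c) s) (conormal α N c s) := by
  rw [torsion, geodTorsion, hc.unit_speed s (Set.mem_univ s), div_one, conormal, tang_eq hS hc,
    deriv_comp_eq_diff (hS.mdiff_normal _) (hc.mdiff isOpen_univ (Set.mem_univ s))]

theorem torsion_ne_zero (hc : IsUnitLine κ α N c Set.univ) (s : ℝ) : torsion α N c s ≠ 0 := by
  intro h
  have := hc.torsion_sign s (Set.mem_univ s)
  rw [← torsion, h, mul_zero] at this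
  exact lt_irrefl _ this

theorem contDiff_torsion (hS : IsRegularSurface α N) (hc : IsUnitLine κ α N c Set.univ) :
    ContDiff ℝ 4 (torsion α N c) := by
  have h : torsion α N c = fun s => -inner ℝ (deriv (N ∘ c) s) (conormal α N c s) :=
    funext (torsion_eq hS hc)
  rw [h]
  have h2 : ContDiff ℝ (4 + 1) (N ∘ c) := (contDiff_normal_curve hS hc).of_le (by norm_num)
  exact ((contDiff_succ_iff_deriv.1 h2).2.2.inner ℝ (contDiff_conormal hS hc)).neg

theorem inner_normal_conormal (s : ℝ) : inner ℝ (N (c s)) (conormal α N c s) = (0 : ℝ) := by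
  rw [conormal, real_inner_comm, inner_wedge_left]

theorem diff_tangentLift_conormal (hS : IsRegularSurface α N) (s : ℝ) :
    diff α (c s) (tangentLift α (c s) (conormal α N c s)) = conormal α N c s :=
  diff_tangentLift (exists_diff_eq (hS.injective _)
    (by rw [← norm_ne_zero_iff, hS.norm_eq_one]; norm_num) (hS.orthogonal _)
    (inner_normal_conormal s))

theorem IsStrip.mfderiv_conormal (hS : IsRegularSurface α N) (hΦ : IsStrip α N c Φ I)
    {s : ℝ} (hs : s ∈ I) :
    (mfderiv 𝓘(ℝ, ℝ × ℝ) (𝓡 2) Φ (s, 0) ((0, 1) : ℝ × ℝ) : E2)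
      = tangentLift α (c s) (conormal α N c s) := by
  apply hS.injective (c s)
  rw [diff_tangentLift_conormal hS, ← hΦ.deriv_conormal s hs]
  exact (fderiv_comp_eq_diff_of_eq (hΦ.base s hs) (hS.mdiff _)
    ((hΦ.smooth s hs).mdifferentiableAt (by simp)) _).symm

theorem IsStrip.fderiv_normal_conormal (hS : IsRegularSurface α N) (hΦ : IsStrip α N c Φ I)
    {s : ℝ} (hs : s ∈ I) : fderiv ℝ (N ∘ Φ) (s, 0) (0, 1)
      = diff N (c s) (tangentLift α (c s) (conormal α N c s)) := by
  rw [fderiv_comp_eq_diff_of_eq (hΦ.base s hs) (hS.mdiff_normal _)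
    ((hΦ.smooth s hs).mdifferentiableAt (by simp)), hΦ.mfderiv_conormal hS hs]

theorem IsStrip.pairing_one_one (hS : IsRegularSurface α N) (hc : IsUnitLine κ α N c Set.univ)
    (hΦ : IsStrip α N c Φ I) (hI : IsOpen I) {s : ℝ} (hs : s ∈ I) :
    pairing (α ∘ Φ) (α ∘ Φ) (1, 0) (1, 0) (s, 0) = 1 := by
  rw [pairing, hΦ.fderiv_base hS.smooth_five hI hs]
  exact inner_tang_self hS hc s

theorem IsStrip.pairing_one_two (hS : IsRegularSurface α N) (hΦ : IsStrip α N c Φ I)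
    (hI : IsOpen I) {s : ℝ} (hs : s ∈ I) :
    pairing (α ∘ Φ) (α ∘ Φ) (1, 0) (0, 1) (s, 0) = 0 := by
  rw [pairing, hΦ.fderiv_base hS.smooth_five hI hs, hΦ.deriv_conormal s hs]
  exact inner_tang_conormal s

theorem IsStrip.pairing_two_two (hS : IsRegularSurface α N) (hc : IsUnitLine κ α N c Set.univ)
    (hΦ : IsStrip α N c Φ I) {s : ℝ} (hs : s ∈ I) :
    pairing (α ∘ Φ) (α ∘ Φ) (0, 1) (0, 1) (s, 0) = 1 := by
  rw [pairing, hΦ.deriv_conormal s hs]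
  exact inner_conormal_self hS hc s

theorem IsStrip.gramDet_base (hS : IsRegularSurface α N) (hc : IsUnitLine κ α N c Set.univ)
    (hΦ : IsStrip α N c Φ I) (hI : IsOpen I) {s : ℝ} (hs : s ∈ I) :
    gramDet (α ∘ Φ) (1, 0) (0, 1) (s, 0) = 1 := by
  rw [gramDet, hΦ.pairing_one_one hS hc hI hs, hΦ.pairing_one_two hS hI hs,
    hΦ.pairing_two_two hS hc hs]
  norm_num

theorem IsStrip.pairing_normal_one_one (hS : IsRegularSurface α N)
    (hc : IsUnitLine κ α N c Set.univ) (hΦ : IsStrip α N c Φ I) (hI : IsOpen I)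
    {s : ℝ} (hs : s ∈ I) :
    pairing (N ∘ Φ) (α ∘ Φ) (1, 0) (1, 0) (s, 0) = -√(gaussCurv α N (c s)) := by
  rw [pairing, hΦ.fderiv_base hS.smooth_five hI hs, hΦ.fderiv_base hS.smooth_normal hI hs]
  have h := hc.normalCurv_eq s (Set.mem_univ s)
  rw [normalCurv, hc.unit_speed s (Set.mem_univ s), div_one, secondForm,
    ← deriv_comp_eq_diff (hS.mdiff _) (hc.mdiff isOpen_univ (Set.mem_univ s)),
    ← deriv_comp_eq_diff (hS.mdiff_normal _) (hc.mdiff isOpen_univ (Set.mem_univ s))] at h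
  rw [← h, neg_neg]

theorem IsStrip.pairing_normal_one_two (hS : IsRegularSurface α N)
    (hc : IsUnitLine κ α N c Set.univ) (hΦ : IsStrip α N c Φ I) (hI : IsOpen I)
    {s : ℝ} (hs : s ∈ I) :
    pairing (N ∘ Φ) (α ∘ Φ) (1, 0) (0, 1) (s, 0) = -torsion α N c s := by
  rw [pairing, hΦ.fderiv_base hS.smooth_normal hI hs, hΦ.deriv_conormal s hs, torsion_eq hS hc,
    neg_neg]

/-- The second form has trace `2H` in the orthonormal frame, and its entry along the line is `√K`;
the pairing is minus the remaining entry. -/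
theorem IsStrip.pairing_normal_two_two (hS : IsRegularSurface α N)
    (hc : IsUnitLine κ α N c Set.univ) (hΦ : IsStrip α N c Φ I) {s : ℝ} (hs : s ∈ I) :
    pairing (N ∘ Φ) (α ∘ Φ) (0, 1) (0, 1) (s, 0)
      = √(gaussCurv α N (c s)) - 2 * meanCurv α N (c s) := by
  obtain ⟨Y, hY, -, -, -, -, hH, -⟩ := exists_frame (hS.injective _) (hS.norm_eq_one _)
    (hS.orthogonal _) (hS.symm _) (hc.unit_speed s (Set.mem_univ s))
  have h := hc.normalCurv_eq s (Set.mem_univ s)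
  rw [normalCurv, hc.unit_speed s (Set.mem_univ s), div_one] at h
  have hYe : Y = tangentLift α (c s) (conormal α N c s) := by
    apply hS.injective
    rw [diff_tangentLift_conormal hS, hY, conormal, tang_eq hS hc]
  rw [h] at hH
  rw [hH, pairing, hΦ.fderiv_normal_conormal hS hs, hΦ.deriv_conormal s hs, secondForm, ← hYe, hY,
    conormal, tang_eq hS hc]
  ring

theorem IsStrip.contDiffAt_gaussCurv (hS : IsRegularSurface α N) (hc : IsUnitLine κ α N c Set.univ)
    (hΦ : IsStrip α N c Φ I) (hI : IsOpen I) {s : ℝ} (hs : s ∈ I) :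
    ContDiffAt ℝ 3 (gaussCurv α N ∘ Φ) (s, 0) :=
  GeomMeanCurv.contDiffAt_gaussCurv hS (k := 3) (m := 4) (by norm_num) le_rfl (hΦ.smooth s hs)
    (by rw [hΦ.gramDet_base hS hc hI hs]; norm_num)

theorem IsStrip.gaussCurv_pos (hc : IsUnitLine κ α N c Set.univ) (hΦ : IsStrip α N c Φ I)
    {s : ℝ} (hs : s ∈ I) :
    0 < gaussCurv α N (Φ (s, 0)) := by
  rw [hΦ.base s hs]; exact hc.elliptic s (Set.mem_univ s)

theorem IsStrip.contDiffAt_sqrt (hS : IsRegularSurface α N) (hc : IsUnitLine κ α N c Set.univ)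
    (hΦ : IsStrip α N c Φ I) (hI : IsOpen I) {s : ℝ} (hs : s ∈ I) :
    ContDiffAt ℝ 3 (fun z => √(gaussCurv α N (Φ z))) (s, 0) :=
  (hΦ.contDiffAt_gaussCurv hS hc hI hs).sqrt (hΦ.gaussCurv_pos hc hs).ne'

theorem IsStrip.contDiffAt_diffCoef (hS : IsRegularSurface α N) (hc : IsUnitLine κ α N c Set.univ)
    (hΦ : IsStrip α N c Φ I) (hI : IsOpen I) {s : ℝ} (hs : s ∈ I) (ζ η : ℝ × ℝ) :
    ContDiffAt ℝ 3 (diffCoef α N Φ ζ η) (s, 0) := by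
  have h1 := contDiffAt_smooth_comp hS.smooth_five (hΦ.smooth s hs)
  have h2 := contDiffAt_smooth_comp hS.smooth_normal (hΦ.smooth s hs)
  exact (contDiffAt_pairing (by norm_num) h2 h1 ζ η).neg.sub
    ((hΦ.contDiffAt_sqrt hS hc hI hs).mul (contDiffAt_pairing (by norm_num) h1 h1 ζ η))

theorem IsStrip.diffCoef_one_one (hS : IsRegularSurface α N) (hc : IsUnitLine κ α N c Set.univ)
    (hΦ : IsStrip α N c Φ I) (hI : IsOpen I) {s : ℝ} (hs : s ∈ I) :
    diffCoef α N Φ (1, 0) (1, 0) (s, 0) = 0 := by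
  rw [diffCoef, hΦ.pairing_one_one hS hc hI hs, hΦ.pairing_normal_one_one hS hc hI hs,
    hΦ.base s hs]
  ring

theorem IsStrip.diffCoef_one_two (hS : IsRegularSurface α N) (hc : IsUnitLine κ α N c Set.univ)
    (hΦ : IsStrip α N c Φ I) (hI : IsOpen I) {s : ℝ} (hs : s ∈ I) :
    diffCoef α N Φ (1, 0) (0, 1) (s, 0) = torsion α N c s := by
  rw [diffCoef, hΦ.pairing_one_two hS hI hs, hΦ.pairing_normal_one_two hS hc hI hs]
  ring

/-- This selects the root of the quadratic equation for the slope: on the axis the denominator in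
`slope` becomes `τ + τ` instead of `τ - τ`. -/
theorem sign_mul_abs_torsion (hc : IsUnitLine κ α N c Set.univ) (s : ℝ) :
    κ.sign * √(torsion α N c s ^ 2) = torsion α N c s := by
  have h := hc.torsion_sign s (Set.mem_univ s)
  rw [← torsion] at h
  have h2 : torsion α N c s ^ 2 = (κ.sign * torsion α N c s) ^ 2 := by
    rw [mul_pow, sq κ.sign, κ.sign_mul_self, one_mul]
  rw [h2, Real.sqrt_sq h.le, ← mul_assoc, κ.sign_mul_self, one_mul]

theorem IsStrip.contDiffAt_denominator (hS : IsRegularSurface α N)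
    (hc : IsUnitLine κ α N c Set.univ) (hΦ : IsStrip α N c Φ I) (hI : IsOpen I)
    {s : ℝ} (hs : s ∈ I) :
    ContDiffAt ℝ 3 (fun z => diffCoef α N Φ (1, 0) (0, 1) z +
    κ.sign * √(diffCoef α N Φ (1, 0) (0, 1) z ^ 2
      - diffCoef α N Φ (1, 0) (1, 0) z * diffCoef α N Φ (0, 1) (0, 1) z)) (s, 0) := by
  have h11 := hΦ.contDiffAt_diffCoef hS hc hI hs (1, 0) (1, 0)
  have h12 := hΦ.contDiffAt_diffCoef hS hc hI hs (1, 0) (0, 1)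
  have h22 := hΦ.contDiffAt_diffCoef hS hc hI hs (0, 1) (0, 1)
  refine h12.add (contDiffAt_const.mul (((h12.pow 2).sub (h11.mul h22)).sqrt ?_))
  rw [hΦ.diffCoef_one_one hS hc hI hs, hΦ.diffCoef_one_two hS hc hI hs]
  simpa using torsion_ne_zero hc s

theorem IsStrip.denominator_base (hS : IsRegularSurface α N) (hc : IsUnitLine κ α N c Set.univ)
    (hΦ : IsStrip α N c Φ I) (hI : IsOpen I) {s : ℝ} (hs : s ∈ I) :
    diffCoef α N Φ (1, 0) (0, 1) (s, 0) +
    κ.sign * √(diffCoef α N Φ (1, 0) (0, 1) (s, 0) ^ 2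
      - diffCoef α N Φ (1, 0) (1, 0) (s, 0) * diffCoef α N Φ (0, 1) (0, 1) (s, 0))
      = 2 * torsion α N c s := by
  rw [hΦ.diffCoef_one_one hS hc hI hs, hΦ.diffCoef_one_two hS hc hI hs, zero_mul, sub_zero,
    sign_mul_abs_torsion hc s]
  ring

theorem IsStrip.contDiffAt_slope (hS : IsRegularSurface α N) (hc : IsUnitLine κ α N c Set.univ)
    (hΦ : IsStrip α N c Φ I) (hI : IsOpen I) {s : ℝ} (hs : s ∈ I) :
    ContDiffAt ℝ 3 (slope κ α N Φ) (s, 0) :=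
  (hΦ.contDiffAt_diffCoef hS hc hI hs _ _).neg.div (hΦ.contDiffAt_denominator hS hc hI hs) (by
    rw [hΦ.denominator_base hS hc hI hs]
    exact mul_ne_zero two_ne_zero (torsion_ne_zero hc s))

theorem IsStrip.slope_base (hS : IsRegularSurface α N) (hc : IsUnitLine κ α N c Set.univ)
    (hΦ : IsStrip α N c Φ I) (hI : IsOpen I) {s : ℝ} (hs : s ∈ I) :
    slope κ α N Φ (s, 0) = 0 := by
  rw [slope, hΦ.diffCoef_one_one hS hc hI hs]; simp

/-- Near the axis of the strip the vectors `(1, slope)` are tangent to the foliation. -/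
theorem IsStrip.eventually_isDir (hS : IsRegularSurface α N) (hc : IsUnitLine κ α N c Set.univ)
    (hΦ : IsStrip α N c Φ I) (hI : IsOpen I) {s : ℝ} (hs : s ∈ I)
    (hnu : meanCurv α N (c s) ^ 2 ≠ gaussCurv α N (c s)) :
    ∀ᶠ z in 𝓝 (s, (0 : ℝ)), IsDir κ α N (Φ z)
      (mfderiv 𝓘(ℝ, ℝ × ℝ) (𝓡 2) Φ z ((1, slope κ α N Φ z) : ℝ × ℝ)) := by
  have h1 : IsManifold (𝓡 2) (4 : WithTop ℕ∞) M := IsManifold.of_le (n := ∞) (by norm_cast)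
  have hev : ∀ᶠ z in 𝓝 (s, (0 : ℝ)), ContMDiffAt 𝓘(ℝ, ℝ × ℝ) (𝓡 2) 4 Φ z :=
    (contMDiffAt_iff_contMDiffAt_nhds (by simp)).1 (hΦ.smooth s hs)
  have hA := contDiffAt_smooth_comp hS.smooth_five (hΦ.smooth s hs)
  have hn := contDiffAt_smooth_comp hS.smooth_normal (hΦ.smooth s hs)
  have hp := (hΦ.contDiffAt_slope hS hc hI hs).continuousAt
  have hζ : ContinuousAt (fun z => ((1, slope κ α N Φ z) : ℝ × ℝ)) (s, 0) :=
    continuousAt_const.prodMk hp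
  have hAζ : ContinuousAt (fun z => fderiv ℝ (α ∘ Φ) z (1, slope κ α N Φ z)) (s, 0) :=
    (hA.fderiv_right (m := 1) (by norm_num)).continuousAt.clm_apply hζ
  have hnζ : ContinuousAt (fun z => fderiv ℝ (N ∘ Φ) z (1, slope κ α N Φ z)) (s, 0) :=
    (hn.fderiv_right (m := 1) (by norm_num)).continuousAt.clm_apply hζ
  have hK := (hΦ.contDiffAt_gaussCurv hS hc hI hs).continuousAt
  have hH : ContinuousAt (meanCurv α N ∘ Φ) (s, 0) :=
    (contDiffAt_meanCurv hS (k := 3) (m := 4) (by norm_num) le_rfl (hΦ.smooth s hs)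
      (by rw [hΦ.gramDet_base hS hc hI hs]; norm_num)).continuousAt
  have hA0 : fderiv ℝ (α ∘ Φ) (s, 0) (1, slope κ α N Φ (s, 0)) = tang α c s := by
    rw [hΦ.slope_base hS hc hI hs, hΦ.fderiv_apply hS hI hs]; simp
  have hn0 : fderiv ℝ (N ∘ Φ) (s, 0) (1, slope κ α N Φ (s, 0)) = deriv (N ∘ c) s := by
    rw [hΦ.slope_base hS hc hI hs, hΦ.fderiv_base hS.smooth_normal hI hs]
  have hfirst : ∀ᶠ z in 𝓝 (s, (0 : ℝ)), 0 < (inner ℝ (fderiv ℝ (α ∘ Φ) z (1, slope κ α N Φ z))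
      (fderiv ℝ (α ∘ Φ) z (1, slope κ α N Φ z)) : ℝ) := by
    refine continuousAt_const.eventually_lt (hAζ.inner hAζ) ?_
    rw [hA0, inner_tang_self hS hc]; norm_num
  have htor : ∀ᶠ z in 𝓝 (s, (0 : ℝ)), 0 < κ.sign *
      (-inner ℝ (fderiv ℝ (N ∘ Φ) z (1, slope κ α N Φ z))
        (wedge (N (Φ z)) (fderiv ℝ (α ∘ Φ) z (1, slope κ α N Φ z)))) := by
    have hw : ContinuousAt (fun z => wedge (N (Φ z))
        (fderiv ℝ (α ∘ Φ) z (1, slope κ α N Φ z))) (s, 0) :=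
      (wedgeL.continuous.continuousAt.comp hn.continuousAt).clm_apply hAζ
    refine continuousAt_const.eventually_lt (continuousAt_const.mul (hnζ.inner hw).neg) ?_
    rw [hA0, hn0, hΦ.base s hs, ← conormal, ← torsion_eq hS hc]
    exact hc.torsion_sign s (Set.mem_univ s)
  have hden := (hΦ.contDiffAt_denominator hS hc hI hs).continuousAt.eventually_ne (by
    rw [hΦ.denominator_base hS hc hI hs]
    exact mul_ne_zero two_ne_zero (torsion_ne_zero hc s))
  have hdisc : ∀ᶠ z in 𝓝 (s, (0 : ℝ)), 0 < diffCoef α N Φ (1, 0) (0, 1) z ^ 2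
      - diffCoef α N Φ (1, 0) (1, 0) z * diffCoef α N Φ (0, 1) (0, 1) z := by
    have h11 := (hΦ.contDiffAt_diffCoef hS hc hI hs (1, 0) (1, 0)).continuousAt
    have h12 := (hΦ.contDiffAt_diffCoef hS hc hI hs (1, 0) (0, 1)).continuousAt
    have h22 := (hΦ.contDiffAt_diffCoef hS hc hI hs (0, 1) (0, 1)).continuousAt
    refine continuousAt_const.eventually_lt ((h12.pow 2).sub (h11.mul h22)) ?_
    rw [hΦ.diffCoef_one_one hS hc hI hs, hΦ.diffCoef_one_two hS hc hI hs, zero_mul, sub_zero]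
    exact sq_pos_of_ne_zero (torsion_ne_zero hc s)
  have hKp : ∀ᶠ z in 𝓝 (s, (0 : ℝ)), 0 < gaussCurv α N (Φ z) :=
    continuousAt_const.eventually_lt hK (hΦ.gaussCurv_pos hc hs)
  have hum : ∀ᶠ z in 𝓝 (s, (0 : ℝ)), meanCurv α N (Φ z) ^ 2 ≠ gaussCurv α N (Φ z) := by
    refine ((hH.pow 2).ne_iff_eventually_ne hK).1 ?_
    change meanCurv α N (Φ (s, 0)) ^ 2 ≠ gaussCurv α N (Φ (s, 0))
    rw [hΦ.base s hs]
    exact hnu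
  filter_upwards [hev, hfirst, htor, hden, hdisc, hKp, hum] with z e1 e2 e3 e4 e5 e6 e7
  have hmd : MDifferentiableAt 𝓘(ℝ, ℝ × ℝ) (𝓡 2) Φ z := e1.mdifferentiableAt (by simp)
  have f1 : firstForm α (Φ z) (mfderiv 𝓘(ℝ, ℝ × ℝ) (𝓡 2) Φ z ((1, slope κ α N Φ z) : ℝ × ℝ))
      (mfderiv 𝓘(ℝ, ℝ × ℝ) (𝓡 2) Φ z ((1, slope κ α N Φ z) : ℝ × ℝ)) =
      inner ℝ (fderiv ℝ (α ∘ Φ) z (1, slope κ α N Φ z))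
        (fderiv ℝ (α ∘ Φ) z (1, slope κ α N Φ z)) := firstForm_param hS hmd _ _
  refine ⟨?_, e6, e7, ?_, ?_⟩
  · intro h0
    rw [← f1, h0] at e2
    simp [firstForm] at e2
  · have hsplit : ((1, slope κ α N Φ z) : ℝ × ℝ) = (1, 0) + slope κ α N Φ z • ((0, 1) : ℝ × ℝ) := by
      ext <;> simp
    rw [normalCurv, div_eq_iff (by rw [f1]; exact e2.ne')]
    have g11 := diffCoef.eq_1 α N Φ (1, 0) (1, 0) z
    have g12 := diffCoef.eq_1 α N Φ (1, 0) (0, 1) z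
    have g22 := diffCoef.eq_1 α N Φ (0, 1) (0, 1) z
    rw [← secondForm_param hS hmd, ← firstForm_param hS hmd] at g11 g12 g22
    -- The slope is a root of `e + 2 f p + g p² = 0` written as `-e / (f + κ √(f² - e g))`. This
    -- form needs no division by `g` and exhibits the root that vanishes with `e`.
    have hq : diffCoef α N Φ (1, 0) (1, 0) z + 2 * diffCoef α N Φ (1, 0) (0, 1) z * slope κ α N Φ z
        + diffCoef α N Φ (0, 1) (0, 1) z * slope κ α N Φ z ^ 2 = 0 := by
      have hsq := Real.sq_sqrt e5.le
      have hκ := κ.sign_mul_self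
      rw [slope]
      set D := √(diffCoef α N Φ (1, 0) (0, 1) z ^ 2
        - diffCoef α N Φ (1, 0) (1, 0) z * diffCoef α N Φ (0, 1) (0, 1) z)
      field_simp
      linear_combination diffCoef α N Φ (1, 0) (1, 0) z * hsq
        + diffCoef α N Φ (1, 0) (1, 0) z * D ^ 2 * hκ
    have hlin : mfderiv 𝓘(ℝ, ℝ × ℝ) (𝓡 2) Φ z ((1, slope κ α N Φ z) : ℝ × ℝ) =
        mfderiv 𝓘(ℝ, ℝ × ℝ) (𝓡 2) Φ z ((1, 0) : ℝ × ℝ)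
          + slope κ α N Φ z • mfderiv 𝓘(ℝ, ℝ × ℝ) (𝓡 2) Φ z ((0, 1) : ℝ × ℝ) := by
      let D : ℝ × ℝ →L[ℝ] E2 := mfderiv 𝓘(ℝ, ℝ × ℝ) (𝓡 2) Φ z
      have : D (1, slope κ α N Φ z) = D (1, 0) + slope κ α N Φ z • D (0, 1) := by
        rw [← map_smul, ← map_add, ← hsplit]
      exact this
    rw [hlin]
    set X := mfderiv 𝓘(ℝ, ℝ × ℝ) (𝓡 2) Φ z ((1, 0) : ℝ × ℝ)
    set Y := mfderiv 𝓘(ℝ, ℝ × ℝ) (𝓡 2) Φ z ((0, 1) : ℝ × ℝ)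
    rw [g11, g12, g22] at hq
    generalize slope κ α N Φ z = r at hq ⊢
    have r1 : secondForm α N (Φ z) (X + r • Y) (X + r • Y) = secondForm α N (Φ z) X X
        + 2 * r * secondForm α N (Φ z) X Y + r ^ 2 * secondForm α N (Φ z) Y Y := by
      simp only [secondForm_add_left, secondForm_add_right, secondForm_smul_left,
        secondForm_smul_right, hS.symm (Φ z) Y X]
      ring
    have r2 : firstForm α (Φ z) (X + r • Y) (X + r • Y) = firstForm α (Φ z) X X
        + 2 * r * firstForm α (Φ z) X Y + r ^ 2 * firstForm α (Φ z) Y Y := by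
      simp only [firstForm_add_left, firstForm_add_right, firstForm_smul_left,
        firstForm_smul_right, firstForm_comm Y X]
      ring
    refine Eq.trans r1 (Eq.trans ?_ (congrArg _ r2).symm)
    linear_combination hq
  · have f2 : geodTorsion α N (Φ z) (mfderiv 𝓘(ℝ, ℝ × ℝ) (𝓡 2) Φ z ((1, slope κ α N Φ z) : ℝ × ℝ)) =
        -inner ℝ (fderiv ℝ (N ∘ Φ) z (1, slope κ α N Φ z))
        (wedge (N (Φ z)) (fderiv ℝ (α ∘ Φ) z (1, slope κ α N Φ z))) /
        inner ℝ (fderiv ℝ (α ∘ Φ) z (1, slope κ α N Φ z))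
        (fderiv ℝ (α ∘ Φ) z (1, slope κ α N Φ z)) := by
      rw [geodTorsion, f1, fderiv_comp_eq_diff (hS.mdiff _) hmd,
        fderiv_comp_eq_diff (hS.mdiff_normal _) hmd]
    rw [f2, ← mul_div_assoc]
    exact div_pos e3 e2

end Slope

/-! ### The transversal derivative of the slope -/

theorem inner_deriv_self_eq_zero {f : ℝ → E3} {f' : E3} {t r : ℝ} (hf : HasDerivAt f f' t)
    (h : ∀ᶠ x in 𝓝 t, inner ℝ (f x) (f x) = r) : inner ℝ (f t) f' = (0 : ℝ) := by
  have h1 := hf.inner ℝ hf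
  have h2 := h1.unique ((hasDerivAt_const t r).congr_of_eventuallyEq h)
  rw [real_inner_comm (f t) f'] at h2
  linarith

theorem inner_deriv_add_eq_zero {f g : ℝ → E3} {f' g' : E3} {t : ℝ} (hf : HasDerivAt f f' t)
    (hg : HasDerivAt g g' t) (h : ∀ x, inner ℝ (f x) (g x) = (0 : ℝ)) :
    inner ℝ (f t) g' + inner ℝ f' (g t) = (0 : ℝ) :=
  (hf.inner ℝ hg).unique ((hasDerivAt_const t (0 : ℝ)).congr_of_eventuallyEq
    (Filter.Eventually.of_forall h))

section SlopeDeriv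

variable {M : Type*} [TopologicalSpace M] [ChartedSpace E2 M] [IsManifold (𝓡 2) ∞ M]
  {α N : M → E3} {κ : Kind} {c : ℝ → M} {Φ : ℝ × ℝ → M} {I : Set ℝ}

theorem hasDerivAt_tang (hS : IsRegularSurface α N) (hc : IsUnitLine κ α N c Set.univ) (s : ℝ) :
    HasDerivAt (tang α c) (deriv (tang α c) s) s :=
  ((contDiff_tang hS hc).differentiable (by norm_num) s).hasDerivAt

theorem hasDerivAt_conormal (hS : IsRegularSurface α N) (hc : IsUnitLine κ α N c Set.univ) (s : ℝ) :
    HasDerivAt (conormal α N c) (deriv (conormal α N c) s) s :=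
  ((contDiff_conormal hS hc).differentiable (by norm_num) s).hasDerivAt

theorem hasDerivAt_normal (hS : IsRegularSurface α N) (hc : IsUnitLine κ α N c Set.univ) (s : ℝ) :
    HasDerivAt (N ∘ c) (deriv (N ∘ c) s) s :=
  ((contDiff_normal_curve hS hc).differentiable (by norm_num) s).hasDerivAt

theorem IsStrip.fderiv_fderiv_one_one (hS : IsRegularSurface α N) (hΦ : IsStrip α N c Φ I)
    (hI : IsOpen I) {s : ℝ} (hs : s ∈ I) :
    fderiv ℝ (fderiv ℝ (α ∘ Φ)) (s, 0) (1, 0) (1, 0) = deriv (tang α c) s := by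
  have hA : ContDiffAt ℝ 2 (α ∘ Φ) (s, 0) :=
    (contDiffAt_smooth_comp hS.smooth_five (hΦ.smooth s hs)).of_le (by norm_num)
  have h1 := hasDerivAt_slice (hasFDerivAt_fderiv_apply hA (1, 0)).differentiableAt
  rw [(hasFDerivAt_fderiv_apply hA (1, 0)).fderiv] at h1
  refine h1.deriv.symm.trans (Filter.EventuallyEq.deriv_eq ?_)
  filter_upwards [hI.mem_nhds hs] with x hx
  exact hΦ.fderiv_base hS.smooth_five hI hx

theorem IsStrip.fderiv_fderiv_one_two (hS : IsRegularSurface α N) (hΦ : IsStrip α N c Φ I)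
    (hI : IsOpen I) {s : ℝ} (hs : s ∈ I) :
    fderiv ℝ (fderiv ℝ (α ∘ Φ)) (s, 0) (1, 0) (0, 1) = deriv (conormal α N c) s := by
  have hA : ContDiffAt ℝ 2 (α ∘ Φ) (s, 0) :=
    (contDiffAt_smooth_comp hS.smooth_five (hΦ.smooth s hs)).of_le (by norm_num)
  have h1 := hasDerivAt_slice (hasFDerivAt_fderiv_apply hA (0, 1)).differentiableAt
  rw [(hasFDerivAt_fderiv_apply hA (0, 1)).fderiv] at h1
  refine h1.deriv.symm.trans (Filter.EventuallyEq.deriv_eq ?_)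
  filter_upwards [hI.mem_nhds hs] with x hx
  exact hΦ.deriv_conormal x hx

/-- By symmetry of the second form `-τ = ⟨N_w, α_s⟩` on the axis; this is differentiated along the
axis. The result contains `⟨N_sw, T⟩`, and so removes the only second derivative of `N` occurring in
the derivative of the slope. -/
theorem IsStrip.deriv_torsion (hS : IsRegularSurface α N) (hc : IsUnitLine κ α N c Set.univ)
    (hΦ : IsStrip α N c Φ I) (hI : IsOpen I) {s : ℝ} (hs : s ∈ I) :
    -deriv (torsion α N c) s = inner ℝ (fderiv ℝ (fderiv ℝ (N ∘ Φ)) (s, 0) (1, 0) (0, 1))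
      (tang α c s) + inner ℝ (fderiv ℝ (N ∘ Φ) (s, 0) (0, 1)) (deriv (tang α c) s) := by
  have hA : ContDiffAt ℝ 2 (α ∘ Φ) (s, 0) :=
    (contDiffAt_smooth_comp hS.smooth_five (hΦ.smooth s hs)).of_le (by norm_num)
  have hn : ContDiffAt ℝ 2 (N ∘ Φ) (s, 0) :=
    (contDiffAt_smooth_comp hS.smooth_normal (hΦ.smooth s hs)).of_le (by norm_num)
  have h1 := fderiv_pairing hn hA (0, 1) (1, 0) (1, 0)
  rw [hΦ.fderiv_fderiv_one_one hS hI hs, hΦ.fderiv_base hS.smooth_five hI hs] at h1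
  have hd : DifferentiableAt ℝ (pairing (N ∘ Φ) (α ∘ Φ) (0, 1) (1, 0)) (s, 0) :=
    (contDiffAt_pairing (k := 1) (by norm_num) hn hA _ _).differentiableAt (by norm_num)
  have h2 := (hasDerivAt_slice hd).deriv
  rw [h1] at h2
  have h3 : HasDerivAt (fun x => -torsion α N c x) (-deriv (torsion α N c) s) s :=
    ((contDiff_torsion hS hc).differentiable (by norm_num) s).hasDerivAt.neg
  refine h3.deriv.symm.trans (Eq.trans (Filter.EventuallyEq.deriv_eq ?_) h2)
  filter_upwards [hI.mem_nhds hs] with x hx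
  rw [pairing_comm hS ((hΦ.smooth x hx).mdifferentiableAt (by simp)),
    hΦ.pairing_normal_one_two hS hc hI hx]

/-- The local inverse `R` of the strip writes `√K` near `c s` as `(√K ∘ Φ) ∘ R`, which shows that it
is differentiable on the surface. Only then does the chain rule apply to the `mfderiv` in
`sqrtCurvDeriv`. -/
theorem IsStrip.fderiv_sqrt (hS : IsRegularSurface α N) (hc : IsUnitLine κ α N c Set.univ)
    (hΦ : IsStrip α N c Φ I) (hI : IsOpen I) {s : ℝ} (hs : s ∈ I) :
    fderiv ℝ (fun z => √(gaussCurv α N (Φ z))) (s, 0) (0, 1) = sqrtCurvDeriv α N c s := by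
  obtain ⟨R, hR, hRc, -, hΦR⟩ := hΦ.exists_inverse hS hc hI hs
  have hm := hΦ.contDiffAt_sqrt hS hc hI hs
  have h1 : ContMDiffAt (𝓡 2) 𝓘(ℝ, ℝ) 1 (fun q => √(gaussCurv α N q)) (c s) := by
    have h2 : (fun q => √(gaussCurv α N q)) =ᶠ[𝓝 (c s)]
        (fun z => √(gaussCurv α N (Φ z))) ∘ R := by
      filter_upwards [hΦR] with q hq
      simp only [Function.comp_apply, hq]
    refine ContMDiffAt.congr_of_eventuallyEq ?_ h2
    refine ContMDiffAt.comp (c s) ?_ (hR.of_le (by norm_num))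
    rw [hRc]
    exact (hm.of_le (by norm_num)).contMDiffAt
  have h3 : ∀ q, q = c s → ∀ ζ : ℝ × ℝ, Φ (s, 0) = q →
      fderiv ℝ ((fun q => √(gaussCurv α N q)) ∘ Φ) (s, 0) ζ =
      mfderiv (𝓡 2) 𝓘(ℝ, ℝ) (fun q => √(gaussCurv α N q)) q
        (mfderiv 𝓘(ℝ, ℝ × ℝ) (𝓡 2) Φ (s, 0) ζ : E2) := by
    rintro q hq ζ rfl
    rw [← mfderiv_eq_fderiv, mfderiv_comp (s, (0 : ℝ))
      (by rw [hq]; exact h1.mdifferentiableAt (by simp))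
      ((hΦ.smooth s hs).mdifferentiableAt (by simp))]
    rfl
  have h4 := h3 (c s) rfl (0, 1) (hΦ.base s hs)
  rw [hΦ.mfderiv_conormal hS hs] at h4
  exact h4

/-- Derivative of the slope of the foliation in the direction transversal to the cycle. -/
theorem IsStrip.fderiv_slope (hS : IsRegularSurface α N) (hc : IsUnitLine κ α N c Set.univ)
    (hΦ : IsStrip α N c Φ I) (hI : IsOpen I) {s : ℝ} (hs : s ∈ I) :
    fderiv ℝ (slope κ α N Φ) (s, 0) (0, 1) =
      returnIntegrand α N c s - deriv (torsion α N c) s / (2 * torsion α N c s) := by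
  have hA4 := contDiffAt_smooth_comp hS.smooth_five (hΦ.smooth s hs)
  have hn4 := contDiffAt_smooth_comp hS.smooth_normal (hΦ.smooth s hs)
  have hA : ContDiffAt ℝ 2 (α ∘ Φ) (s, 0) := hA4.of_le (by norm_num)
  have hn : ContDiffAt ℝ 2 (N ∘ Φ) (s, 0) := hn4.of_le (by norm_num)
  have hτ := torsion_ne_zero hc s
  have hE : HasDerivAt (fun w => diffCoef α N Φ (1, 0) (1, 0) (s, w))
      (-fderiv ℝ (pairing (N ∘ Φ) (α ∘ Φ) (1, 0) (1, 0)) (s, 0) (0, 1)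
        - (sqrtCurvDeriv α N c s * pairing (α ∘ Φ) (α ∘ Φ) (1, 0) (1, 0) (s, 0)
          + √(gaussCurv α N (Φ (s, 0)))
            * fderiv ℝ (pairing (α ∘ Φ) (α ∘ Φ) (1, 0) (1, 0)) (s, 0) (0, 1))) 0 := by
    rw [← hΦ.fderiv_sqrt hS hc hI hs]
    have d1 := hasDerivAt_slice_right ((contDiffAt_pairing (k := 1) (by norm_num) hn hA
      (1, 0) (1, 0)).differentiableAt (by norm_num))
    have d2 := hasDerivAt_slice_right ((contDiffAt_pairing (k := 1) (by norm_num) hA hA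
      (1, 0) (1, 0)).differentiableAt (by norm_num))
    have d3 := hasDerivAt_slice_right
      ((hΦ.contDiffAt_sqrt hS hc hI hs).differentiableAt (by norm_num))
    exact d1.neg.sub (d3.mul d2)
  have hD := hasDerivAt_slice_right
    ((hΦ.contDiffAt_denominator hS hc hI hs).differentiableAt (by norm_num))
  have hDne := hΦ.denominator_base hS hc hI hs
  have hsl := hasDerivAt_slice_right
    ((hΦ.contDiffAt_slope hS hc hI hs).differentiableAt (by norm_num))
  have hq := hE.neg.div hD (by rw [hDne]; exact mul_ne_zero two_ne_zero hτ)
  have hval := hsl.unique hq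
  rw [hDne] at hval
  -- The numerator vanishes on the axis, so the derivative of the denominator drops out and `-e_w /
  -- (2τ)` remains.
  have hz : (-fun w => diffCoef α N Φ (1, 0) (1, 0) (s, w)) 0 = 0 := by
    rw [Pi.neg_apply, hΦ.diffCoef_one_one hS hc hI hs, neg_zero]
  rw [hz, zero_mul, sub_zero] at hval
  rw [hval]
  have hpN := fderiv_pairing hn hA (1, 0) (1, 0) (0, 1)
  have hpA := fderiv_pairing hA hA (1, 0) (1, 0) (0, 1)
  rw [fderiv_fderiv_comm hn, fderiv_fderiv_comm hA, hΦ.fderiv_fderiv_one_two hS hI hs,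
    hΦ.fderiv_base hS.smooth_five hI hs, hΦ.fderiv_base hS.smooth_normal hI hs] at hpN
  rw [fderiv_fderiv_comm hA, hΦ.fderiv_fderiv_one_two hS hI hs,
    hΦ.fderiv_base hS.smooth_five hI hs] at hpA
  have ht' := hΦ.deriv_torsion hS hc hI hs
  have dT := hasDerivAt_tang hS hc s
  have dY := hasDerivAt_conormal hS hc s
  have dN := hasDerivAt_normal hS hc s
  have o1 := inner_deriv_self_eq_zero dT (Filter.Eventually.of_forall (inner_tang_self hS hc))
  have o2 := inner_deriv_self_eq_zero dY (Filter.Eventually.of_forall (inner_conormal_self hS hc))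
  have o3 := inner_deriv_self_eq_zero dN (Filter.Eventually.of_forall fun x => hS.inner_self (c x))
  have o4 := inner_deriv_add_eq_zero dT dY fun x => inner_tang_conormal x
  have o5 := inner_deriv_add_eq_zero dN dT fun x => inner_normal_tang hS hc x
  have o6 := inner_deriv_self_eq_zero
    (hasDerivAt_slice_right (hn.differentiableAt (by norm_num))) (r := 1)
    (Filter.Eventually.of_forall fun x => hS.inner_self (Φ (s, x)))
  have q11 := hΦ.pairing_normal_one_one hS hc hI hs
  have q12 := hΦ.pairing_normal_one_two hS hc hI hs
  have q22 := hΦ.pairing_normal_two_two hS hc hs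
  rw [pairing, hΦ.fderiv_base hS.smooth_five hI hs, hΦ.fderiv_base hS.smooth_normal hI hs] at q11
  rw [pairing, hΦ.deriv_conormal s hs] at q22
  have hframe := inner_frame (hS.inner_self (c s)) (inner_tang_self hS hc s)
    (inner_normal_tang hS hc s)
  rw [← conormal] at hframe
  -- Unit lengths and orthogonality leave one term in each expansion: `⟨N_w, T'⟩ = (√K - 2H) k_g`
  -- and `⟨N_s, (N ∧ T)'⟩ = -√K ⟨T, (N ∧ T)'⟩`, the latter being `√K k_g` by `o4`.
  have k1 := hframe (fderiv ℝ (N ∘ Φ) (s, 0) (0, 1)) (deriv (tang α c) s)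
  have k2 := hframe (deriv (N ∘ c) s) (deriv (conormal α N c) s)
  have hkg : geodCurv α N c s = inner ℝ (deriv (tang α c) s) (conormal α N c s) := rfl
  simp only [Function.comp_apply, hΦ.base s hs] at o3 o5 o6
  have htd : deriv (α ∘ c) s = tang α c s := rfl
  rw [htd] at hpN hpA q11
  rw [hpN, hpA, hΦ.pairing_one_one hS hc hI hs, hΦ.base s hs, returnIntegrand, ← torsion, hkg]
  rw [real_inner_comm (tang α c s) (deriv (conormal α N c) s)]
  rw [o1, o6, real_inner_comm _ (conormal α N c s), real_inner_comm _ (conormal α N c s), q22] at k1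
  rw [o2, o3, real_inner_comm _ (tang α c s), q11] at k2
  field_simp
  linear_combination -ht' - k1 + k2 + √(gaussCurv α N (c s)) * o4

end SlopeDeriv

/-! ### Scalar equations near the zero solution -/

/-- Tube lemma: compactness of `K` turns local statements at the points `(s, 0)` into one with a
uniform width. -/
theorem exists_tube {K : Set ℝ} (hK : IsCompact K) {Q : ℝ × ℝ → Prop}
    (hQ : ∀ s ∈ K, ∀ᶠ z in 𝓝 (s, (0 : ℝ)), Q z) :
    ∃ ε > 0, ∀ s ∈ K, ∀ w, |w| < ε → Q (s, w) := by
  have h : ∀ᶠ w in 𝓝 (0 : ℝ), ∀ s ∈ K, Q (s, w) := by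
    refine hK.eventually_forall_of_forall_eventually (P := fun w s => Q (s, w)) fun s hs => ?_
    have : ContinuousAt (fun z : ℝ × ℝ => (z.2, z.1)) ((0 : ℝ), s) := by fun_prop
    exact this.eventually (hQ s hs)
  obtain ⟨ε, hε, h'⟩ := Metric.eventually_nhds_iff.1 h
  exact ⟨ε, hε, fun s hs w hw => h' (by simpa using hw) s hs⟩

/-- A solution of `w' = f` with `|f| ≤ K |w|` stays within a constant multiple of its values. -/
theorem abs_le_of_deriv_le_mul {w f : ℝ → ℝ} {a b K : ℝ}
    (hw : ∀ s ∈ Set.Icc a b, HasDerivWithinAt w (f s) (Set.Icc a b) s)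
    (hf : ∀ s ∈ Set.Icc a b, |f s| ≤ K * |w s|) {s t : ℝ} (hs : s ∈ Set.Icc a b)
    (ht : t ∈ Set.Icc a b) : |w t| ≤ Real.exp (K * |t - s|) * |w s| := by
  have hwc : ContinuousOn w (Set.Icc a b) := fun s hs => (hw s hs).continuousWithinAt
  have hd : ∀ s ∈ interior (Set.Icc a b), HasDerivAt w (f s) s := fun s hs =>
    (hw s (interior_subset hs)).hasDerivAt (mem_interior_iff_mem_nhds.1 hs)
  have hfw : ∀ s ∈ Set.Icc a b, |w s * f s| ≤ K * w s ^ 2 := fun s hs => by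
    rw [abs_mul]
    calc |w s| * |f s| ≤ |w s| * (K * |w s|) :=
          mul_le_mul_of_nonneg_left (hf s hs) (abs_nonneg _)
      _ = K * |w s| ^ 2 := by ring
      _ = K * w s ^ 2 := by rw [sq_abs]
  -- Grönwall in both time directions: `w² exp(2εs)` is increasing for `ε = K` and decreasing for `ε
  -- = -K`. Working with squares avoids dividing by `w`.
  have key : ∀ ε : ℝ, ∀ s ∈ interior (Set.Icc a b),
      HasDerivAt (fun x => w x ^ 2 * Real.exp (2 * ε * x))
        (2 * (w s * f s + ε * w s ^ 2) * Real.exp (2 * ε * s)) s := by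
    intro ε s hs
    have h1 := (hd s hs).fun_pow 2
    have h2 := ((hasDerivAt_id' s).const_mul (2 * ε)).exp
    refine (h1.fun_mul h2).congr_deriv ?_
    push_cast
    ring
  have hcont : ∀ ε : ℝ, ContinuousOn (fun x => w x ^ 2 * Real.exp (2 * ε * x)) (Set.Icc a b) :=
    fun ε => (hwc.pow 2).mul (by fun_prop)
  have hmono : MonotoneOn (fun x => w x ^ 2 * Real.exp (2 * K * x)) (Set.Icc a b) := by
    refine monotoneOn_of_deriv_nonneg (convex_Icc a b) (hcont K)
      (fun x hx => (key K x hx).differentiableAt.differentiableWithinAt) fun x hx => ?_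
    rw [(key K x hx).deriv]
    have := (abs_le.1 (hfw x (interior_subset hx))).1
    exact mul_nonneg (by linarith) (Real.exp_pos _).le
  have hanti : AntitoneOn (fun x => w x ^ 2 * Real.exp (2 * (-K) * x)) (Set.Icc a b) := by
    refine antitoneOn_of_deriv_nonpos (convex_Icc a b) (hcont (-K))
      (fun x hx => (key (-K) x hx).differentiableAt.differentiableWithinAt) fun x hx => ?_
    rw [(key (-K) x hx).deriv]
    have := (abs_le.1 (hfw x (interior_subset hx))).2
    exact mul_nonpos_of_nonpos_of_nonneg (by linarith) (Real.exp_pos _).le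
  have hsq : w t ^ 2 ≤ (Real.exp (K * |t - s|) * |w s|) ^ 2 := by
    have e1 : (Real.exp (K * |t - s|) * |w s|) ^ 2
        = w s ^ 2 * Real.exp (2 * K * |t - s|) := by
      rw [mul_pow, sq_abs, ← Real.exp_nat_mul]
      push_cast
      rw [mul_comm]; ring_nf
    rw [e1]
    rcases le_total s t with h | h
    · have h1 := hanti hs ht h
      simp only at h1
      rw [abs_of_nonneg (sub_nonneg.2 h)]
      have h2 := mul_le_mul_of_nonneg_right h1 (Real.exp_pos (2 * K * t)).le
      rw [mul_assoc (w t ^ 2), mul_assoc (w s ^ 2), ← Real.exp_add, ← Real.exp_add] at h2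
      have e2 : 2 * -K * t + 2 * K * t = 0 := by ring
      have e3 : 2 * -K * s + 2 * K * t = 2 * K * (t - s) := by ring
      rwa [e2, e3, Real.exp_zero, mul_one] at h2
    · have h1 := hmono ht hs h
      simp only at h1
      rw [abs_of_nonpos (sub_nonpos.2 h)]
      have h2 := mul_le_mul_of_nonneg_right h1 (Real.exp_pos (-(2 * K * t))).le
      rw [mul_assoc (w t ^ 2), mul_assoc (w s ^ 2), ← Real.exp_add, ← Real.exp_add] at h2
      have e2 : 2 * K * t + -(2 * K * t) = 0 := by ring
      have e3 : 2 * K * s + -(2 * K * t) = 2 * K * -(t - s) := by ring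
      rwa [e2, e3, Real.exp_zero, mul_one] at h2
  exact abs_le_of_sq_le_sq hsq (by positivity)

section Flow

variable {p : ℝ × ℝ → ℝ} {I : Set ℝ} {s₁ s₂ : ℝ}

theorem exists_lipschitz_tube (hp : ∀ s ∈ I, ContDiffAt ℝ 1 p (s, 0)) (hI : Set.Icc s₁ s₂ ⊆ I) :
    ∃ ε > 0, ∃ K : ℝ, 0 ≤ K ∧ ∀ s ∈ Set.Icc s₁ s₂, ∀ w, |w| < ε →
      ContDiffAt ℝ 1 p (s, w) ∧ |fderiv ℝ p (s, w) (0, 1)| ≤ K := by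
  have hc : ∀ s ∈ I, ContinuousAt (fun z => fderiv ℝ p z (0, 1)) (s, 0) := fun s hs =>
    ((hp s hs).fderiv_right (m := 0) (by norm_num)).continuousAt.clm_apply continuousAt_const
  have hc' : ContinuousOn (fun s : ℝ => fderiv ℝ p (s, 0) (0, 1)) (Set.Icc s₁ s₂) := fun s hs => by
    have h : ContinuousAt (fun s : ℝ => (s, (0 : ℝ))) s := by fun_prop
    exact (ContinuousAt.comp (f := fun s : ℝ => (s, (0 : ℝ))) (hc s (hI hs)) h).continuousWithinAt
  obtain ⟨K, hK⟩ := isCompact_Icc.exists_bound_of_continuousOn hc'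
  obtain ⟨ε, hε, h⟩ := exists_tube (isCompact_Icc (a := s₁) (b := s₂))
    (Q := fun z => ContDiffAt ℝ 1 p z ∧ |fderiv ℝ p z (0, 1)| ≤ |K| + 1) fun s hs => by
      refine ((hp s (hI hs)).eventually (by simp)).and ?_
      have h1 : |fderiv ℝ p (s, 0) (0, 1)| < |K| + 1 := by
        have := hK s hs
        rw [Real.norm_eq_abs] at this
        linarith [le_abs_self K]
      exact ((hc s (hI hs)).abs.eventually_lt continuousAt_const h1).mono fun z hz => hz.le
  exact ⟨ε, hε, |K| + 1, by positivity, h⟩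

/-- Solutions of `w' = p (s, w)` near the solution `w = 0`. -/
theorem exists_flow (hp : ∀ s ∈ I, ContDiffAt ℝ 1 p (s, 0)) (hp0 : ∀ s ∈ I, p (s, 0) = 0)
    (hI : Set.Icc s₁ s₂ ⊆ I) : ∃ ε > 0, ∃ C > 0, ∀ s₀ ∈ Set.Icc s₁ s₂, ∀ w₀, |w₀| < ε →
      ∃ w : ℝ → ℝ, w s₀ = w₀ ∧
        (∀ s ∈ Set.Icc s₁ s₂, HasDerivWithinAt w (p (s, w s)) (Set.Icc s₁ s₂) s) ∧
        ∀ s ∈ Set.Icc s₁ s₂, |w s| ≤ C * |w₀| := by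
  obtain ⟨δ, hδ, K, hK, hpK⟩ := exists_lipschitz_tube hp hI
  obtain ⟨δ', hδ', hδδ⟩ := exists_between hδ
  have hder : ∀ s ∈ Set.Icc s₁ s₂, ∀ w, |w| < δ →
      HasDerivAt (fun x => p (s, x)) (fderiv ℝ p (s, w) (0, 1)) w := fun s hs w hw =>
    hasDerivAt_slice_right ((hpK s hs w hw).1.differentiableAt (by norm_num))
  have hmemδ : ∀ w ∈ Set.Icc (-δ') δ', |w| < δ := fun w hw => (abs_le.2 hw).trans_lt hδδ
  have hlip : ∀ s ∈ Set.Icc s₁ s₂, LipschitzOnWith K.toNNReal (fun x => p (s, x))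
      (Set.Icc (-δ') δ') := fun s hs =>
    (convex_Icc _ _).lipschitzOnWith_of_nnnorm_hasDerivWithin_le
      (fun w hw => (hder s hs w (hmemδ w hw)).hasDerivWithinAt) fun w hw => by
        rw [← NNReal.coe_le_coe, coe_nnnorm, Real.coe_toNNReal K hK]
        exact (hpK s hs w (hmemδ w hw)).2
  have hδ0 : -δ' ≤ δ' := by linarith
  -- Clamping `w` to `[-δ', δ']` makes the right-hand side Lipschitz for all `w`. The growth bound
  -- shows afterwards that solutions with `|w₀| < exp(-K (s₂ - s₁)) δ'` stay where the clamp is the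
  -- identity.
  let cl : ℝ → ℝ := fun w => (Set.projIcc (-δ') δ' hδ0 w : ℝ)
  have hcl : ∀ w, cl w ∈ Set.Icc (-δ') δ' := fun w => (Set.projIcc (-δ') δ' hδ0 w).2
  have hclid : ∀ w ∈ Set.Icc (-δ') δ', cl w = w := fun w hw => by
    simp only [cl, Set.projIcc_of_mem hδ0 hw]
  have h0mem : (0 : ℝ) ∈ Set.Icc (-δ') δ' := ⟨by linarith, hδ'.le⟩
  have hcl1 : LipschitzWith 1 cl := LipschitzWith.projIcc hδ0
  have hclabs : ∀ w, |cl w| ≤ |w| := fun w => by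
    have := hcl1.dist_le_mul w 0
    rwa [hclid 0 h0mem, Real.dist_eq, Real.dist_eq, sub_zero, sub_zero, NNReal.coe_one,
      one_mul] at this
  let f : ℝ → ℝ → ℝ := fun s w => p (s, cl w)
  have hf1 : ∀ s ∈ Set.Icc s₁ s₂, LipschitzWith K.toNNReal (f s) := fun s hs => by
    rw [← lipschitzOnWith_univ]
    have := (hlip s hs).comp (hcl1.lipschitzOnWith (s := Set.univ)) (fun w _ => hcl w)
    rwa [mul_one] at this
  have hf2 : ∀ s ∈ Set.Icc s₁ s₂, ∀ w, |f s w| ≤ K * |cl w| := fun s hs w => by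
    have := (hlip s hs).dist_le_mul (cl w) (hcl w) 0 h0mem
    rw [hp0 s (hI hs), Real.dist_eq, Real.dist_eq, sub_zero, sub_zero, Real.coe_toNNReal K hK]
      at this
    exact this
  have hf3 : ∀ w, ContinuousOn (fun s => f s w) (Set.Icc s₁ s₂) := fun w s hs => by
    have h1 := (hpK s hs (cl w) (hmemδ _ (hcl w))).1.continuousAt
    have h2 : ContinuousAt (fun s : ℝ => (s, cl w)) s := by fun_prop
    exact (ContinuousAt.comp (f := fun s : ℝ => (s, cl w)) h1 h2).continuousWithinAt
  refine ⟨Real.exp (-(K * (s₂ - s₁))) * δ', by positivity, Real.exp (K * (s₂ - s₁)),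
    Real.exp_pos _, fun s₀ hs₀ w₀ hw₀ => ?_⟩
  have h12 : 0 ≤ s₂ - s₁ := by linarith [hs₀.1, hs₀.2]
  -- The clamped field is bounded by `K δ'`, so no solution leaves the ball of radius `K δ' (s₂ -
  -- s₁)`, and the whole interval is covered in one step.
  have hpl : IsPicardLindelof f (tmin := s₁) (tmax := s₂) ⟨s₀, hs₀⟩ w₀
      (K * δ' * (s₂ - s₁)).toNNReal 0 (K * δ').toNNReal K.toNNReal := by
    refine ⟨fun t ht => (hf1 t ht).lipschitzOnWith, fun x _ => hf3 x, fun t ht x _ => ?_, ?_⟩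
    · rw [Real.coe_toNNReal _ (by positivity), Real.norm_eq_abs]
      exact (hf2 t ht x).trans (mul_le_mul_of_nonneg_left (abs_le.2 (hcl x)) hK)
    · rw [Real.coe_toNNReal _ (by positivity), Real.coe_toNNReal _ (by positivity),
        NNReal.coe_zero, sub_zero]
      refine mul_le_mul_of_nonneg_left (max_le ?_ ?_) (by positivity)
      · simp only; linarith [hs₀.1]
      · simp only; linarith [hs₀.2]
  obtain ⟨w, hw0, hw⟩ := hpl.exists_eq_forall_mem_Icc_hasDerivWithinAt₀
  have hw0' : w s₀ = w₀ := hw0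
  have hbound : ∀ s ∈ Set.Icc s₁ s₂, |w s| ≤ Real.exp (K * (s₂ - s₁)) * |w₀| := fun s hs => by
    have h1 := abs_le_of_deriv_le_mul hw (K := K) (fun s hs => (hf2 s hs (w s)).trans
      (mul_le_mul_of_nonneg_left (hclabs _) hK)) hs₀ hs
    rw [hw0'] at h1
    refine h1.trans (mul_le_mul_of_nonneg_right (Real.exp_le_exp.2 ?_) (abs_nonneg _))
    refine mul_le_mul_of_nonneg_left (abs_le.2 ⟨?_, ?_⟩) hK <;>
      linarith [hs.1, hs.2, hs₀.1, hs₀.2]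
  refine ⟨w, hw0', fun s hs => ?_, hbound⟩
  have hmem : w s ∈ Set.Icc (-δ') δ' := by
    rw [Set.mem_Icc, ← abs_le]
    refine (hbound s hs).trans ?_
    have := mul_le_mul_of_nonneg_left hw₀.le (Real.exp_pos (K * (s₂ - s₁))).le
    rwa [← mul_assoc, ← Real.exp_add, add_neg_cancel, Real.exp_zero, one_mul] at this
  have h := hw s hs
  simp only [f, hclid _ hmem] at h
  exact h

/-- Linearization of the equation `w' = p (s, w)` along the solution `w = 0`. -/
theorem flow_asymptotics (hIo : IsOpen I) (hp : ∀ s ∈ I, ContDiffAt ℝ 1 p (s, 0))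
    (hp0 : ∀ s ∈ I, p (s, 0) = 0) (hI : Set.Icc s₁ s₂ ⊆ I) {C : ℝ} (hC : 0 < C) {η : ℝ}
    (hη : 0 < η) : ∃ ε > 0, ∀ w : ℝ → ℝ,
      (∀ s ∈ Set.Icc s₁ s₂, HasDerivWithinAt w (p (s, w s)) (Set.Icc s₁ s₂) s) →
      ∀ s₀ ∈ Set.Icc s₁ s₂, |w s₀| < ε → (∀ s ∈ Set.Icc s₁ s₂, |w s| ≤ C * |w s₀|) →
      ∀ s ∈ Set.Icc s₁ s₂,
        |w s - w s₀ * Real.exp (∫ r in s₀..s, fderiv ℝ p (r, 0) (0, 1))| ≤ η * |w s₀| := by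
  set g : ℝ → ℝ := fun r => fderiv ℝ p (r, 0) (0, 1) with hg
  have hc : ∀ s ∈ I, ContinuousAt (fun z => fderiv ℝ p z (0, 1)) (s, 0) := fun s hs =>
    ((hp s hs).fderiv_right (m := 0) (by norm_num)).continuousAt.clm_apply continuousAt_const
  have hgc : ContinuousOn g I := fun s hs => by
    have h : ContinuousAt (fun s : ℝ => (s, (0 : ℝ))) s := by fun_prop
    exact (ContinuousAt.comp (f := fun s : ℝ => (s, (0 : ℝ))) (hc s hs) h).continuousWithinAt
  let G : ℝ → ℝ := fun s => ∫ r in s₁..s, g r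
  have hint : ∀ s ∈ Set.Icc s₁ s₂, ∀ t ∈ Set.Icc s₁ s₂,
      IntervalIntegrable g MeasureTheory.volume s t := fun s hs t ht =>
    (hgc.mono ((Set.ordConnected_Icc.uIcc_subset hs ht).trans hI)).intervalIntegrable
  have hGd : ∀ s ∈ Set.Icc s₁ s₂, HasDerivAt G (g s) s := fun s hs =>
    intervalIntegral.integral_hasDerivAt_right
      (hint s₁ ⟨le_rfl, hs.1.trans hs.2⟩ s hs)
      (hgc.stronglyMeasurableAtFilter hIo s (hI hs)) (hgc.continuousAt (hIo.mem_nhds (hI hs)))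
  have hGc : ContinuousOn G (Set.Icc s₁ s₂) := fun s hs => (hGd s hs).continuousAt.continuousWithinAt
  obtain ⟨B₀, hB₀⟩ := isCompact_Icc.exists_bound_of_continuousOn hGc
  set B := Real.exp |B₀| with hB
  have hBp : 0 < B := Real.exp_pos _
  have hGB : ∀ s ∈ Set.Icc s₁ s₂, Real.exp (G s) ≤ B ∧ Real.exp (-G s) ≤ B := fun s hs => by
    have h1 := (hB₀ s hs).trans (le_abs_self _)
    rw [Real.norm_eq_abs, abs_le] at h1
    exact ⟨Real.exp_le_exp.2 h1.2, Real.exp_le_exp.2 (by linarith)⟩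
  -- Tolerance for the linearization error. It is multiplied by `C` (size of `w`), by `B` twice
  -- (bounds of `exp (±G)`) and by the length of the interval; the `+ 1` keeps the denominator
  -- positive.
  let η' := η / (B * B * C * (|s₂ - s₁| + 1))
  have hη' : 0 < η' := by positivity
  obtain ⟨ε, hε, htube⟩ := exists_tube (isCompact_Icc (a := s₁) (b := s₂))
    (Q := fun z => DifferentiableAt ℝ p z ∧ |fderiv ℝ p z (0, 1) - g z.1| < η') fun s hs => by
      have hs' := hI hs
      refine (((hp s hs').eventually (by simp)).mono fun z hz =>
        hz.differentiableAt (by norm_num)).and ?_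
      have h1 : ContinuousAt (fun z : ℝ × ℝ => g z.1) (s, 0) :=
        ContinuousAt.comp (f := fun z : ℝ × ℝ => z.1) (g := g) (x := (s, (0 : ℝ)))
          (hgc.continuousAt (hIo.mem_nhds hs')) continuousAt_fst
      refine (((hc s hs').sub h1).abs).eventually_lt continuousAt_const ?_
      simp [hg, hη']
  have hrem : ∀ s ∈ Set.Icc s₁ s₂, ∀ x, |x| < ε → |p (s, x) - g s * x| ≤ η' * |x| := by
    intro s hs x hx
    have hx' : x ∈ Metric.ball (0 : ℝ) ε := by simpa using hx
    have h0' : (0 : ℝ) ∈ Metric.ball (0 : ℝ) ε := Metric.mem_ball_self hε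
    have h1 := (convex_ball (0 : ℝ) ε).norm_image_sub_le_of_norm_hasDerivWithin_le
      (f := fun x => p (s, x) - g s * x) (f' := fun x => fderiv ℝ p (s, x) (0, 1) - g s * 1)
      (C := η') (fun y hy => ?_) (fun y hy => ?_) h0' hx'
    · simpa [hp0 s (hI hs)] using h1
    · have hy' : |y| < ε := by simpa using hy
      exact ((hasDerivAt_slice_right (htube s hs y hy').1).sub
        ((hasDerivAt_id y).const_mul (g s))).hasDerivWithinAt
    · have hy' : |y| < ε := by simpa using hy
      rw [mul_one]
      exact (htube s hs y hy').2.le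
  refine ⟨ε / C, by positivity, fun w hw s₀ hs₀ hw₀ hwC s hs => ?_⟩
  have hwε : ∀ t ∈ Set.Icc s₁ s₂, |w t| < ε := fun t ht =>
    (hwC t ht).trans_lt (by rwa [lt_div_iff₀ hC, mul_comm] at hw₀)
  -- Variation of constants: after division by the linear solution `exp G`, only the remainder `p -
  -- g w` contributes to the derivative.
  let v : ℝ → ℝ := fun t => w t * Real.exp (-G t)
  have hv : ∀ t ∈ Set.Icc s₁ s₂, HasDerivWithinAt v
      ((p (t, w t) - g t * w t) * Real.exp (-G t)) (Set.Icc s₁ s₂) t := fun t ht => by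
    have h1 := (hw t ht).fun_mul ((hGd t ht).fun_neg.exp.hasDerivWithinAt (s := Set.Icc s₁ s₂))
    refine h1.congr_deriv ?_
    ring
  have hvb : ∀ t ∈ Set.Icc s₁ s₂,
      ‖(p (t, w t) - g t * w t) * Real.exp (-G t)‖ ≤ η' * (C * |w s₀|) * B := fun t ht => by
    rw [norm_mul, Real.norm_eq_abs, Real.norm_eq_abs, abs_of_pos (Real.exp_pos _)]
    refine mul_le_mul ((hrem t ht _ (hwε t ht)).trans
      (mul_le_mul_of_nonneg_left (hwC t ht) hη'.le)) (hGB t ht).2 (Real.exp_pos _).le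
      (by positivity)
  have h1 := (convex_Icc s₁ s₂).norm_image_sub_le_of_norm_hasDerivWithin_le hv hvb hs₀ hs
  have hGsub : ∫ r in s₀..s, g r = G s - G s₀ := by
    have h2 : s₁ ∈ Set.Icc s₁ s₂ := ⟨le_rfl, hs.1.trans hs.2⟩
    exact (intervalIntegral.integral_interval_sub_left (hint _ h2 _ hs) (hint _ h2 _ hs₀)).symm
  have h2 : w s - w s₀ * Real.exp (G s - G s₀) = Real.exp (G s) * (v s - v s₀) := by
    simp only [v]
    have e : Real.exp (G s) * Real.exp (-G s) = 1 := by
      rw [← Real.exp_add, add_neg_cancel, Real.exp_zero]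
    rw [sub_eq_add_neg (G s), Real.exp_add]
    linear_combination (-(w s)) * e
  rw [hGsub, h2, abs_mul, abs_of_pos (Real.exp_pos _)]
  rw [Real.norm_eq_abs, Real.norm_eq_abs] at h1
  have h3 : |s - s₀| ≤ |s₂ - s₁| + 1 := by
    have := le_abs_self (s₂ - s₁)
    rw [abs_le]
    constructor <;> linarith [hs.1, hs.2, hs₀.1, hs₀.2]
  calc Real.exp (G s) * |v s - v s₀|
      ≤ B * (η' * (C * |w s₀|) * B * (|s₂ - s₁| + 1)) := by
        refine mul_le_mul (hGB s hs).1 (h1.trans ?_) (abs_nonneg _) hBp.le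
        exact mul_le_mul_of_nonneg_left h3 (by positivity)
    _ = η * |w s₀| := by
        simp only [η']
        field_simp

end Flow

/-! ### The section as a graph in strip coordinates -/

theorem exists_local_inverse {f : ℝ → ℝ} {b : ℝ} (hf : ContDiffAt ℝ 1 f 0) (h0 : f 0 = 0)
    (hb : HasDerivAt f b 0) (hb0 : b ≠ 0) : ∃ V : ℝ → ℝ, ContDiffAt ℝ 1 V 0 ∧
      HasDerivAt V b⁻¹ 0 ∧ V 0 = 0 ∧ (∀ᶠ v in 𝓝 0, V (f v) = v) ∧ ∀ᶠ w in 𝓝 0, f (V w) = w := by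
  let e : ℝ ≃L[ℝ] ℝ := ContinuousLinearEquiv.unitsEquivAut ℝ (Units.mk0 b hb0)
  have he : HasFDerivAt f (e : ℝ →L[ℝ] ℝ) 0 := by
    refine hb.hasFDerivAt.congr_fderiv ?_
    ext
    simp [e]
  have hst := hf.hasStrictFDerivAt' he (by norm_num)
  have h1 : ContDiffAt ℝ 1 (hst.localInverse f e 0) (f 0) := hf.to_localInverse he (by norm_num)
  have h2 : hst.localInverse f e 0 (f 0) = 0 := hst.localInverse_apply_image
  have h3 := hst.eventually_left_inverse
  have h4 := hst.eventually_right_inverse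
  rw [h0] at h1 h2 h4
  refine ⟨_, h1, ?_, h2, h3, h4⟩
  refine HasDerivAt.of_local_left_inverse h1.continuousAt ?_ hb0 h4
  rwa [h2]

/-- A solution of `w' = p (s, w)` close to the `s`-axis meets a graph `s = g w` exactly once. -/
theorem strictMonoOn_sub_graph {p : ℝ × ℝ → ℝ} {g : ℝ → ℝ} {t : ℝ} (hp : ContinuousAt p (t, 0))
    (hp0 : p (t, 0) = 0) (hg : ContDiffAt ℝ 1 g 0) (hg0 : g 0 = t) :
    ∃ η₀ > 0, ∀ η, 0 < η → η ≤ η₀ → ∃ ε > 0, ∀ w : ℝ → ℝ,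
      (∀ s ∈ Set.Icc (t - η) (t + η),
        HasDerivWithinAt w (p (s, w s)) (Set.Icc (t - η) (t + η)) s ∧ |w s| < ε) →
      StrictMonoOn (fun s => s - g (w s)) (Set.Icc (t - η) (t + η)) ∧
        ContinuousOn (fun s => s - g (w s)) (Set.Icc (t - η) (t + η)) ∧
        t - η - g (w (t - η)) < 0 ∧ 0 < t + η - g (w (t + η)) := by
  have hgd : ContinuousAt (deriv g) 0 := by
    have h1 := (hg.fderiv_right (m := 0) (by norm_num)).continuousAt.clm_apply
      (continuousAt_const (y := (1 : ℝ)))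
    simpa only [fderiv_apply_one_eq_deriv] using h1
  -- The derivative of `s - g (w s)` is `1 - g' p`; it is positive near `(t, 0)` because `p`
  -- vanishes there. Solutions are almost horizontal and cross the graph transversally.
  have hev : ∀ᶠ z in 𝓝 (t, (0 : ℝ)), DifferentiableAt ℝ g z.2 ∧ deriv g z.2 * p z < 1 := by
    have h1 : ContinuousAt (fun z : ℝ × ℝ => z.2) (t, 0) := continuousAt_snd
    have h2 : ContinuousAt (fun z : ℝ × ℝ => deriv g z.2) (t, 0) :=
      ContinuousAt.comp (f := fun z : ℝ × ℝ => z.2) (g := deriv g) hgd h1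
    refine (h1.eventually (((hg.eventually (by simp)).mono fun x hx =>
      hx.differentiableAt (by norm_num)))).and
      ((h2.mul hp).eventually_lt continuousAt_const ?_)
    simp [hp0]
  obtain ⟨ρ, hρ, hball⟩ := Metric.eventually_nhds_iff.1 hev
  refine ⟨ρ / 2, by positivity, fun η hη hηρ => ?_⟩
  obtain ⟨ε', hε', hgε⟩ := Metric.continuousAt_iff.1 hg.continuousAt η hη
  refine ⟨min ρ ε', lt_min hρ hε', fun w hw => ?_⟩
  have hz : ∀ s ∈ Set.Icc (t - η) (t + η),
      DifferentiableAt ℝ g (w s) ∧ deriv g (w s) * p (s, w s) < 1 := fun s hs => by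
    refine hball (y := (s, w s)) ?_
    rw [Prod.dist_eq, max_lt_iff, Real.dist_eq, Real.dist_eq, sub_zero]
    refine ⟨?_, (hw s hs).2.trans_le (min_le_left _ _)⟩
    rw [abs_lt]; constructor <;> linarith [hs.1, hs.2]
  have hd : ∀ s ∈ Set.Icc (t - η) (t + η), HasDerivWithinAt (fun s => s - g (w s))
      (1 - deriv g (w s) * p (s, w s)) (Set.Icc (t - η) (t + η)) s := fun s hs =>
    (hasDerivWithinAt_id s _).sub ((hz s hs).1.hasDerivAt.comp_hasDerivWithinAt s (hw s hs).1)
  have hgw : ∀ s ∈ Set.Icc (t - η) (t + η), |g (w s) - t| < η := fun s hs => by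
    have := @hgε (w s) (by
      rw [Real.dist_eq, sub_zero]; exact (hw s hs).2.trans_le (min_le_right _ _))
    rwa [hg0, Real.dist_eq] at this
  have hcont : ContinuousOn (fun s => s - g (w s)) (Set.Icc (t - η) (t + η)) :=
    fun s hs => (hd s hs).continuousWithinAt
  refine ⟨strictMonoOn_of_deriv_pos (convex_Icc _ _) hcont fun s hs => ?_, hcont, ?_, ?_⟩
  · have hs' := interior_subset hs
    rw [((hd s hs').hasDerivAt (mem_interior_iff_mem_nhds.1 hs)).deriv]
    linarith [(hz s hs').2]
  · have := abs_lt.1 (hgw (t - η) ⟨le_rfl, by linarith⟩)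
    linarith
  · have := abs_lt.1 (hgw (t + η) ⟨by linarith, le_rfl⟩)
    linarith

section SectionChart

variable {M : Type*} [TopologicalSpace M] [ChartedSpace E2 M] [IsManifold (𝓡 2) ∞ M]
  {α N : M → E3} {κ : Kind} {c σ : ℝ → M} {Φ : ℝ × ℝ → M} {I : Set ℝ}

/-- The germ of the curve `σ` at `0`, expressed in the coordinates `Φ` near `(t, 0)` by `ς`, where
it is a graph over the second coordinate; `V` expresses its parameter through that coordinate. -/
structure IsSectionChart (Φ : ℝ × ℝ → M) (σ : ℝ → M) (t b : ℝ) (ς : ℝ → ℝ × ℝ) (V : ℝ → ℝ) :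
    Prop where
  contDiffAt : ContDiffAt ℝ 1 ς 0
  base : ς 0 = (t, 0)
  lift : ∀ᶠ v in 𝓝 0, Φ (ς v) = σ v
  eq_of_eq : ∀ᶠ z in 𝓝 (t, (0 : ℝ)), ∀ v, Φ z = σ v → z = ς v
  hasDerivAt : HasDerivAt (fun v => (ς v).2) b 0
  ne_zero : b ≠ 0
  contDiffAt_param : ContDiffAt ℝ 1 V 0
  hasDerivAt_param : HasDerivAt V b⁻¹ 0
  param_zero : V 0 = 0
  param_left : ∀ᶠ v in 𝓝 0, V (ς v).2 = v
  param_right : ∀ᶠ w in 𝓝 0, (ς (V w)).2 = w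

/-- The curve `σ` is read through the local inverse of the strip. Its second coordinate has
derivative `⟨N ∧ T, σ'(0)⟩`, nonzero by transversality, so it can serve as a parameter. The constant
is written at parameter `0` even for the chart at `t`: the charts at `0` and at `L` thus share it.
-/
theorem IsStrip.exists_isSectionChart (hS : IsRegularSurface α N)
    (hc : IsUnitLine κ α N c Set.univ) (hΦ : IsStrip α N c Φ I) (hI : IsOpen I) {t : ℝ}
    (ht : t ∈ I) (hσ : IsCrossSection α c σ) (h1 : c t = c 0) (h2 : tang α c t = tang α c 0) :
    ∃ (ς : ℝ → ℝ × ℝ) (V : ℝ → ℝ),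
      IsSectionChart Φ σ t (inner ℝ (conormal α N c 0) (deriv (α ∘ σ) 0)) ς V := by
  obtain ⟨R, hR, hR0, hRl, hRr⟩ := hΦ.exists_inverse hS hc hI ht
  have hσt : σ 0 = c t := hσ.base.trans h1.symm
  have hς : ContDiffAt ℝ 1 (R ∘ σ) 0 := by
    refine contDiffAt_comp_of_contMDiffAt ?_ hσ.contMDiffAt
    rw [hσt]
    exact hR.of_le (by norm_num)
  have hς0 : (R ∘ σ) 0 = (t, 0) := by rw [Function.comp_apply, hσt, hR0]
  have hlift : ∀ᶠ v in 𝓝 (0 : ℝ), Φ ((R ∘ σ) v) = σ v := by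
    have := hσ.contMDiffAt.continuousAt
    rw [ContinuousAt, hσt] at this
    exact this.eventually hRr
  have hςd := (hς.differentiableAt (by norm_num)).hasDerivAt
  have hA : DifferentiableAt ℝ (α ∘ Φ) ((R ∘ σ) 0) := by
    rw [hς0]
    exact (contDiffAt_smooth_comp hS.smooth_five (hΦ.smooth t ht)).differentiableAt (by norm_num)
  have hd := hA.hasFDerivAt.comp_hasDerivAt (0 : ℝ) hςd
  have hd' : deriv (α ∘ σ) 0 = (deriv (R ∘ σ) 0).1 • tang α c t
      + (deriv (R ∘ σ) 0).2 • conormal α N c t := by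
    rw [← hΦ.fderiv_apply hS hI ht, ← hς0, ← hd.deriv]
    apply Filter.EventuallyEq.deriv_eq
    filter_upwards [hlift] with v hv
    exact congrArg α hv.symm
  have hco : conormal α N c t = conormal α N c 0 := by rw [conormal, conormal, h1, h2]
  rw [h2, hco] at hd'
  have hb : inner ℝ (conormal α N c 0) (deriv (α ∘ σ) 0) = (deriv (R ∘ σ) 0).2 := by
    rw [hd', inner_add_right, inner_smul_right, inner_smul_right, inner_conormal_self hS hc,
      real_inner_comm, inner_tang_conormal]
    ring
  have hb0 : (deriv (R ∘ σ) 0).2 ≠ 0 := by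
    intro h0
    have h := hσ.transversal
    rw [hd', h0, zero_smul, add_zero, LinearIndependent.pair_iff] at h
    have := h (-(deriv (R ∘ σ) 0).1) 1 (by rw [one_smul, neg_smul]; exact neg_add_cancel _)
    exact one_ne_zero this.2
  have hsnd : HasDerivAt (fun v => ((R ∘ σ) v).2) (deriv (R ∘ σ) 0).2 0 :=
    (ContinuousLinearMap.snd ℝ ℝ ℝ).hasFDerivAt.comp_hasDerivAt (0 : ℝ) hςd
  obtain ⟨V, hV, hVd, hV0, hVl, hVr⟩ := exists_local_inverse (f := fun v => ((R ∘ σ) v).2)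
    hς.snd (by rw [hς0]) hsnd hb0
  refine ⟨R ∘ σ, V, hς, hς0, hlift, ?_, hb ▸ hsnd, hb ▸ hb0, hV, hb ▸ hVd, hV0, hVl, hVr⟩
  filter_upwards [hRl] with z hz v hv
  rw [Function.comp_apply, ← hv, hz]

/-- Solutions of `w' = slope (s, w)` close to the axis of the strip are lines of the foliation. -/
theorem IsStrip.exists_isLine_of_solution (hS : IsRegularSurface α N)
    (hc : IsUnitLine κ α N c Set.univ) (hΦ : IsStrip α N c Φ I) (hI : IsOpen I) {s₁ s₂ : ℝ}
    (hs : Set.Icc s₁ s₂ ⊆ I) : ∃ ε > 0, ∀ w : ℝ → ℝ,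
      (∀ s ∈ Set.Ioo s₁ s₂, HasDerivAt w (slope κ α N Φ (s, w s)) s ∧ |w s| < ε) → ∀ s₀ : ℝ,
      IsLine κ α N (fun t => Φ (s₀ + t, w (s₀ + t))) (Set.Ioo (s₁ - s₀) (s₂ - s₀)) ∧
        ∀ t ∈ Set.Ioo (s₁ - s₀) (s₂ - s₀), deriv (α ∘ fun t => Φ (s₀ + t, w (s₀ + t))) t =
          fderiv ℝ (α ∘ Φ) (s₀ + t, w (s₀ + t)) (1, slope κ α N Φ (s₀ + t, w (s₀ + t))) := by
  have h4 : IsManifold (𝓡 2) (4 : WithTop ℕ∞) M := IsManifold.of_le (n := ∞) (by norm_cast)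
  obtain ⟨ε, hε, htube⟩ := exists_tube (isCompact_Icc (a := s₁) (b := s₂))
    (Q := fun z => (ContMDiffAt 𝓘(ℝ, ℝ × ℝ) (𝓡 2) 4 Φ z ∧ ContinuousAt (slope κ α N Φ) z) ∧
      IsDir κ α N (Φ z) (mfderiv 𝓘(ℝ, ℝ × ℝ) (𝓡 2) Φ z ((1, slope κ α N Φ z) : ℝ × ℝ)))
    fun s hs' => by
      have hsI := hs hs'
      have hev : ∀ᶠ z in 𝓝 (s, (0 : ℝ)), ContMDiffAt 𝓘(ℝ, ℝ × ℝ) (𝓡 2) 4 Φ z :=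
        (contMDiffAt_iff_contMDiffAt_nhds (by simp)).1 (hΦ.smooth s hsI)
      exact (hev.and (((hΦ.contDiffAt_slope hS hc hI hsI).eventually (by simp)).mono
        fun z hz => hz.continuousAt)).and
        (hΦ.eventually_isDir hS hc hI hsI (hc.nonumbilic s (Set.mem_univ s)))
  refine ⟨ε, hε, fun w hw s₀ => ?_⟩
  have hwc : ContDiffOn ℝ 1 w (Set.Ioo s₁ s₂) := by
    rw [← zero_add (1 : WithTop ℕ∞), contDiffOn_succ_iff_deriv_of_isOpen isOpen_Ioo]
    refine ⟨fun s hs' => (hw s hs').1.differentiableAt.differentiableWithinAt, by simp, ?_⟩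
    rw [contDiffOn_zero]
    intro s hs'
    have h1 := (htube s (Set.Ioo_subset_Icc_self hs') _ (hw s hs').2).1.2
    have h2 : ContinuousAt (fun s => slope κ α N Φ (s, w s)) s :=
      ContinuousAt.comp (f := fun s => (s, w s)) h1
        (continuousAt_id.prodMk (hw s hs').1.continuousAt)
    refine h2.continuousWithinAt.congr (fun x hx => (hw x hx).1.deriv) (hw s hs').1.deriv
  let u : ℝ → ℝ × ℝ := fun t => (s₀ + t, w (s₀ + t))
  have hmem : ∀ t ∈ Set.Ioo (s₁ - s₀) (s₂ - s₀), s₀ + t ∈ Set.Ioo s₁ s₂ := fun t ht =>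
    ⟨by linarith [ht.1], by linarith [ht.2]⟩
  have hQ := fun t ht => htube (s₀ + t) (Set.Ioo_subset_Icc_self (hmem t ht)) _
    (hw _ (hmem t ht)).2
  have hu : ∀ t ∈ Set.Ioo (s₁ - s₀) (s₂ - s₀), ContDiffAt ℝ 1 u t := fun t ht => by
    have h1 : ContDiffAt ℝ 1 w (s₀ + t) := hwc.contDiffAt (isOpen_Ioo.mem_nhds (hmem t ht))
    have h2 : ContDiffAt ℝ 1 (fun t => s₀ + t) t := by fun_prop
    exact h2.prodMk (h1.comp t h2)
  have hud : ∀ t ∈ Set.Ioo (s₁ - s₀) (s₂ - s₀),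
      HasDerivAt u (1, slope κ α N Φ (s₀ + t, w (s₀ + t))) t := fun t ht => by
    have h1 : HasDerivAt (fun t => s₀ + t) 1 t := (hasDerivAt_id' t).const_add s₀
    exact h1.prodMk ((hw _ (hmem t ht)).1.comp_const_add s₀ t)
  have hvel : ∀ t ∈ Set.Ioo (s₁ - s₀) (s₂ - s₀), velocity (Φ ∘ u) t =
      mfderiv 𝓘(ℝ, ℝ × ℝ) (𝓡 2) Φ (u t) ((1, slope κ α N Φ (u t)) : ℝ × ℝ) := fun t ht => by
    have e : velocity (Φ ∘ u) t = mfderiv 𝓘(ℝ, ℝ × ℝ) (𝓡 2) Φ (u t) (fderiv ℝ u t 1) := by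
      rw [velocity, mfderiv_comp t ((hQ t ht).1.1.mdifferentiableAt (by simp))
        ((hu t ht).contMDiffAt.mdifferentiableAt (by simp)), mfderiv_eq_fderiv]
      rfl
    rw [e, fderiv_apply_one_eq_deriv, (hud t ht).deriv]
  refine ⟨?_, fun t ht => ?_⟩
  · refine ⟨fun t ht => ?_, fun t ht => ?_, fun t ht => (hQ t ht).2.elliptic,
      fun t ht => (hQ t ht).2.nonumbilic, fun t ht => ?_, fun t ht => ?_⟩
    · exact ContMDiffAt.contMDiffWithinAt (ContMDiffAt.comp (g := Φ) (f := u) t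
        ((hQ t ht).1.1.of_le (by norm_num)) (hu t ht).contMDiffAt)
    · exact (hvel t ht).symm ▸ (hQ t ht).2.ne_zero
    · exact (hvel t ht).symm ▸ (hQ t ht).2.normalCurv_eq
    · exact (hvel t ht).symm ▸ (hQ t ht).2.torsion_sign
  · exact ((contDiffAt_smooth_comp hS.smooth_five (hQ t ht).1.1).differentiableAt
      (by norm_num)).hasFDerivAt.comp_hasDerivAt t (hud t ht) |>.deriv

end SectionChart

/-! ### Existence of the first return -/

/-- `f = β E + o(β)` with `β(v) = b v + o(v)` and `E` continuous at `0`. The error relative to `β`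
is the form in which `flow_asymptotics` delivers it. -/
theorem hasDerivAt_of_asymptotics {f β E : ℝ → ℝ} {b : ℝ} (hβ : HasDerivAt β b 0) (hβ0 : β 0 = 0)
    (hE : ContinuousAt E 0)
    (h : ∀ η > 0, ∀ᶠ v in 𝓝 (0 : ℝ), |f v - β v * E v| ≤ η * |β v|) :
    HasDerivAt f (b * E 0) 0 := by
  have hf0 : f 0 = 0 := by
    have := (h 1 one_pos).self_of_nhds
    rw [hβ0, zero_mul, sub_zero, abs_zero, mul_zero] at this
    exact abs_nonpos_iff.1 this
  have hO : β =O[𝓝 0] fun v => v - 0 := by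
    have := hβ.isBigO_sub
    simpa only [hβ0, sub_zero] using this
  have h1 : (fun v => f v - β v * E v) =o[𝓝 0] fun v => v - 0 := by
    refine Asymptotics.IsLittleO.trans_isBigO ?_ hO
    rw [Asymptotics.isLittleO_iff]
    exact fun η hη => h η hη
  have h2 : (fun v => β v * (E v - E 0)) =o[𝓝 0] fun v => v - 0 := by
    have h3 : (fun v => E v - E 0) =o[𝓝 0] fun _ => (1 : ℝ) := by
      rw [Asymptotics.isLittleO_one_iff]
      have := hE.tendsto.sub_const (E 0)
      rwa [sub_self] at this
    simpa using hO.mul_isLittleO h3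
  have h3 : (fun v => E 0 * (β v - β 0 - (v - 0) • b)) =o[𝓝 0] fun v => v - 0 :=
    (hasDerivAt_iff_isLittleO.1 hβ).const_mul_left _
  rw [hasDerivAt_iff_isLittleO]
  refine ((h1.add h2).add h3).congr_left fun v => ?_
  rw [hf0, hβ0, smul_eq_mul, smul_eq_mul]
  ring

section ReturnMap

variable {M : Type*} [TopologicalSpace M] [T2Space M] [ChartedSpace E2 M] [IsManifold (𝓡 2) ∞ M]
  {α N : M → E3} {κ : Kind} {c σ : ℝ → M} {Φ : ℝ × ℝ → M} {I : Set ℝ} {L : ℝ}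

/-- Near `(t, 0)` the section is the graph `s = (ς (V w)).1`, which a solution close to the axis
crosses exactly once by `strictMonoOn_sub_graph`. Any meeting with `σ v` lies on that graph by
`eq_of_eq`, hence is this crossing. `ρ` is fixed before `η`. -/
theorem IsSectionChart.exists_crossing {t b : ℝ} {ς : ℝ → ℝ × ℝ} {V : ℝ → ℝ} {p : ℝ × ℝ → ℝ}
    (h : IsSectionChart Φ σ t b ς V) (hp : ContinuousAt p (t, 0)) (hp0 : p (t, 0) = 0) :
    ∃ ρ > 0, ∃ η₀ > 0, ∀ η, 0 < η → η ≤ η₀ → ∃ ε > 0, ∀ w : ℝ → ℝ,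
      (∀ s ∈ Set.Icc (t - η) (t + η),
        HasDerivWithinAt w (p (s, w s)) (Set.Icc (t - η) (t + η)) s ∧ |w s| < ε) →
      ∃ s ∈ Set.Ioo (t - η) (t + η), ς (V (w s)) = (s, w s) ∧ Φ (s, w s) = σ (V (w s)) ∧
        ∀ r ∈ Set.Icc (t - η) (t + η), ∀ v, |v| < ρ → Φ (r, w r) = σ v → r = s := by
  have hςV : ContDiffAt ℝ 1 (fun w => ς (V w)) 0 := by
    have h1 : ContDiffAt ℝ 1 ς (V 0) := by rw [h.param_zero]; exact h.contDiffAt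
    exact h1.comp 0 h.contDiffAt_param
  obtain ⟨η₁, hη₁, hmono⟩ := strictMonoOn_sub_graph (g := fun w => (ς (V w)).1) hp hp0 hςV.fst
    (by simp only [h.param_zero, h.base])
  obtain ⟨ρ, hρ, hleft⟩ := Metric.eventually_nhds_iff.1 h.param_left
  obtain ⟨η₂, hη₂, heq⟩ := Metric.eventually_nhds_iff.1 h.eq_of_eq
  have hVt : Filter.Tendsto V (𝓝 0) (𝓝 0) := by
    have := h.contDiffAt_param.continuousAt.tendsto
    rwa [h.param_zero] at this
  obtain ⟨ε₁, hε₁, hright⟩ := Metric.eventually_nhds_iff.1 (h.param_right.and (hVt.eventually h.lift))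
  refine ⟨ρ, hρ, min η₁ (η₂ / 2), by positivity, fun η hη hηη => ?_⟩
  obtain ⟨ε₂, hε₂, hw₂⟩ := hmono η hη (hηη.trans (min_le_left _ _))
  refine ⟨min ε₁ (min ε₂ η₂), by positivity, fun w hw => ?_⟩
  have hε : ∀ s ∈ Set.Icc (t - η) (t + η), |w s| < ε₁ ∧ |w s| < ε₂ ∧ |w s| < η₂ := fun s hs =>
    have h := (hw s hs).2
    ⟨h.trans_le (min_le_left _ _), h.trans_le ((min_le_right _ _).trans (min_le_left _ _)),
      h.trans_le ((min_le_right _ _).trans (min_le_right _ _))⟩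
  obtain ⟨hm, hcont, hneg, hpos⟩ := hw₂ w fun s hs => ⟨(hw s hs).1, (hε s hs).2.1⟩
  obtain ⟨s, hs, hs0⟩ := intermediate_value_Ioo (by linarith) hcont ⟨hneg, hpos⟩
  have hs' := Set.Ioo_subset_Icc_self hs
  have hws := @hright (w s) (by rw [Real.dist_eq, sub_zero]; exact (hε s hs').1)
  have hs0' : (ς (V (w s))).1 = s := (sub_eq_zero.1 hs0).symm
  have hς : ς (V (w s)) = (s, w s) := Prod.ext hs0' hws.1
  refine ⟨s, hs, hς, hς ▸ hws.2, fun r hr v hv hrv => ?_⟩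
  have hz := @heq (r, w r) (by
    rw [Prod.dist_eq, max_lt_iff, Real.dist_eq, Real.dist_eq, sub_zero]
    refine ⟨?_, (hε r hr).2.2⟩
    have := hηη.trans (min_le_right _ _)
    rw [abs_lt]; constructor <;> linarith [hr.1, hr.2]) v hrv
  have hv' := @hleft v (by rwa [Real.dist_eq, sub_zero])
  have hr0 : r - (ς (V (w r))).1 = 0 := by
    have h1 : w r = (ς v).2 := congrArg Prod.snd hz
    rw [h1, hv', ← hz, sub_self]
  exact hm.injOn hr hs' (hr0.trans hs0.symm)

/-- The cycle is injective on `[0, L)`, so `c s ≠ c 0` for `s` in `[η, L - η]`. The Hausdorff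
property and compactness make this uniform for nearby points of the strip and of the section. -/
theorem IsStrip.exists_avoid (hc : IsCycle κ α N c L) (hΦ : IsStrip α N c Φ I)
    (hσ : IsCrossSection α c σ) {η : ℝ} (hη : 0 < η) (hI : Set.Icc η (L - η) ⊆ I) :
    ∃ ε > 0, ∀ s ∈ Set.Icc η (L - η), ∀ w, |w| < ε → ∀ v, |v| < ε → Φ (s, w) ≠ σ v := by
  have h : ∀ᶠ x in 𝓝 ((0 : ℝ), (0 : ℝ)), ∀ s ∈ Set.Icc η (L - η), Φ (s, x.1) ≠ σ x.2 := by
    refine isCompact_Icc.eventually_forall_of_forall_eventually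
      (P := fun (x : ℝ × ℝ) s => Φ (s, x.1) ≠ σ x.2) fun s hs => ?_
    have h1 : ContinuousAt (fun z : (ℝ × ℝ) × ℝ => Φ (z.2, z.1.1)) (((0 : ℝ), (0 : ℝ)), s) :=
      ContinuousAt.comp (f := fun z : (ℝ × ℝ) × ℝ => (z.2, z.1.1))
        (hΦ.smooth s (hI hs)).continuousAt (by fun_prop)
    have h2 : ContinuousAt (fun z : (ℝ × ℝ) × ℝ => σ z.1.2) (((0 : ℝ), (0 : ℝ)), s) :=
      ContinuousAt.comp (f := fun z : (ℝ × ℝ) × ℝ => z.1.2)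
        hσ.contMDiffAt.continuousAt (by fun_prop)
    refine (h1.prodMk h2).eventually (isClosed_diagonal.isOpen_compl.mem_nhds fun he => ?_)
    replace he : Φ (s, 0) = σ 0 := he
    rw [hΦ.base s (hI hs), hσ.base] at he
    have := hc.injOn ⟨by linarith [hs.1], by linarith [hs.2]⟩ ⟨le_rfl, hc.length_pos⟩ he
    linarith [hs.1]
  obtain ⟨ε, hε, h'⟩ := Metric.eventually_nhds_iff.1 h
  refine ⟨ε, hε, fun s hs w hw v hv => h' (y := (w, v)) ?_ s hs⟩
  rw [Prod.dist_eq, max_lt_iff, Real.dist_eq, Real.dist_eq, sub_zero, sub_zero]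
  exact ⟨hw, hv⟩

/-- Lines starting on the section close to a cycle meet the section again after one turn. -/
theorem IsStrip.exists_return (hS : IsRegularSurface α N) (hc : IsCycle κ α N c L)
    (hΦ : IsStrip α N c Φ (Set.Ioo (-2) (L + 2))) (hσ : IsCrossSection α c σ) {b b' : ℝ}
    {ς ς' : ℝ → ℝ × ℝ} {V V' : ℝ → ℝ} (h : IsSectionChart Φ σ 0 b ς V)
    (h' : IsSectionChart Φ σ L b' ς' V') : ∃ C > 0, ∃ δ > 0, ∀ᶠ v in 𝓝 (0 : ℝ),
      ∃ (w : ℝ → ℝ) (s : ℝ),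
        (∀ r ∈ Set.Icc (-1) (L + 1),
          HasDerivWithinAt w (slope κ α N Φ (r, w r)) (Set.Icc (-1) (L + 1)) r) ∧
        (∀ r ∈ Set.Icc (-1) (L + 1), |w r| ≤ C * |w (ς v).1|) ∧
        w (ς v).1 = (ς v).2 ∧ (ς v).1 ∈ Set.Ioo (-1) s ∧ s ∈ Set.Ioo (-1) (L + 1) ∧
        ς' (V' (w s)) = (s, w s) ∧ Φ (s, w s) = σ (V' (w s)) ∧
        (∀ r ∈ Set.Ioo (ς v).1 s, ∀ u, |u| < δ → Φ (r, w r) ≠ σ u) ∧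
        IsLine κ α N (fun t => Φ ((ς v).1 + t, w ((ς v).1 + t)))
          (Set.Ioo (-1 - (ς v).1) (L + 1 - (ς v).1)) ∧
        Φ (ς v) = σ v ∧
        0 < inner ℝ (deriv (α ∘ fun t => Φ ((ς v).1 + t, w ((ς v).1 + t))) 0)
          (deriv (α ∘ c) 0) := by
  have hu := hc.isUnitLine
  have hL := hc.length_pos
  have hI : IsOpen (Set.Ioo (-2) (L + 2)) := isOpen_Ioo
  have h0 : (0 : ℝ) ∈ Set.Ioo (-2) (L + 2) := ⟨by norm_num, by linarith⟩
  have hLm : L ∈ Set.Ioo (-2) (L + 2) := ⟨by linarith, by linarith⟩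
  have hsub : Set.Icc (-1) (L + 1) ⊆ Set.Ioo (-2) (L + 2) := fun s hs =>
    ⟨by linarith [hs.1], by linarith [hs.2]⟩
  have hp : ∀ s ∈ Set.Ioo (-2) (L + 2), ContDiffAt ℝ 1 (slope κ α N Φ) (s, 0) := fun s hs =>
    (hΦ.contDiffAt_slope hS hu hI hs).of_le (by norm_num)
  have hp0 : ∀ s ∈ Set.Ioo (-2) (L + 2), slope κ α N Φ (s, 0) = 0 := fun s hs =>
    hΦ.slope_base hS hu hI hs
  obtain ⟨ε₁, hε₁, C, hC, hflow⟩ := exists_flow hp hp0 hsub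
  obtain ⟨ε₂, hε₂, hline⟩ := hΦ.exists_isLine_of_solution hS hu hI hsub
  obtain ⟨ρ₀, hρ₀, η₀, hη₀, hcr₀⟩ := h.exists_crossing (hp 0 h0).continuousAt (hp0 0 h0)
  obtain ⟨ρ₁, hρ₁, η₁, hη₁, hcr₁⟩ := h'.exists_crossing (hp L hLm).continuousAt (hp0 L hLm)
  -- One turn is covered by `[-η, η]`, `[η, L - η]` and `[L - η, L + η]`; `η < L / 4` keeps the two
  -- end arcs disjoint, and `η < 1` keeps them inside `[-1, L + 1]`.
  obtain ⟨η, hη, hηlt⟩ := exists_between (show (0 : ℝ) < min (min η₀ η₁) (min 1 (L / 4)) by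
    positivity)
  obtain ⟨⟨hη0, hη1⟩, hη2, hη3⟩ : (η < η₀ ∧ η < η₁) ∧ η < 1 ∧ η < L / 4 := by
    simpa only [lt_min_iff] using hηlt
  obtain ⟨ε₃, hε₃, hcr₀⟩ := hcr₀ η hη hη0.le
  obtain ⟨ε₄, hε₄, hcr₁⟩ := hcr₁ η hη hη1.le
  obtain ⟨ε₅, hε₅, hav⟩ := hΦ.exists_avoid hc hσ hη
    (fun s hs => ⟨by linarith [hs.1], by linarith [hs.2]⟩)
  refine ⟨C, hC, min ρ₀ (min ρ₁ ε₅), by positivity, ?_⟩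
  have hςc := h.contDiffAt.continuousAt
  have hς1 : ∀ᶠ v in 𝓝 (0 : ℝ), (ς v).1 ∈ Set.Ioo (-η) η := by
    have h1 : ContinuousAt (fun v => (ς v).1) 0 := hςc.fst
    refine h1.eventually (isOpen_Ioo.mem_nhds ?_)
    simp only [h.base]
    exact ⟨by linarith, hη⟩
  have hς2 : ∀ ε > 0, ∀ᶠ v in 𝓝 (0 : ℝ), |(ς v).2| < ε := fun ε hε => by
    have h1 : ContinuousAt (fun v => |(ς v).2|) 0 := hςc.snd.abs
    refine h1.eventually_lt continuousAt_const ?_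
    simpa [h.base] using hε
  have hA := contDiffAt_smooth_comp hS.smooth_five (hΦ.smooth 0 h0)
  have hin : ∀ᶠ v in 𝓝 (0 : ℝ),
      0 < inner ℝ (fderiv ℝ (α ∘ Φ) (ς v) (1, slope κ α N Φ (ς v))) (deriv (α ∘ c) 0) := by
    have h1 : ContinuousAt (fun z => inner ℝ (fderiv ℝ (α ∘ Φ) z (1, slope κ α N Φ z))
        (deriv (α ∘ c) 0)) ((0 : ℝ), (0 : ℝ)) :=
      ContinuousAt.inner ((hA.fderiv_right (m := 3) (by norm_num)).continuousAt.clm_apply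
        (continuousAt_const.prodMk (hp 0 h0).continuousAt)) continuousAt_const
    have h2 : ∀ᶠ z in 𝓝 (ς 0), 0 < inner ℝ (fderiv ℝ (α ∘ Φ) z (1, slope κ α N Φ z))
        (deriv (α ∘ c) 0) := by
      rw [h.base]
      refine continuousAt_const.eventually_lt h1 ?_
      rw [hp0 0 h0, hΦ.fderiv_base hS.smooth_five hI h0]
      have := inner_tang_self hS hu 0
      rw [tang] at this
      rw [this]
      exact one_pos
    exact hςc.eventually h2
  have hρv : ∀ᶠ v in 𝓝 (0 : ℝ), |v| < ρ₀ :=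
    continuous_abs.continuousAt.eventually_lt continuousAt_const (by simpa using hρ₀)
  filter_upwards [hς1, hς2 ε₁ hε₁, hς2 (min ε₂ (min ε₃ (min ε₄ ε₅)) / C) (by positivity), hin,
    h.lift, hρv] with v hv1 hv2 hv3 hv4 hv5 hv6
  have hs0 : (ς v).1 ∈ Set.Icc (-1) (L + 1) := ⟨by linarith [hv1.1], by linarith [hv1.2]⟩
  obtain ⟨w, hw0, hw, hwC⟩ := hflow (ς v).1 hs0 (ς v).2 hv2
  have hwε : ∀ r ∈ Set.Icc (-1) (L + 1), |w r| < ε₂ ∧ |w r| < ε₃ ∧ |w r| < ε₄ ∧ |w r| < ε₅ :=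
    fun r hr => by
      rw [lt_div_iff₀ hC, mul_comm] at hv3
      simpa only [lt_min_iff] using (hwC r hr).trans_lt hv3
  have hsub0 : Set.Icc (0 - η) (0 + η) ⊆ Set.Icc (-1) (L + 1) :=
    Set.Icc_subset_Icc (by linarith) (by linarith)
  have hsub1 : Set.Icc (L - η) (L + η) ⊆ Set.Icc (-1) (L + 1) :=
    Set.Icc_subset_Icc (by linarith) (by linarith)
  obtain ⟨s₀, hs₀, -, -, huniq₀⟩ := hcr₀ w fun r hr =>
    ⟨(hw r (hsub0 hr)).mono hsub0, (hwε r (hsub0 hr)).2.1⟩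
  obtain ⟨s, hs, hςs, hΦs, huniq₁⟩ := hcr₁ w fun r hr =>
    ⟨(hw r (hsub1 hr)).mono hsub1, (hwε r (hsub1 hr)).2.2.1⟩
  have hpt : ((ς v).1, w (ς v).1) = ς v := by rw [hw0]
  -- The starting point lies on the section, so it is the unique crossing near `s = 0`, and the
  -- solution does not meet the section again on that arc.
  have hs₀eq : (ς v).1 = s₀ := huniq₀ _ ⟨by linarith [hv1.1], by linarith [hv1.2]⟩ v hv6
    (by rw [hpt, hv5])
  have hsm : s ∈ Set.Ioo (-1) (L + 1) := ⟨by linarith [hs.1], by linarith [hs.2]⟩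
  have hl := hline w (fun r hr => ⟨(hw r (Set.Ioo_subset_Icc_self hr)).hasDerivAt
    (Icc_mem_nhds hr.1 hr.2), (hwε r (Set.Ioo_subset_Icc_self hr)).1⟩) (ς v).1
  refine ⟨w, s, hw, fun r hr => hw0.symm ▸ hwC r hr, hw0,
    ⟨by linarith [hv1.1], by linarith [hv1.2, hs.1]⟩, hsm, hςs, hΦs, fun r hr u hu' he => ?_, hl.1,
    hv5, ?_⟩
  -- No earlier meeting: uniqueness of the crossing excludes it on the two end arcs, `exists_avoid`
  -- on the middle one.
  · simp only [lt_min_iff] at hu'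
    rcases le_total r η with h1 | h1
    · have := huniq₀ r ⟨by linarith [hv1.1, hr.1], by linarith⟩ u hu'.1 he
      linarith [hr.1]
    · rcases le_total r (L - η) with h2 | h2
      · exact hav r ⟨h1, h2⟩ _ (hwε r ⟨by linarith, by linarith⟩).2.2.2 u hu'.2.2 he
      · have := huniq₁ r ⟨h2, by linarith [hr.2, hs.2]⟩ u hu'.2.1 he
        linarith [hr.2]
  · rw [hl.2 0 ⟨by linarith [hv1.1], by linarith [hv1.2]⟩, add_zero, hpt]
    exact hv4

end ReturnMap

/-! ### The derivative of the return map -/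

section Derivative

variable {M : Type*} [TopologicalSpace M] [T2Space M] [ChartedSpace E2 M] [IsManifold (𝓡 2) ∞ M]
  {α N : M → E3} {κ : Kind} {c σ : ℝ → M} {Φ : ℝ × ℝ → M} {I : Set ℝ} {L : ℝ}

theorem continuousAt_integral {g : ℝ → ℝ} (hI : IsOpen I) (hIc : I.OrdConnected)
    (hg : ContinuousOn g I) {x y : ℝ → ℝ} {v : ℝ} (hx : ContinuousAt x v) (hy : ContinuousAt y v)
    (hxv : x v ∈ I) (hyv : y v ∈ I) : ContinuousAt (fun v => ∫ r in x v..y v, g r) v := by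
  have hint : ∀ s ∈ I, ∀ t ∈ I, IntervalIntegrable g MeasureTheory.volume s t := fun s hs t ht =>
    (hg.mono (hIc.uIcc_subset hs ht)).intervalIntegrable
  have hG : ∀ s ∈ I, ContinuousAt (fun s => ∫ r in x v..s, g r) s := fun s hs =>
    (intervalIntegral.integral_hasDerivAt_right (hint _ hxv s hs)
      (hg.stronglyMeasurableAtFilter hI s hs) (hg.continuousAt (hI.mem_nhds hs))).continuousAt
  have h1 := (ContinuousAt.comp (f := y) (hG _ hyv) hy).sub (ContinuousAt.comp (f := x) (hG _ hxv) hx)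
  refine h1.congr ?_
  filter_upwards [hx.eventually (hI.mem_nhds hxv), hy.eventually (hI.mem_nhds hyv)] with u hu hu'
  exact intervalIntegral.integral_interval_sub_left (hint _ hxv _ hu') (hint _ hxv _ hu)

/-- The first return map of a cycle exists, and its derivative is given by the linearization of the
equation of the lines along the cycle. -/
theorem IsStrip.exists_isReturnMap (hS : IsRegularSurface α N) (hc : IsCycle κ α N c L)
    (hΦ : IsStrip α N c Φ (Set.Ioo (-2) (L + 2))) (hσ : IsCrossSection α c σ) :
    (∃ ε > 0, Set.InjOn σ (Set.Ioo (-ε) ε)) ∧ ∃ P : ℝ → ℝ, IsReturnMap κ α N c σ P ∧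
      HasDerivAt P (Real.exp (∫ s in (0 : ℝ)..L, fderiv ℝ (slope κ α N Φ) (s, 0) (0, 1))) 0 := by
  have hu := hc.isUnitLine
  have hL := hc.length_pos
  have hI : IsOpen (Set.Ioo (-2) (L + 2)) := isOpen_Ioo
  have h0 : (0 : ℝ) ∈ Set.Ioo (-2) (L + 2) := ⟨by norm_num, by linarith⟩
  have hLm : L ∈ Set.Ioo (-2) (L + 2) := ⟨by linarith, by linarith⟩
  have hsub : Set.Icc (-1) (L + 1) ⊆ Set.Ioo (-2) (L + 2) := fun s hs =>
    ⟨by linarith [hs.1], by linarith [hs.2]⟩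
  have hp : ∀ s ∈ Set.Ioo (-2) (L + 2), ContDiffAt ℝ 1 (slope κ α N Φ) (s, 0) := fun s hs =>
    (hΦ.contDiffAt_slope hS hu hI hs).of_le (by norm_num)
  have hp0 : ∀ s ∈ Set.Ioo (-2) (L + 2), slope κ α N Φ (s, 0) = 0 := fun s hs =>
    hΦ.slope_base hS hu hI hs
  have hgc : ContinuousOn (fun s => fderiv ℝ (slope κ α N Φ) (s, 0) (0, 1))
      (Set.Ioo (-2) (L + 2)) := fun s hs => by
    have h1 : ContinuousAt (fun s : ℝ => (s, (0 : ℝ))) s := by fun_prop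
    exact (ContinuousAt.comp (f := fun s : ℝ => (s, (0 : ℝ)))
      (g := fun z => fderiv ℝ (slope κ α N Φ) z (0, 1))
      (((hp s hs).fderiv_right (m := 0) (by norm_num)).continuousAt.clm_apply continuousAt_const)
      h1).continuousWithinAt
  have hcL : c L = c 0 := by simpa using hc.periodic 0
  have htL : tang α c L = tang α c 0 := by
    have h1 : (fun s => (α ∘ c) (s + L)) = α ∘ c := funext fun s => congrArg α (hc.periodic s)
    have h2 := deriv_comp_add_const (f := α ∘ c) L 0
    rw [h1, zero_add] at h2
    exact h2.symm
  obtain ⟨ς, V, h⟩ := hΦ.exists_isSectionChart hS hu hI h0 hσ rfl rfl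
  obtain ⟨ς', V', h'⟩ := hΦ.exists_isSectionChart hS hu hI hLm hσ hcL htL
  set b := inner ℝ (conormal α N c 0) (deriv (α ∘ σ) 0) with hb
  obtain ⟨C, hC, δ₀, hδ₀, hret⟩ := hΦ.exists_return hS hc hσ h h'
  refine ⟨?_, ?_⟩
  -- Two parameters with the same point on the section have the same coordinates by `eq_of_eq`, and
  -- `V` recovers the parameter from the second coordinate.
  · obtain ⟨ε, hε, hl⟩ := Metric.eventually_nhds_iff.1
      ((hret.and h.param_left).and
        (h.contDiffAt.continuousAt.eventually (by rw [h.base]; exact h.eq_of_eq)))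
    refine ⟨ε, hε, fun x hx y hy hxy => ?_⟩
    have hx' := @hl x (by rw [Real.dist_eq, sub_zero]; exact abs_lt.2 hx)
    have hy' := @hl y (by rw [Real.dist_eq, sub_zero]; exact abs_lt.2 hy)
    obtain ⟨_, _, _, _, _, _, _, _, _, _, _, hσx, _⟩ := hx'.1.1
    have e := hx'.2 y (hσx.trans hxy)
    rw [← hx'.1.2, e, hy'.1.2]
  obtain ⟨w, hw⟩ := hret.choice
  obtain ⟨s, hs⟩ := hw.choice
  -- The height `w` at which the solution issuing from `σ v` arrives; the return map is this height
  -- expressed in the parameter of the section by `V'`.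
  set f : ℝ → ℝ := fun v => w v (s v) with hf
  have hbound : ∀ᶠ v in 𝓝 (0 : ℝ), |f v| ≤ C * |(ς v).2| := by
    filter_upwards [hs] with v hv
    obtain ⟨-, h1, h2, -, h3, -⟩ := hv
    rw [← h2]
    exact h1 _ (Set.Ioo_subset_Icc_self h3)
  have hς2 : ContinuousAt (fun v => |(ς v).2|) 0 := h.contDiffAt.continuousAt.snd.abs
  have hf0 : f 0 = 0 := by
    have := hbound.self_of_nhds
    rw [h.base, abs_zero, mul_zero] at this
    exact abs_nonpos_iff.1 this
  have hfc : ContinuousAt f 0 := by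
    rw [ContinuousAt, hf0]
    refine squeeze_zero_norm' hbound ?_
    have := hς2.tendsto.const_mul C
    rwa [h.base, abs_zero, mul_zero] at this
  have hVc : ContinuousAt (fun v => V' (f v)) 0 :=
    ContinuousAt.comp (g := V') (by rw [hf0]; exact h'.contDiffAt_param.continuousAt) hfc
  have hP0 : V' (f 0) = 0 := by rw [hf0, h'.param_zero]
  -- The arrival time was obtained by choice. Near `v = 0` it equals the first coordinate of `ς' (V'
  -- (f v))`, which is continuous at `0` because `f` is.
  have hyc : ContinuousAt (fun v => (ς' (V' (f v))).1) 0 :=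
    (ContinuousAt.comp (g := ς') (f := fun v => V' (f v))
      (by rw [hP0]; exact h'.contDiffAt.continuousAt) hVc).fst
  have hy0 : (ς' (V' (f 0))).1 = L := by rw [hP0, h'.base]
  have hx0 : (ς 0).1 = 0 := by rw [h.base]
  have hEc : ContinuousAt (fun v => Real.exp (∫ r in (ς v).1..(ς' (V' (f v))).1,
      fderiv ℝ (slope κ α N Φ) (r, 0) (0, 1))) 0 :=
    Real.continuous_exp.continuousAt.comp (continuousAt_integral hI Set.ordConnected_Ioo hgc
      h.contDiffAt.continuousAt.fst hyc (by rwa [hx0]) (by rwa [hy0]))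
  have hfd := hasDerivAt_of_asymptotics (f := f) h.hasDerivAt (by rw [h.base]) hEc fun η hη => by
    obtain ⟨ε, hε, hflow⟩ := flow_asymptotics hI hp hp0 hsub hC hη
    have hlt : ∀ᶠ v in 𝓝 (0 : ℝ), |(ς v).2| < ε :=
      hς2.eventually_lt continuousAt_const (by simpa [h.base] using hε)
    filter_upwards [hs, hlt] with v hv hlt
    obtain ⟨h1, h2, h3, h4, h5, h6, -⟩ := hv
    have h7 := hflow (w v) h1 (ς v).1 ⟨h4.1.le, (h4.2.trans h5.2).le⟩ (by rwa [h3]) h2 (s v)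
      (Set.Ioo_subset_Icc_self h5)
    rw [h3] at h7
    simpa only [hf, h6] using h7
  simp only [hx0, hy0] at hfd
  refine ⟨fun v => V' (f v), ?_, ?_⟩
  · filter_upwards [Ioo_mem_nhdsGT hδ₀] with δ hδ
    have hPδ : ∀ᶠ v in 𝓝 (0 : ℝ), V' (f v) ∈ Set.Ioo (-δ) δ :=
      hVc.eventually (isOpen_Ioo.mem_nhds (by
        simp only [hP0]; exact ⟨neg_lt_zero.2 hδ.1, hδ.1⟩))
    filter_upwards [hs, hPδ] with v hv hPv
    obtain ⟨-, -, h3, h4, h5, -, h6, h7, h8, h9, h10⟩ := hv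
    refine ⟨_, _, _, s v - (ς v).1, by linarith [h4.1], by linarith [h4.2], by linarith [h5.2], h8,
      ?_, h10, hPv, ?_, ?_⟩
    · simp only [add_zero]
      rw [h3, h9]
    · simp only [add_sub_cancel]
      exact h6
    · rintro t ht ⟨u, hu', he⟩
      exact h7 ((ς v).1 + t) ⟨by linarith [ht.1], by linarith [ht.2]⟩ u
        ((abs_lt.2 hu').trans hδ.2) he.symm
  · have h1 : HasDerivAt V' b⁻¹ (f 0) := by rw [hf0]; exact h'.hasDerivAt_param
    -- Leaving the section contributes the factor `b` and arriving on it `b⁻¹`, with the same `b`.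
    refine (h1.comp 0 hfd).congr_deriv ?_
    rw [inv_mul_cancel_left₀ h.ne_zero]

end Derivative

/-! ### Comparison of the integrals -/

section Integral

variable {M : Type*} [TopologicalSpace M] [ChartedSpace E2 M] [IsManifold (𝓡 2) ∞ M]
  {α N : M → E3} {κ : Kind} {c : ℝ → M} {Φ : ℝ × ℝ → M} {L : ℝ}

theorem IsCycle.torsion_periodic (hS : IsRegularSurface α N) (hc : IsCycle κ α N c L) :
    Function.Periodic (torsion α N c) L := fun s => by
  have h : ∀ f : M → E3, deriv (f ∘ c) (s + L) = deriv (f ∘ c) s := fun f => by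
    have h1 : (fun s => (f ∘ c) (s + L)) = f ∘ c := funext fun s => congrArg f (hc.periodic s)
    have h2 := deriv_comp_add_const (f := f ∘ c) L s
    rw [h1] at h2
    exact h2.symm
  rw [torsion_eq hS hc.isUnitLine, torsion_eq hS hc.isUnitLine, conormal, conormal, tang, tang, h,
    h, hc.periodic]

/-- The integrand has the periodic primitive `(1/2) log |τ|`. `Real.log` already is the logarithm of
the absolute value, so both foliations are covered. -/
theorem IsCycle.integral_logDeriv_torsion (hS : IsRegularSurface α N) (hc : IsCycle κ α N c L) :
    IntervalIntegrable (fun s => deriv (torsion α N c) s / (2 * torsion α N c s))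
      MeasureTheory.volume 0 L ∧
    ∫ s in (0 : ℝ)..L, deriv (torsion α N c) s / (2 * torsion α N c s) = 0 := by
  have hτ := contDiff_torsion hS hc.isUnitLine
  have h0 := torsion_ne_zero hc.isUnitLine
  have hint : IntervalIntegrable (fun s => deriv (torsion α N c) s / (2 * torsion α N c s))
      MeasureTheory.volume 0 L :=
    ((hτ.continuous_deriv (by norm_num)).div (continuous_const.mul hτ.continuous)
      fun s => mul_ne_zero two_ne_zero (h0 s)).intervalIntegrable _ _
  refine ⟨hint, ?_⟩
  have hd : ∀ s ∈ Set.uIcc 0 L, HasDerivAt (fun s => Real.log (torsion α N c s) / 2)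
      (deriv (torsion α N c) s / (2 * torsion α N c s)) s := fun s _ => by
    refine (((hτ.differentiable (by norm_num) s).hasDerivAt.log (h0 s)).div_const 2).congr_deriv ?_
    rw [div_div, mul_comm]
  rw [intervalIntegral.integral_eq_sub_of_hasDerivAt hd hint]
  have := hc.torsion_periodic hS 0
  rw [zero_add] at this
  rw [this, sub_self]

/-- By `IsStrip.fderiv_slope` the integrand is the continuous function `p_w` plus `τ' / (2τ)`; this
gives integrability, and the second term has zero integral. -/
theorem IsStrip.integral_returnIntegrand (hS : IsRegularSurface α N) (hc : IsCycle κ α N c L)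
    (hΦ : IsStrip α N c Φ (Set.Ioo (-2) (L + 2))) :
    IntervalIntegrable (returnIntegrand α N c) MeasureTheory.volume 0 L ∧
    ∫ s in (0 : ℝ)..L, returnIntegrand α N c s
      = ∫ s in (0 : ℝ)..L, fderiv ℝ (slope κ α N Φ) (s, 0) (0, 1) := by
  have hu := hc.isUnitLine
  have hsub : Set.uIcc 0 L ⊆ Set.Ioo (-2) (L + 2) := by
    rw [Set.uIcc_of_le hc.length_pos.le]
    exact fun s hs => ⟨by linarith [hs.1], by linarith [hs.2]⟩
  obtain ⟨hτ, hτ0⟩ := hc.integral_logDeriv_torsion hS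
  have hg : IntervalIntegrable (fun s => fderiv ℝ (slope κ α N Φ) (s, 0) (0, 1))
      MeasureTheory.volume 0 L := by
    refine ContinuousOn.intervalIntegrable fun s hs => ?_
    have h1 : ContinuousAt (fun s : ℝ => (s, (0 : ℝ))) s := by fun_prop
    exact (ContinuousAt.comp (f := fun s : ℝ => (s, (0 : ℝ)))
      (g := fun z => fderiv ℝ (slope κ α N Φ) z (0, 1))
      (((hΦ.contDiffAt_slope hS hu isOpen_Ioo (hsub hs)).fderiv_right (m := 2)
        (by norm_num)).continuousAt.clm_apply continuousAt_const) h1).continuousWithinAt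
  have heq : ∀ s ∈ Set.uIcc 0 L, fderiv ℝ (slope κ α N Φ) (s, 0) (0, 1)
      + deriv (torsion α N c) s / (2 * torsion α N c s) = returnIntegrand α N c s := fun s hs => by
    rw [hΦ.fderiv_slope hS hu isOpen_Ioo (hsub hs)]
    ring
  refine ⟨(hg.add hτ).congr fun s hs => heq s (Set.uIoc_subset_uIcc hs), ?_⟩
  rw [← intervalIntegral.integral_congr heq, intervalIntegral.integral_add hg hτ, hτ0, add_zero]

end Integral

end GeomMeanCurv

end

/-! ### Conclusion -/

theorem proposition3 {M : Type*} [TopologicalSpace M] [T2Space M] [ChartedSpace E2 M]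
    [IsManifold (𝓡 2) ∞ M]
    (r : ℕ∞) (hr : 6 ≤ r) (α : M → E3) (hα : IsImmersionOfClass r α)
    (N : M → E3) (hN : IsUnitNormal α N)
    (κ : Kind) (c : ℝ → M) (L : ℝ) (hc : IsCycle κ α N c L) :
    (∀ s : ℝ, geodTorsion α N (c s) (velocity c s) =
      κ.sign * (gaussCurv α N (c s) ^ (1 / 4 : ℝ)
        * √(2 * meanCurv α N (c s) - 2 * √(gaussCurv α N (c s))))) ∧
    IntervalIntegrable (returnIntegrand α N c) MeasureTheory.volume 0 L ∧
    ∀ σ : ℝ → M, IsCrossSection α c σ →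
      (∃ P : ℝ → ℝ, IsReturnMap κ α N c σ P) ∧
      ∀ P : ℝ → ℝ, IsReturnMap κ α N c σ P →
        P 0 = 0 ∧
        ∃ d : ℝ, 0 < d ∧ HasDerivAt P d 0 ∧
          Real.log d = ∫ s in (0 : ℝ)..L, returnIntegrand α N c s := by
  have hS := IsRegularSurface.of hr hα hN
  have hu := hc.isUnitLine
  -- The margin beyond `[0, L]` leaves room for both crossings of the section, near `s = 0` and near
  -- `s = L`.
  obtain ⟨Φ, hΦ⟩ := exists_isStrip hS hu (-2) (L + 2)
  obtain ⟨hint, hval⟩ := hΦ.integral_returnIntegrand hS hc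
  refine ⟨fun s => geodTorsion_eq (hS.injective _) (hS.norm_eq_one _) (hS.orthogonal _) (hS.symm _)
    (hu.unit_speed s (Set.mem_univ s)) (hu.elliptic s (Set.mem_univ s))
    (hu.normalCurv_eq s (Set.mem_univ s)) (hu.torsion_sign s (Set.mem_univ s)), hint,
    fun σ hσ => ?_⟩
  obtain ⟨hinj, Q, hQ, hQd⟩ := hΦ.exists_isReturnMap hS hc hσ
  -- An arbitrary return map inherits the derivative of the constructed one, since their germs
  -- agree.
  refine ⟨⟨Q, hQ⟩, fun P hP => ⟨hP.apply_zero, _, Real.exp_pos _,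
    hQd.congr_of_eventuallyEq (hP.eventuallyEq hS hinj hQ), ?_⟩⟩
  rw [Real.log_exp, hval]
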